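/- Let $V$ be a connected smooth manifold (Hausdorff, second countable, without boundary, not necessarily closed) with a contact form $\lambda$ whose Reeb vector field generates a circle action $e_t$, $t\in S^1=\mathbb R/\mathbb Z$. Let $\mathcal G_c$ be the identity component of the group of compactly supported contactomorphisms of $(V,\ker\lambda)$ (diffeomorphisms preserving the co-oriented contact structure), let $\mathcal G_e$ be the group of contactomorphisms of the form $e_t\circ\phi$ with $\phi\in\mathcal G_c$, and let $\widetilde{\mathcal G}_e$ be its universal cover, i.e. the group of homotopy classes with fixed endpoints of smooth paths $\{f_t\}_{t\in[0,1]}$ in $\mathcal G_e$ with $f_0=\mathrm{id}$, under pointwise composition. (Smoothness of a path or homotopy includes that, outside a compact set independent of the parameters, it equals $e_c$ for a smooth real function $c$ of the parameters.) Let $SV=(V\times\mathbb R_+,\,d(s\lambda))$ be the symplectization and $\mathrm{Stab}(SV)=(SV\times T^*S^1,\ d(s\lambda+r\,dt))$, with $\mathbb R_+$ acting by $c\cdot(x,s)=(x,cs)$ and $c\cdot(x,s,r,t)=(x,cs,cr,t)$. The Hamiltonian vector field of $H$ for an exact symplectic form $\omega$ is given by $\omega(X_H,\cdot)=-dH$.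 For $X\subset SV$ let $\mathrm{Stab}(X)=X\times S^1$, with $S^1=\{r=0\}\subset T^*S^1$. A pair $(A,B)$ of closed subsets of $SV$, with $B$ compact, has the stable intersection property if $\Phi(\mathrm{Stab}(A))\cap\mathrm{Stab}(B)\neq\emptyset$ for every $\mathbb R_+$-equivariant Hamiltonian diffeomorphism $\Phi$ of $\mathrm{Stab}(SV)$, i.e. for the time-one map $\Phi$ of the flow of every smooth time-dependent Hamiltonian $H_\tau$ on $\mathrm{Stab}(SV)$ with complete flow and $H_\tau(c\cdot z)=cH_\tau(z)$ for all $c>0$. The contact Hamiltonian of a path $\{f_t\}$ is the function $F_t:SV\to\mathbb R$ with $F_t(c\cdot z)=cF_t(z)$ whose Hamiltonian flow on $SV$ projects to $f_t$ on $V$. For $f,g\in\widetilde{\mathcal G}_e$ write $f\succeq\mathrm{id}$ if the class $f$ contains a path with contact Hamiltonian $F_t\ge 0$ for all $t\in[0,1]$, and $f\succeq g$ if $fg^{-1}\succeq\mathrm{id}$. **Theorem.** Suppose that $SV$ contains a pair $(A,B)$ with the stable intersection property. Then $\succeq$ is a bi-invariant partial order on $\widetilde{\mathcal G}_e$: it is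 reflexive, transitive and antisymmetric, and $f\succeq g$, $a\succeq b$ imply $fa\succeq gb$. -/

import Mathlib

open Set
open scoped Manifold ContDiff

noncomputable section

namespace ContactOrder

section Calculus

variable {F : Type*} [NormedAddCommGroup F] [NormedSpace ℝ F]
  {H : Type*} [TopologicalSpace H] (I : ModelWithCorners ℝ F H)
  {M : Type*} [TopologicalSpace M] [ChartedSpace H M]

/-- A (not necessarily smooth) differential 1-form on a manifold. -/
abbrev OneForm (M : Type*) [TopologicalSpace M] [ChartedSpace H M] : Type _ :=
  ∀ x : M, TangentSpace I x →L[ℝ] ℝ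

variable {I}

/-- A 1-form is smooth if it is smooth as a fibrewise linear function on the tangent bundle. -/
def OneForm.IsSmooth [IsManifold I ∞ M] (α : OneForm I M) : Prop :=
  ContMDiff I.tangent 𝓘(ℝ, ℝ) ∞ (fun p : TangentBundle I M => α p.1 p.2)

/-- The expression of a 1-form in the preferred chart around `x`, a 1-form on the model space
(its pullback under the inverse of the chart). -/
def OneForm.inChart (α : OneForm I M) (x : M) (y : F) : F →L[ℝ] ℝ :=
  (α ((extChartAt I x).symm y)).comp (mfderiv 𝓘(ℝ, F) I (extChartAt I x).symm y)

/-- The exterior derivative `dα` of a 1-form on a manifold without boundary, at the point `x`: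
`dα (v, w) = (D_v α) w - (D_w α) v` in the preferred chart around `x`, through which the tangent
space at `x` is identified with the model space. -/
def OneForm.d (α : OneForm I M) (x : M) (v w : TangentSpace I x) : ℝ :=
  (show F →L[ℝ] F →L[ℝ] ℝ from fderiv ℝ (α.inChart x) (extChartAt I x x)) v w -
    (show F →L[ℝ] F →L[ℝ] ℝ from fderiv ℝ (α.inChart x) (extChartAt I x x)) w v

variable (I)

/-- The velocity vector at time `t` of a curve in a manifold. -/
def velocity (γ : ℝ → M) (t : ℝ) : TangentSpace I (γ t) :=
  mfderiv 𝓘(ℝ, ℝ) I γ t (1 : ℝ)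

/-- A family of bijections of `M`, indexed by a normed space, is a smooth family of
diffeomorphisms if the maps and their inverses depend smoothly on the parameter and the point
jointly. -/
def IsSmoothFamily {P : Type*} [NormedAddCommGroup P] [NormedSpace ℝ P]
    (f : P → Equiv.Perm M) : Prop :=
  ContMDiff (𝓘(ℝ, P).prod I) I ∞ (fun q : P × M => f q.1 q.2) ∧
    ContMDiff (𝓘(ℝ, P).prod I) I ∞ (fun q : P × M => (f q.1).symm q.2)

variable {I}

namespace IsSmoothFamily

variable {P : Type*} [NormedAddCommGroup P] [NormedSpace ℝ P] {f g : P → Equiv.Perm M}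

theorem one : IsSmoothFamily I (1 : P → Equiv.Perm M) := ⟨contMDiff_snd, contMDiff_snd⟩

theorem mul (hf : IsSmoothFamily I f) (hg : IsSmoothFamily I g) : IsSmoothFamily I (f * g) :=
  ⟨hf.1.comp (contMDiff_fst.prodMk hg.1), hg.2.comp (contMDiff_fst.prodMk hf.2)⟩

theorem inv (hf : IsSmoothFamily I f) : IsSmoothFamily I f⁻¹ := ⟨hf.2, hf.1⟩

theorem comp (hf : IsSmoothFamily I f) {Q : Type*} [NormedAddCommGroup Q] [NormedSpace ℝ Q]
    {σ : Q → P} (hσ : ContDiff ℝ ∞ σ) : IsSmoothFamily I (fun q => f (σ q)) := by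
  have h : ContMDiff (𝓘(ℝ, Q).prod I) (𝓘(ℝ, P).prod I) ∞ (fun q : Q × M => (σ q.1, q.2)) :=
    (hσ.contMDiff.comp contMDiff_fst).prodMk contMDiff_snd
  exact ⟨hf.1.comp h, hf.2.comp h⟩

theorem contMDiff (hf : IsSmoothFamily I f) (p : P) : ContMDiff I I ∞ (f p) :=
  hf.1.comp (contMDiff_const.prodMk contMDiff_id)

end IsSmoothFamily

/-- For the exact symplectic form `dα` on `M`: the isotopy `Ψ` is the flow, starting at the
identity, of the time-dependent Hamiltonian function `h`. The Hamiltonian vector field `X_t` of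
`h_t` is given by `dα (X_t, ·) = - d h_t`. -/
def IsHamiltonianIsotopy (α : OneForm I M) (h : ℝ → M → ℝ) (Ψ : ℝ → Equiv.Perm M) : Prop :=
  ContMDiff (𝓘(ℝ, ℝ).prod I) 𝓘(ℝ, ℝ) ∞ (fun q : ℝ × M => h q.1 q.2) ∧
  IsSmoothFamily I Ψ ∧ Ψ 0 = 1 ∧
  ∀ (t : ℝ) (z : M) (w : TangentSpace I (Ψ t z)),
    α.d (Ψ t z) (velocity I (fun τ => Ψ τ z) t) w =
      - (show ℝ from mfderiv I 𝓘(ℝ, ℝ) (h t) (Ψ t z) w)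

end Calculus

section Circle

/-- The chart of the circle `ℝ/ℤ` inverse to the projection `(a, a + 1) → ℝ/ℤ`. -/
def circleChart (a : ℝ) : OpenPartialHomeomorph UnitAddCircle ℝ :=
  (AddCircle.openPartialHomeomorphCoe (1 : ℝ) a).symm

/-- The representative in `[0, 1)` of a point of `ℝ/ℤ`. -/
def circleLift (x : UnitAddCircle) : ℝ := (AddCircle.equivIco (1 : ℝ) 0 x : ℝ)

theorem circleLift_coe (x : UnitAddCircle) : ((circleLift x : ℝ) : UnitAddCircle) = x :=
  (AddCircle.equivIco (1 : ℝ) 0).symm_apply_apply x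

/-- The standard smooth atlas of the circle `ℝ/ℤ`, whose charts are the local inverses of the
projection `ℝ → ℝ/ℤ`. In particular `d/dt` corresponds to `1 : ℝ` in every tangent space. -/
instance circleChartedSpace : ChartedSpace ℝ UnitAddCircle where
  atlas := range circleChart
  chartAt x := circleChart (circleLift x - 1 / 2)
  mem_chart_source x := by
    have h : circleLift x ∈ Ioo (circleLift x - 1 / 2) (circleLift x - 1 / 2 + 1) := by
      constructor <;> linarith
    have := (AddCircle.openPartialHomeomorphCoe (1 : ℝ) (circleLift x - 1 / 2)).map_source h
    rwa [AddCircle.openPartialHomeomorphCoe_apply, circleLift_coe] at this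
  chart_mem_atlas x := mem_range_self _

instance circleIsManifold : IsManifold 𝓘(ℝ, ℝ) ∞ UnitAddCircle := by
  apply isManifold_of_contDiffOn
  rintro _ _ ⟨a, rfl⟩ ⟨b, rfl⟩
  simp only [modelWithCornersSelf_coe, modelWithCornersSelf_coe_symm, Function.comp_id,
    Function.id_comp, preimage_id, range_id, inter_univ, OpenPartialHomeomorph.coe_trans]
  intro y hy
  set f : OpenPartialHomeomorph ℝ UnitAddCircle := AddCircle.openPartialHomeomorphCoe (1 : ℝ) b
  have hy2 : (y : UnitAddCircle) ∈ f.target := by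
    have := hy
    rw [OpenPartialHomeomorph.trans_source] at this
    exact this.2
  obtain ⟨n, hn⟩ : ∃ n : ℤ, f.symm (y : UnitAddCircle) = y + n := by
    have h1 : ((f.symm (y : UnitAddCircle) : ℝ) : UnitAddCircle) = y := f.right_inv hy2
    have h2 : ((f.symm (y : UnitAddCircle) - y : ℝ) : UnitAddCircle) = 0 := by
      rw [AddCircle.coe_sub, h1, sub_self]
    obtain ⟨n, hn⟩ := (AddCircle.coe_eq_zero_iff (1 : ℝ)).1 h2
    refine ⟨n, ?_⟩
    have : (n : ℝ) = f.symm (y : UnitAddCircle) - y := by simpa using hn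
    linarith
  have hmem : y + n ∈ Ioo b (b + 1) := hn ▸ f.map_target hy2
  have hev : ∀ᶠ y' : ℝ in nhds y, f.symm (y' : UnitAddCircle) = y' + n := by
    have hc : Continuous (fun y' : ℝ => y' + n) := by fun_prop
    filter_upwards [hc.continuousAt.preimage_mem_nhds (isOpen_Ioo.mem_nhds hmem)] with y' hy'
    have h2 : f.symm (f (y' + n)) = y' + n := f.left_inv hy'
    have h3 : f (y' + n) = (y' : UnitAddCircle) := by
      change (((y' + n : ℝ)) : UnitAddCircle) = _
      simp
    rwa [h3] at h2
  have : ContDiffAt ℝ ∞ (fun y' : ℝ => f.symm (y' : UnitAddCircle)) y :=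
    ContDiffAt.congr_of_eventuallyEq (by fun_prop) hev
  exact this.contDiffWithinAt

end Circle

section Contact

variable (E : Type*) [NormedAddCommGroup E] [NormedSpace ℝ E]
  (V : Type*) [TopologicalSpace V] [ChartedSpace E V] [IsManifold 𝓘(ℝ, E) ∞ V]

/-- A contact form: a smooth, nowhere vanishing 1-form `lam` whose differential is nondegenerate
on the hyperplanes `ker lam` (equivalently, `lam ∧ (d lam)^n` vanishes nowhere, and then
`dim V = 2n + 1`). -/
structure ContactForm where
  /-- the underlying 1-form -/
  form : OneForm 𝓘(ℝ, E) V
  smooth : form.IsSmooth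
  ne_zero : ∀ x, form x ≠ 0
  nondegenerate : ∀ (x : V) (v : TangentSpace 𝓘(ℝ, E) x), form x v = 0 → v ≠ 0 →
    ∃ w : TangentSpace 𝓘(ℝ, E) x, form x w = 0 ∧ form.d x v w ≠ 0

variable {E V}

/-- An action of the circle `ℝ/ℤ` on `V`, written as a 1-periodic flow `e`, whose generating
vector field is the Reeb vector field `R` of the contact form, given by `lam R = 1` and
`d lam (R, ·) = 0`. -/
structure ReebCircleAction (lam : ContactForm E V) where
  /-- the flow -/
  e : ℝ → V → V
  smooth : ContMDiff (𝓘(ℝ, ℝ).prod 𝓘(ℝ, E)) 𝓘(ℝ, E) ∞ (fun q : ℝ × V => e q.1 q.2)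
  zero : ∀ x, e 0 x = x
  add : ∀ s t x, e (s + t) x = e s (e t x)
  one : ∀ x, e 1 x = x
  form_velocity : ∀ t x, lam.form (e t x) (velocity 𝓘(ℝ, E) (fun τ => e τ x) t) = 1
  d_velocity : ∀ t x w, lam.form.d (e t x) (velocity 𝓘(ℝ, E) (fun τ => e τ x) t) w = 0

/-- `φ` preserves the contact hyperplanes `ker lam` together with their co-orientation: the
pullback of `lam` is a positive multiple of `lam`. -/
def PreservesContact (lam : ContactForm E V) (φ : V → V) : Prop :=
  ∃ g : V → ℝ, ∀ x, 0 < g x ∧ ∀ v : TangentSpace 𝓘(ℝ, E) x,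
    lam.form (φ x) (mfderiv 𝓘(ℝ, E) 𝓘(ℝ, E) φ x v) = g x * lam.form x v

namespace ReebCircleAction

variable {lam : ContactForm E V} (a : ReebCircleAction lam)

/-- The union of the orbits of the points of `K`. -/
def saturation (K : Set V) : Set V := (fun q : ℝ × V => a.e q.1 q.2) '' (Icc 0 1 ×ˢ K)

theorem isCompact_saturation {K : Set V} (hK : IsCompact K) : IsCompact (a.saturation K) :=
  (isCompact_Icc.prod hK).image a.smooth.continuous

theorem e_int (n : ℤ) (x : V) : a.e n x = x := by
  induction n using Int.induction_on with
  | zero => simpa using a.zero x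
  | succ k ih => push_cast at ih ⊢; rw [a.add, a.one, ih]
  | pred k ih =>
    push_cast at ih ⊢
    have h := a.add (-(k : ℝ) - 1) 1 x
    rw [a.one, sub_add_cancel, ih] at h
    exact h.symm

theorem notMem_of_notMem_saturation {K : Set V} (t : ℝ) {x : V} (hx : x ∉ a.saturation K) :
    a.e t x ∉ K := by
  intro h
  refine hx ⟨(Int.fract (-t), a.e t x), ⟨⟨Int.fract_nonneg _, (Int.fract_lt_one _).le⟩, h⟩, ?_⟩
  change a.e (Int.fract (-t)) (a.e t x) = x
  have h1 : Int.fract (-t) + t = ((-⌊-t⌋ : ℤ) : ℝ) := by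
    rw [Int.fract]; push_cast; ring
  rw [← a.add, h1, a.e_int]

end ReebCircleAction

namespace PreservesContact

variable {lam : ContactForm E V}

theorem id : PreservesContact lam (_root_.id : V → V) :=
  ⟨fun _ => 1, fun x => ⟨one_pos, fun v => by rw [mfderiv_id]; simp⟩⟩

theorem comp {φ ψ : V → V} (hφ : PreservesContact lam φ) (hψ : PreservesContact lam ψ)
    (hφ' : ContMDiff 𝓘(ℝ, E) 𝓘(ℝ, E) ∞ φ) (hψ' : ContMDiff 𝓘(ℝ, E) 𝓘(ℝ, E) ∞ ψ) :
    PreservesContact lam (fun x => φ (ψ x)) := by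
  obtain ⟨g, hg⟩ := hφ
  obtain ⟨k, hk⟩ := hψ
  refine ⟨fun x => g (ψ x) * k x, fun x => ⟨mul_pos (hg _).1 (hk _).1, fun v => ?_⟩⟩
  have h : mfderiv 𝓘(ℝ, E) 𝓘(ℝ, E) (fun x => φ (ψ x)) x =
      (mfderiv 𝓘(ℝ, E) 𝓘(ℝ, E) φ (ψ x)).comp (mfderiv 𝓘(ℝ, E) 𝓘(ℝ, E) ψ x) :=
    mfderiv_comp x (hφ'.mdifferentiable (by simp) _) (hψ'.mdifferentiable (by simp) _)
  rw [h, mul_assoc, ← (hk x).2 v]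
  exact (hg (ψ x)).2 _

theorem symm {φ : Equiv.Perm V} (hφ : PreservesContact lam φ)
    (hφ' : ContMDiff 𝓘(ℝ, E) 𝓘(ℝ, E) ∞ φ) (hψ' : ContMDiff 𝓘(ℝ, E) 𝓘(ℝ, E) ∞ φ.symm) :
    PreservesContact lam φ.symm := by
  obtain ⟨g, hg⟩ := hφ
  refine ⟨fun x => (g (φ.symm x))⁻¹, fun x => ⟨inv_pos.2 (hg _).1, fun v => ?_⟩⟩
  have h : mfderiv 𝓘(ℝ, E) 𝓘(ℝ, E) (φ ∘ φ.symm) x =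
      (mfderiv 𝓘(ℝ, E) 𝓘(ℝ, E) φ (φ.symm x)).comp (mfderiv 𝓘(ℝ, E) 𝓘(ℝ, E) φ.symm x) :=
    mfderiv_comp x (hφ'.mdifferentiable (by simp) _) (hψ'.mdifferentiable (by simp) _)
  have h1 := (hg (φ.symm x)).2 (mfderiv 𝓘(ℝ, E) 𝓘(ℝ, E) φ.symm x v)
  have h2 : lam.form (φ (φ.symm x))
      (mfderiv 𝓘(ℝ, E) 𝓘(ℝ, E) φ (φ.symm x) (mfderiv 𝓘(ℝ, E) 𝓘(ℝ, E) φ.symm x v)) =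
      lam.form x v := by
    have h3 : mfderiv 𝓘(ℝ, E) 𝓘(ℝ, E) φ (φ.symm x) (mfderiv 𝓘(ℝ, E) 𝓘(ℝ, E) φ.symm x v) = v := by
      have h4 := congrArg (fun A : E →L[ℝ] E => A v) h
      rw [Equiv.self_comp_symm, mfderiv_id] at h4
      exact h4.symm
    refine Eq.trans (congrArg _ h3) ?_
    have h5 : ∀ y, y = x → (show E →L[ℝ] ℝ from lam.form y) v = lam.form x v := by
      rintro y rfl; rfl
    exact h5 _ (φ.apply_symm_apply x)
  have hne := (hg (φ.symm x)).1.ne'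
  rw [h2] at h1
  rw [h1, inv_mul_cancel_left₀ hne]

end PreservesContact

section Symplectization

/-- The open half-line `ℝ_+`, an open submanifold of `ℝ`. -/
abbrev PosReals : TopologicalSpace.Opens ℝ := ⟨Ioi 0, isOpen_Ioi⟩

/-- Multiplication of positive reals. -/
def posMul (c s : PosReals) : PosReals := ⟨c.1 * s.1, mul_pos (mem_Ioi.1 c.2) (mem_Ioi.1 s.2)⟩

variable (V) in
/-- The manifold `SV = V × ℝ_+`. -/
abbrev SV : Type _ := V × PosReals

variable (V) in
/-- The manifold `Stab(SV) = SV × T^*S^1`, with `T^*S^1 = S^1 × ℝ` and coordinates `(t, r)` on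
`T^*S^1`. -/
abbrev StabSV : Type _ := SV V × (UnitAddCircle × ℝ)

variable (E) in
/-- The model of the manifold `SV`. -/
abbrev modelSV : ModelWithCorners ℝ (E × ℝ) (ModelProd E ℝ) := 𝓘(ℝ, E).prod 𝓘(ℝ, ℝ)

variable (E) in
/-- The model of the manifold `Stab(SV)`. -/
abbrev modelStabSV : ModelWithCorners ℝ ((E × ℝ) × (ℝ × ℝ))
    (ModelProd (ModelProd E ℝ) (ModelProd ℝ ℝ)) :=
  (modelSV E).prod (𝓘(ℝ, ℝ).prod 𝓘(ℝ, ℝ))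

/-- The 1-form `s lam` on `SV`; the symplectic form of the symplectization is its differential. -/
def liouville (lam : ContactForm E V) : OneForm (modelSV E) (SV V) := fun z =>
  show E × ℝ →L[ℝ] ℝ from
    (z.2 : ℝ) • (show E →L[ℝ] ℝ from lam.form z.1).comp (ContinuousLinearMap.fst ℝ E ℝ)

/-- The 1-form `s lam + r dt` on `Stab(SV)`; the symplectic form is its differential. -/
def stabLiouville (lam : ContactForm E V) : OneForm (modelStabSV E) (StabSV V) := fun z =>
  show (E × ℝ) × (ℝ × ℝ) →L[ℝ] ℝ from
    (show E × ℝ →L[ℝ] ℝ from liouville lam z.1).comp (ContinuousLinearMap.fst ℝ (E × ℝ) (ℝ × ℝ)) +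
    z.2.2 • (ContinuousLinearMap.fst ℝ ℝ ℝ).comp (ContinuousLinearMap.snd ℝ (E × ℝ) (ℝ × ℝ))

/-- The action of `ℝ_+` on `SV`. -/
def scaleSV (c : PosReals) (z : SV V) : SV V := (z.1, posMul c z.2)

/-- The action of `ℝ_+` on `Stab(SV)`, by `c · (x, s, t, r) = (x, c s, t, c r)`. -/
def scaleStabSV (c : PosReals) (z : StabSV V) : StabSV V :=
  (scaleSV c z.1, (z.2.1, c.1 * z.2.2))

/-- `Stab(X) = X × S^1`, where `S^1` is the zero section `r = 0` of `T^*S^1`. -/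
def stab (X : Set (SV V)) : Set (StabSV V) := {z | z.1 ∈ X ∧ z.2.2 = 0}

/-- An `ℝ_+`-equivariant Hamiltonian diffeomorphism of `Stab(SV)`: the time-one map of the flow of
an `ℝ_+`-equivariant time-dependent Hamiltonian, `h_t (c z) = c h_t (z)`. -/
def IsEquivariantHamiltonianDiffeo (lam : ContactForm E V) (Φ : Equiv.Perm (StabSV V)) : Prop :=
  ∃ (h : ℝ → StabSV V → ℝ) (Ψ : ℝ → Equiv.Perm (StabSV V)),
    (∀ t c z, h t (scaleStabSV c z) = c.1 * h t z) ∧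
    IsHamiltonianIsotopy (stabLiouville lam) h Ψ ∧ Ψ 1 = Φ

/-- The pair `(A, B)` of closed subsets of `SV`, with `B` compact, has the stable intersection
property: `Stab(A)` cannot be displaced from `Stab(B)` by an `ℝ_+`-equivariant Hamiltonian
diffeomorphism. -/
def StableIntersectionProperty (lam : ContactForm E V) (A B : Set (SV V)) : Prop :=
  IsClosed A ∧ IsCompact B ∧ ∀ Φ : Equiv.Perm (StabSV V), IsEquivariantHamiltonianDiffeo lam Φ →
    (Φ '' stab A ∩ stab B).Nonempty

/-- `h` is the contact Hamiltonian of the contact isotopy `f`: it is an `ℝ_+`-equivariant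
time-dependent function on `SV`, and its Hamiltonian flow on the symplectization produces `f`. -/
def IsContactHamiltonian (lam : ContactForm E V) (h : ℝ → SV V → ℝ) (f : ℝ → Equiv.Perm V) :
    Prop :=
  (∀ t c z, h t (scaleSV c z) = c.1 * h t z) ∧
  ∃ Ψ : ℝ → Equiv.Perm (SV V), IsHamiltonianIsotopy (liouville lam) h Ψ ∧
    ∀ t z, (Ψ t z).1 = f t z.1

end Symplectization

section Group

variable {lam : ContactForm E V} (a : ReebCircleAction lam)
  (P : Type*) [NormedAddCommGroup P] [NormedSpace ℝ P]

/-- The smooth families `f p`, `p ∈ P`, of contactomorphisms for which there are a smooth function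
`c` on `P` and a compact set `K` such that `f p = e_{c p}` outside of `K`, for all `p`. Equivalently,
`f p = e_{c p} ∘ φ p` with `φ` a smooth family of contactomorphisms supported in one compact set.
They form a group under pointwise composition. -/
def familyGroup : Subgroup (P → Equiv.Perm V) where
  carrier := {f | IsSmoothFamily 𝓘(ℝ, E) f ∧ (∀ p, PreservesContact lam (f p)) ∧
    ∃ c : P → ℝ, ContDiff ℝ ∞ c ∧ ∃ K : Set V, IsCompact K ∧ ∀ p, ∀ x ∉ K, f p x = a.e (c p) x}
  mul_mem' := by
    rintro f g ⟨hf, hf', c, hc, K, hK, hfK⟩ ⟨hg, hg', d, hd, L, hL, hgL⟩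
    refine ⟨hf.mul hg, fun p => (hf' p).comp (hg' p) (hf.contMDiff p) (hg.contMDiff p),
      fun p => c p + d p, hc.add hd, L ∪ a.saturation K, hL.union (a.isCompact_saturation hK), ?_⟩
    intro p x hx
    simp only [mem_union, not_or] at hx
    change f p (g p x) = _
    rw [hgL p x hx.1, hfK p _ (a.notMem_of_notMem_saturation _ hx.2), a.add]
  one_mem' := by
    refine ⟨IsSmoothFamily.one, fun p => PreservesContact.id, fun _ => 0, contDiff_const, ∅,
      isCompact_empty, fun p x _ => ?_⟩
    rw [a.zero]; rfl
  inv_mem' := by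
    rintro f ⟨hf, hf', c, hc, K, hK, hfK⟩
    refine ⟨hf.inv, fun p => (hf' p).symm (hf.contMDiff p) (hf.inv.contMDiff p),
      fun p => - c p, hc.neg, a.saturation K, a.isCompact_saturation hK, ?_⟩
    intro p x hx
    have h1 := hfK p _ (a.notMem_of_notMem_saturation (- c p) hx)
    rw [← a.add, add_neg_cancel, a.zero] at h1
    change (f p).symm x = _
    rw [Equiv.symm_apply_eq, h1]

variable {P} in
theorem familyGroup_comp {Q : Type*} [NormedAddCommGroup Q] [NormedSpace ℝ Q] {σ : Q → P}
    (hσ : ContDiff ℝ ∞ σ) {f : P → Equiv.Perm V} (hf : f ∈ familyGroup a P) :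
    (fun q => f (σ q)) ∈ familyGroup a Q := by
  obtain ⟨h1, h2, c, hc, K, hK, h3⟩ := hf
  exact ⟨h1.comp hσ, fun q => h2 _, fun q => c (σ q), hc.comp hσ, K, hK, fun q => h3 _⟩

/-- Let `𝒢_c` be the identity component of the group of compactly supported contactomorphisms and
`𝒢_e` the group of the maps `e_t ∘ φ` with `φ ∈ 𝒢_c`. This is the group, under pointwise
composition, of the smooth paths `t ↦ f t` in `𝒢_e` with `f 0 = id`. The paths are parametrized by
`ℝ`; every smooth path defined on `[0, 1]` extends to `ℝ`, and only the restriction to `[0, 1]`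
matters below. -/
def pathGroup : Subgroup (ℝ → Equiv.Perm V) where
  carrier := {f | f ∈ familyGroup a ℝ ∧ f 0 = 1}
  mul_mem' := by
    rintro f g ⟨hf, hf0⟩ ⟨hg, hg0⟩
    exact ⟨mul_mem hf hg, by simp [hf0, hg0]⟩
  one_mem' := ⟨one_mem _, rfl⟩
  inv_mem' := by
    rintro f ⟨hf, hf0⟩
    exact ⟨inv_mem hf, by simp [hf0]⟩

/-- Smooth homotopy in `𝒢_e`, with fixed endpoints, of the paths `f t` and `g t`, `t ∈ [0, 1]`. -/
def Homotopic (f g : pathGroup a) : Prop :=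
  ∃ h ∈ familyGroup a (ℝ × ℝ),
    (∀ t ∈ Icc (0 : ℝ) 1, h (0, t) = f.1 t ∧ h (1, t) = g.1 t) ∧
    ∀ u ∈ Icc (0 : ℝ) 1, h (u, 0) = 1 ∧ h (u, 1) = f.1 1

theorem Homotopic.refl (f : pathGroup a) : Homotopic a f f :=
  ⟨_, familyGroup_comp a contDiff_snd f.2.1, fun _ _ => ⟨rfl, rfl⟩, fun _ _ => ⟨f.2.2, rfl⟩⟩

variable {a}

theorem Homotopic.mul {f f' g g' : pathGroup a} (hf : Homotopic a f f') (hg : Homotopic a g g') :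
    Homotopic a (f * g) (f' * g') := by
  obtain ⟨h, hh, h1, h2⟩ := hf
  obtain ⟨k, hk, k1, k2⟩ := hg
  refine ⟨h * k, mul_mem hh hk, fun t ht => ?_, fun u hu => ?_⟩
  · simp [(h1 t ht).1, (h1 t ht).2, (k1 t ht).1, (k1 t ht).2]
  · simp [(h2 u hu).1, (h2 u hu).2, (k2 u hu).1, (k2 u hu).2]

theorem Homotopic.inv {f f' : pathGroup a} (hf : Homotopic a f f') :
    Homotopic a f⁻¹ f'⁻¹ := by
  obtain ⟨h, hh, h1, h2⟩ := hf
  refine ⟨h⁻¹, inv_mem hh, fun t ht => ?_, fun u hu => ?_⟩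
  · simp [(h1 t ht).1, (h1 t ht).2]
  · simp [(h2 u hu).1, (h2 u hu).2]

variable (a)

/-- The normal subgroup of the contractible loops: paths that are homotopic, with fixed endpoints,
to the constant path at the identity. -/
def contractibleLoops : Subgroup (pathGroup a) where
  carrier := {f | Homotopic a f 1}
  mul_mem' := by
    intro f g hf hg
    simpa using Homotopic.mul hf hg
  one_mem' := Homotopic.refl a 1
  inv_mem' := by
    intro f hf
    simpa using Homotopic.inv hf

instance contractibleLoops_normal : (contractibleLoops a).Normal where
  conj_mem f hf k := by
    have h : Homotopic a (k * f * k⁻¹) 1 := by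
      simpa using ((Homotopic.refl a k).mul (show Homotopic a f 1 from hf)).mul (Homotopic.refl a k⁻¹)
    exact h

/-- The universal cover of `𝒢_e`: homotopy classes, with fixed endpoints, of paths in `𝒢_e` that
start at the identity (see `UniversalCover.mk_eq_mk_iff`), with pointwise composition. -/
abbrev UniversalCover : Type _ := pathGroup a ⧸ contractibleLoops a

variable {a}

/-- The homotopy class of a path. -/
def UniversalCover.mk (f : pathGroup a) : UniversalCover a := QuotientGroup.mk f

theorem UniversalCover.mk_eq_mk_iff (f g : pathGroup a) :
    UniversalCover.mk f = UniversalCover.mk g ↔ Homotopic a f g := by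
  unfold UniversalCover.mk
  rw [QuotientGroup.eq]
  constructor
  · intro h
    have h1 : Homotopic a (f⁻¹ * g) 1 := h
    have h2 : Homotopic a g f := by simpa using (Homotopic.refl a f).mul h1
    simpa using ((Homotopic.refl a f).mul h2.inv).mul (Homotopic.refl a g)
  · intro h
    have h1 : Homotopic a (f⁻¹ * g) 1 := by simpa using h.inv.mul (Homotopic.refl a g)
    exact h1

/-- `x ≽ id`: the class `x` contains a path with a non-negative contact Hamiltonian. -/
def IsNonneg (x : UniversalCover a) : Prop :=
  ∃ f : pathGroup a, UniversalCover.mk f = x ∧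
    ∃ h : ℝ → SV V → ℝ, IsContactHamiltonian lam h f.1 ∧ ∀ t ∈ Icc (0 : ℝ) 1, ∀ z, 0 ≤ h t z

/-- The relation `x ≽ y` on the universal cover of `𝒢_e`. -/
def Dominates (x y : UniversalCover a) : Prop := IsNonneg (x * y⁻¹)

infix:50 " ≽ " => Dominates

end Group
end Contact
end ContactOrder

end

open ContactOrder

/-! Only antisymmetry uses the geometry. Let `cham` be the value of the contact form on the velocity
of a trajectory. The product rule `cham_mul` and the positivity of conformal factors make the
non-negative classes a monoid. Conjugation by a path is homotopic to conjugation by its endpoint, so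
this monoid is conjugation invariant, and reflexivity, transitivity and compatibility with products
follow formally.

For antisymmetry, let f and g be non-negative paths representing x and x⁻¹. Then fg is a
contractible loop with non-negative contact Hamiltonian. Suppose this Hamiltonian is positive
somewhere. Contactomorphisms act transitively on the connected manifold V, so conjugates, products
and time changes of the loop produce a contractible non-negative loop F whose Hamiltonian is
positive at all times over the compact projection of B (`IsNonnegLoop.exists_pos`). A null-homotopy
of F suspends to an equivariant Hamiltonian isotopy of Stab(SV) whose time-one map is (z, t, r) ↦
(F_t z, t, r - H_t(F_t z)), with F_t lifted to SV and H its Hamiltonian. The isotopy preserves s λ +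
r dt, hence is Hamiltonian. Points with r = 0 that land over B acquire r < 0, so Stab(A) is
displaced from Stab(B) (`not_stableIntersectionProperty`). Hence the Hamiltonian of fg vanishes. As
a sum of non-negative terms it forces the Hamiltonian of f to vanish, and a contact isotopy with
zero Hamiltonian is constant (`eq_of_cham_eq_zero`).

The auxiliary loops need not be compactly supported modulo the circle action: the displacement
argument uses only the compactness of B. Transitivity is local to global. In a chart, cut-off
contact vector fields take every value at a given point. Their time-one maps, which depend smoothly
on that value, move the point over a neighbourhood. So orbits are open, and connectedness leaves
only one. -/

noncomputable section

namespace ContactOrder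

/-! ### Contractions depending smoothly on a parameter -/

section ParametricFixedPoint

variable {X C : Type*} [NormedAddCommGroup X] [NormedSpace ℝ X] [CompleteSpace X]
  [NormedAddCommGroup C] [NormedSpace ℝ C] [CompleteSpace C]

/-- If `P (v, ·)` is a contraction for all `v` in an open set `U`, the solution `γ` of
`γ = η + P (v, γ)` exists, is unique and depends smoothly on `(v, η)`. -/
theorem exists_contDiffOn_fixedPoint {P : X × C → C} (hP : ContDiff ℝ ∞ P) {U : Set X}
    (hU : IsOpen U) (hlip : ∀ v ∈ U, ∃ K : NNReal, K < 1 ∧ LipschitzWith K (fun γ => P (v, γ))) :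
    ∃ S : X × C → C, ContDiffOn ℝ ∞ S (U ×ˢ univ) ∧
      ∀ v ∈ U, ∀ η γ, γ = η + P (v, γ) ↔ γ = S (v, η) := by
  have hex : ∀ q : X × C, ∃ s : C, q.1 ∈ U → ∀ γ, γ = q.2 + P (q.1, γ) ↔ γ = s := by
    rintro ⟨v, η⟩
    by_cases hv : v ∈ U
    · obtain ⟨K, hK, hL⟩ := hlip v hv
      have hc : ContractingWith K (fun γ => η + P (v, γ)) := by
        refine ⟨hK, LipschitzWith.of_dist_le_mul fun x y => ?_⟩
        simpa using hL.dist_le_mul x y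
      refine ⟨ContractingWith.fixedPoint _ hc, fun _ γ => ⟨fun h => ?_, fun h => ?_⟩⟩
      · exact hc.fixedPoint_unique h.symm
      · rw [h]; exact hc.fixedPoint_isFixedPt.symm
    · exact ⟨0, fun h => absurd h hv⟩
  choose S hS using hex
  refine ⟨S, ?_, fun v hv η γ => hS (v, η) hv γ⟩
  rintro ⟨v, η⟩ hq
  have hv : v ∈ U := hq.1
  refine ContDiffAt.contDiffWithinAt ?_
  set γ := S (v, η) with hγ
  have hγ' : γ = η + P (v, γ) := (hS (v, η) hv γ).2 rfl
  -- The fixed-point equation reads M (v, γ) = (v, η). The derivative of M is block triangular with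
  -- diagonal blocks 1 and 1 - T, where T is the derivative of a contraction, so ‖T‖ < 1 and the
  -- Neumann series inverts 1 - T.
  let M : X × C → X × C := fun q => (q.1, q.2 - P q)
  have hM : ContDiff ℝ ∞ M := contDiff_fst.prodMk (contDiff_snd.sub hP)
  have hMγ : M (v, γ) = (v, η) := by
    simp only [M, Prod.mk.injEq, true_and]
    rw [sub_eq_iff_eq_add]; exact hγ'
  obtain ⟨K, hK, hL⟩ := hlip v hv
  have hPd : HasFDerivAt P (fderiv ℝ P (v, γ)) (v, γ) :=
    (hP.differentiable (by simp) _).hasFDerivAt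
  set P' := fderiv ℝ P (v, γ)
  have hT : HasFDerivAt (fun γ => P (v, γ)) (P'.comp (ContinuousLinearMap.inr ℝ X C)) γ :=
    hPd.comp γ (hasFDerivAt_prodMk_right v γ)
  have hTn : ‖P'.comp (ContinuousLinearMap.inr ℝ X C)‖ < 1 :=
    (hT.le_of_lipschitz hL).trans_lt (by exact_mod_cast hK)
  set T := P'.comp (ContinuousLinearMap.inr ℝ X C)
  let M' : (X × C) ≃L[ℝ] (X × C) :=
    (ContinuousLinearEquiv.refl ℝ X).skewProd
      (ContinuousLinearEquiv.ofUnit (Units.oneSub T hTn)) (-(P'.comp (ContinuousLinearMap.inl ℝ X C)))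
  have hM' : HasFDerivAt M (M' : X × C →L[ℝ] X × C) (v, γ) := by
    have h := (hasFDerivAt_fst (𝕜 := ℝ) (p := (v, γ))).prodMk
      ((hasFDerivAt_snd (𝕜 := ℝ) (p := (v, γ))).sub hPd)
    refine h.congr_fderiv ?_
    ext1 <;> ext1 w
    · simp [M', ContinuousLinearEquiv.skewProd_apply]
    · have h0 : P' (0, 0) = 0 := map_zero P'
      simp [M', ContinuousLinearEquiv.skewProd_apply, ContinuousLinearEquiv.ofUnit, T, h0]
  have hMat : ContDiffAt ℝ ∞ M (v, γ) := hM.contDiffAt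
  have hinv := hMat.to_localInverse hM' (by simp)
  have hstrict : HasStrictFDerivAt M (M' : X × C →L[ℝ] X × C) (v, γ) :=
    hMat.hasStrictFDerivAt' hM' (by simp)
  have hri := hstrict.eventually_right_inverse
  rw [hMγ] at hinv hri
  have hUn : ∀ᶠ q : X × C in nhds (v, η), q.1 ∈ U :=
    continuous_fst.continuousAt.eventually (hU.mem_nhds hv)
  refine (contDiff_snd.contDiffAt.comp _ hinv).congr_of_eventuallyEq ?_
  -- Uniqueness of the fixed point identifies S near (v, η) with the second component of the local
  -- inverse of M.
  filter_upwards [hri, hUn] with q hq1 hq2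
  set z := HasStrictFDerivAt.localInverse M M' (v, γ) hstrict q
  have hMz : (z.1, z.2 - P z) = q := hq1
  have h1 : z.1 = q.1 := (Prod.ext_iff.1 hMz).1
  have h2 : z.2 - P z = q.2 := (Prod.ext_iff.1 hMz).2
  have h3 : z.2 = S q := by
    refine (hS q hq2 z.2).1 ?_
    rw [← h1, ← h2]; simp
  exact h3.symm

end ParametricFixedPoint

/-! ### Smoothness of composition operators on spaces of curves -/

section Superposition

universe u
variable {K : Type*} [TopologicalSpace K] [CompactSpace K]
  {E : Type u} [NormedAddCommGroup E] [NormedSpace ℝ E]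

/-- Pointwise application of a continuous family of operators to a continuous family of vectors. -/
def applyCLM (K : Type*) [TopologicalSpace K] [CompactSpace K]
    (E : Type u) [NormedAddCommGroup E] [NormedSpace ℝ E]
    (F : Type*) [NormedAddCommGroup F] [NormedSpace ℝ F] :
    C(K, E →L[ℝ] F) →L[ℝ] C(K, E) →L[ℝ] C(K, F) :=
  LinearMap.mkContinuous₂
    (LinearMap.mk₂ ℝ
      (fun (T : C(K, E →L[ℝ] F)) (δ : C(K, E)) => (⟨fun k => T k (δ k), T.continuous.clm_apply δ.continuous⟩ : C(K, F)))
      (fun _ _ _ => by ext; simp) (fun _ _ _ => by ext; simp)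
      (fun _ _ _ => by ext; simp) (fun _ _ _ => by ext; simp))
    1 (fun T δ => by
      rw [one_mul, ContinuousMap.norm_le _ (by positivity)]
      intro k
      exact ((T k).le_opNorm _).trans (mul_le_mul (T.norm_coe_le_norm k) (δ.norm_coe_le_norm k)
        (norm_nonneg _) ((norm_nonneg _).trans (T.norm_coe_le_norm k))))

/-- The derivative of γ ↦ f ∘ γ is pointwise application of (Df) ∘ γ, an operator of the same kind
for Df; this drives the induction, and F is quantified after n because the step replaces it by `E
→L[ℝ] F`. Compact support makes Df globally Lipschitz, so the first-order remainder is quadratic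
uniformly on K. -/
theorem contDiff_postcomp (n : ℕ) : ∀ {F : Type u} [NormedAddCommGroup F] [NormedSpace ℝ F]
    {f : E → F} (hf : ContDiff ℝ ∞ f), HasCompactSupport f →
      ContDiff ℝ n (fun γ : C(K, E) => (ContinuousMap.mk f hf.continuous).comp γ) := by
  induction n with
  | zero =>
    intro F _ _ f hf _
    exact contDiff_zero.2 (ContinuousMap.continuous_postcomp _)
  | succ n ih =>
    intro F _ _ f hf hs
    have hf' : ContDiff ℝ ∞ (fderiv ℝ f) := hf.fderiv_right (by simp)
    have hs' : HasCompactSupport (fderiv ℝ f) := hs.fderiv ℝ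
    obtain ⟨L, hL⟩ := hf'.lipschitzWith_of_hasCompactSupport hs' (by simp)
    push_cast
    refine contDiff_succ_iff_hasFDerivAt.2
      ⟨_, (applyCLM K E F).contDiff.comp (ih hf' hs'), fun γ => ?_⟩
    set A := (applyCLM K E F) ((ContinuousMap.mk (fderiv ℝ f) hf'.continuous).comp γ)
    set N : C(K, E) → C(K, F) := fun γ => (ContinuousMap.mk f hf.continuous).comp γ
    have h0 : HasFDerivAt (fun δ => N δ - N γ - A (δ - γ)) (0 : C(K, E) →L[ℝ] C(K, F)) γ := by
      refine Asymptotics.IsBigO.hasFDerivAt (n := 2) ?_ one_lt_two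
      refine Asymptotics.IsBigO.of_bound L (Filter.Eventually.of_forall fun δ => ?_)
      rw [ContinuousMap.norm_le _ (by positivity)]
      intro k
      have h := (convex_closedBall (γ k) ‖δ k - γ k‖).norm_image_sub_le_of_norm_hasFDerivWithin_le'
        (f := f) (φ := fderiv ℝ f (γ k)) (C := L * ‖δ k - γ k‖) (x := γ k) (y := δ k)
        (fun x _ => (hf.differentiable (by simp) x).hasFDerivAt.hasFDerivWithinAt)
        (fun x hx => (hL.norm_sub_le _ _).trans
          (mul_le_mul_of_nonneg_left (mem_closedBall_iff_norm.1 hx) L.2))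
        (by simp) (by simp [dist_eq_norm])
      have hb : ‖δ k - γ k‖ ≤ ‖δ - γ‖ := (δ - γ).norm_coe_le_norm k
      calc ‖(N δ - N γ - A (δ - γ)) k‖ = ‖f (δ k) - f (γ k) - fderiv ℝ f (γ k) (δ k - γ k)‖ := rfl
        _ ≤ L * ‖δ k - γ k‖ * ‖δ k - γ k‖ := h
        _ ≤ L * ‖δ - γ‖ * ‖δ - γ‖ := by gcongr
        _ = L * ‖‖δ - γ‖ ^ 2‖ := by rw [Real.norm_of_nonneg (by positivity)]; ring
    have h1 := (h0.add_const (N γ)).add (A.hasFDerivAt.comp γ ((hasFDerivAt_id γ).sub_const γ))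
    refine (h1.congr_of_eventuallyEq (Filter.Eventually.of_forall fun δ => ?_)).congr_fderiv ?_
    · simp only [Function.comp, Pi.add_apply, id]
      abel
    · ext; simp; rfl

end Superposition

/-! ### Integration as a bounded operator on curves -/

section IntegralOperator

variable {E : Type*} [NormedAddCommGroup E] [NormedSpace ℝ E]

/-- The primitive, vanishing at `0`, of a continuous curve on the unit interval. -/
def primitive : C(Icc (0 : ℝ) 1, E) →L[ℝ] C(Icc (0 : ℝ) 1, E) :=
  LinearMap.mkContinuous
    { toFun := fun γ => ⟨fun t => ∫ s in (0 : ℝ)..t, IccExtend zero_le_one γ s,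
        (intervalIntegral.continuous_primitive
          (fun a b => (γ.continuous.Icc_extend').intervalIntegrable a b) 0).comp
          continuous_subtype_val⟩
      map_add' := fun γ δ => by
        ext t
        exact intervalIntegral.integral_add ((γ.continuous.Icc_extend').intervalIntegrable _ _)
          ((δ.continuous.Icc_extend').intervalIntegrable _ _)
      map_smul' := fun c γ => by
        ext t
        exact intervalIntegral.integral_smul c _ }
    1 (fun γ => by
      rw [one_mul, ContinuousMap.norm_le _ (by positivity)]
      intro t
      have h : ∀ s ∈ uIoc (0 : ℝ) t, ‖IccExtend (zero_le_one (α := ℝ)) γ s‖ ≤ ‖γ‖ :=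
        fun s _ => γ.norm_coe_le_norm _
      refine (intervalIntegral.norm_integral_le_of_norm_le_const h).trans ?_
      have h1 := t.2.1
      have h2 := t.2.2
      rw [sub_zero, abs_of_nonneg h1]
      exact mul_le_of_le_one_right (norm_nonneg _) h2)

theorem norm_primitive_le (γ : C(Icc (0 : ℝ) 1, E)) : ‖primitive γ‖ ≤ ‖γ‖ := by
  refine ((primitive (E := E)).le_opNorm γ).trans ?_
  exact mul_le_of_le_one_left (norm_nonneg _) (LinearMap.mkContinuous_norm_le _ zero_le_one _)

end IntegralOperator

/-! ### Flows of vector fields depending linearly on a small parameter -/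

section Flow

universe u
variable {E : Type u} [NormedAddCommGroup E] [NormedSpace ℝ E]

/-- Constant curves, as a continuous linear map. -/
def constCurve (E : Type u) [NormedAddCommGroup E] [NormedSpace ℝ E] :
    E →L[ℝ] C(Icc (0 : ℝ) 1, E) :=
  LinearMap.mkContinuous
    { toFun := fun v => ContinuousMap.const _ v
      map_add' := fun _ _ => rfl
      map_smul' := fun _ _ => rfl } 1
    (fun v => by
      rw [one_mul, ContinuousMap.norm_le _ (norm_nonneg _)]
      exact fun _ => le_rfl)

/-- A smooth solution operator for the equations `γ' = A(γ) v` on `[0, 1]`, for small `v`. -/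
theorem exists_solutionOperator [CompleteSpace E] {A : E → E →L[ℝ] E} (hA : ContDiff ℝ ∞ A)
    (hs : HasCompactSupport A) :
    ∃ δ > 0, ∃ S : E × E → C(Icc (0 : ℝ) 1, E),
      ContDiffOn ℝ ∞ S (Metric.ball 0 δ ×ˢ univ) ∧
      ∀ v ∈ Metric.ball (0 : E) δ, ∀ x, ∀ Γ : ℝ → E, Continuous Γ →
        ((∀ t ∈ Icc (0 : ℝ) 1, Γ t = x + ∫ s in (0 : ℝ)..t, A (Γ s) v) ↔
          ∀ t : Icc (0 : ℝ) 1, Γ t = S (v, x) t) := by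
  set I := Icc (0 : ℝ) 1
  obtain ⟨L, hL⟩ := hA.lipschitzWith_of_hasCompactSupport hs (by simp)
  let N : C(I, E) → C(I, E →L[ℝ] E) := fun γ => (ContinuousMap.mk A hA.continuous).comp γ
  let P : E × C(I, E) → C(I, E) := fun q => primitive (applyCLM I E E (N q.2) (constCurve E q.1))
  have hP : ContDiff ℝ ∞ P := by
    have hN : ContDiff ℝ ∞ N := contDiff_infty.2 fun n => contDiff_postcomp n hA hs
    exact primitive.contDiff.comp
      (((applyCLM I E E).contDiff.comp (hN.comp contDiff_snd)).clm_apply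
        ((constCurve E).contDiff.comp contDiff_fst))
  -- P (v, ·) has Lipschitz constant at most L ‖v‖, which is below 1 when ‖v‖ < 1 / (L + 1).
  -- Smallness of v replaces smallness of time, so solutions live on the whole unit interval.
  have hδ : (0 : ℝ) < (L + 1)⁻¹ := by positivity
  have hlip : ∀ v ∈ Metric.ball (0 : E) (L + 1)⁻¹, ∃ K : NNReal, K < 1 ∧
      LipschitzWith K (fun γ => P (v, γ)) := by
    intro v hv
    have hv' : ‖v‖ < (L + 1 : ℝ)⁻¹ := by simpa using hv
    refine ⟨L * ‖v‖₊, ?_, LipschitzWith.of_dist_le_mul fun γ γ' => ?_⟩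
    · rw [← NNReal.coe_lt_coe]
      push_cast
      calc (L : ℝ) * ‖v‖ ≤ L * (L + 1 : ℝ)⁻¹ := by gcongr
        _ < 1 := by
          rw [← div_eq_mul_inv, div_lt_one (by positivity)]; linarith
    · rw [dist_eq_norm, dist_eq_norm]
      have h1 : P (v, γ) - P (v, γ') =
          primitive (applyCLM I E E (N γ) (constCurve E v) -
            applyCLM I E E (N γ') (constCurve E v)) := (map_sub _ _ _).symm
      rw [h1]
      refine (norm_primitive_le _).trans ?_
      rw [ContinuousMap.norm_le _ (by positivity)]
      intro t
      have h2 : ‖A (γ t) v - A (γ' t) v‖ ≤ (L * ‖γ - γ'‖) * ‖v‖ := by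
        rw [← sub_apply]
        refine ((A (γ t) - A (γ' t)).le_opNorm v).trans ?_
        gcongr
        refine (hL.norm_sub_le _ _).trans ?_
        gcongr
        exact (γ - γ').norm_coe_le_norm t
      refine h2.trans (le_of_eq ?_)
      push_cast
      ring
  obtain ⟨S, hS, hS'⟩ := exists_contDiffOn_fixedPoint hP Metric.isOpen_ball hlip
  refine ⟨(L + 1 : ℝ)⁻¹, hδ, fun q => S (q.1, constCurve E q.2), ?_, ?_⟩
  · refine hS.comp (contDiff_fst.prodMk ((constCurve E).contDiff.comp contDiff_snd)).contDiffOn ?_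
    exact fun q hq => ⟨hq.1, mem_univ _⟩
  · intro v hv x Γ hΓ
    let γ : C(I, E) := ⟨fun t => Γ t, hΓ.comp continuous_subtype_val⟩
    have h1 : (∀ t : I, Γ t = S (v, constCurve E x) t) ↔ γ = S (v, constCurve E x) :=
      ⟨fun h => ContinuousMap.ext h, fun h t => DFunLike.congr_fun h t⟩
    have h2 : ∀ t : I, P (v, γ) t = ∫ s in (0 : ℝ)..t, A (Γ s) v := by
      intro t
      refine intervalIntegral.integral_congr fun s hs => ?_
      have hs' : s ∈ I := by
        rw [uIcc_of_le t.2.1] at hs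
        exact ⟨hs.1, hs.2.trans t.2.2⟩
      change IccExtend zero_le_one _ s = _
      rw [IccExtend_of_mem _ _ hs']
      rfl
    rw [h1, ← hS' v hv, ContinuousMap.ext_iff]
    refine ⟨fun h t => ?_, fun h t ht => ?_⟩
    · change Γ t = x + P (v, γ) t
      rw [h2]; exact h t t.2
    · rw [← h2 ⟨t, ht⟩]
      exact h ⟨t, ht⟩

/-- The time-one maps `φ (v, ·)`, for small `v`, of the flows of the vector fields
`x ↦ A x v`. -/
theorem exists_flow [CompleteSpace E] {A : E → E →L[ℝ] E} (hA : ContDiff ℝ ∞ A)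
    (hs : HasCompactSupport A) :
    ∃ δ > 0, ∃ φ : E × E → E, ContDiffOn ℝ ∞ φ (Metric.ball 0 δ ×ˢ univ) ∧
      (∀ x, φ (0, x) = x) ∧
      (∀ v ∈ Metric.ball (0 : E) δ, ∀ x, φ (-v, φ (v, x)) = x) ∧
      (∀ v ∈ Metric.ball (0 : E) δ, ∀ x, A x = 0 → φ (v, x) = x) ∧
      ∀ v ∈ Metric.ball (0 : E) δ, ∀ x, ∀ t ∈ Icc (0 : ℝ) 1,
        HasDerivWithinAt (fun τ : ℝ => φ (τ • v, x)) (A (φ (t • v, x)) v) (Icc 0 1) t := by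
  obtain ⟨δ, hδ, S, hS, hS'⟩ := exists_solutionOperator hA hs
  let φ : E × E → E := fun q => S q ⟨1, by simp⟩
  have hφ : ContDiffOn ℝ ∞ φ (Metric.ball 0 δ ×ˢ univ) :=
    (ContinuousMap.evalCLM ℝ (⟨1, by simp⟩ : Icc (0 : ℝ) 1) :
      C(Icc (0 : ℝ) 1, E) →L[ℝ] E).contDiff.comp_contDiffOn hS
  let Γ : E → E → ℝ → E := fun v x => IccExtend zero_le_one (S (v, x))
  have hΓc : ∀ v x, Continuous (Γ v x) := fun v x => (S (v, x)).continuous.Icc_extend'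
  have hint : ∀ v x, Continuous (fun s => A (Γ v x s) v) := fun v x =>
    (hA.continuous.comp (hΓc v x)).clm_apply continuous_const
  have hΓ : ∀ v ∈ Metric.ball (0 : E) δ, ∀ x, ∀ t ∈ Icc (0 : ℝ) 1,
      Γ v x t = x + ∫ s in (0 : ℝ)..t, A (Γ v x s) v := by
    intro v hv x
    refine (hS' v hv x _ (hΓc v x)).2 fun t => ?_
    exact IccExtend_of_mem _ _ t.2
  have hone : ∀ v ∈ Metric.ball (0 : E) δ, ∀ x, ∀ Γ' : ℝ → E, Continuous Γ' →
      (∀ t ∈ Icc (0 : ℝ) 1, Γ' t = x + ∫ s in (0 : ℝ)..t, A (Γ' s) v) → φ (v, x) = Γ' 1 :=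
    fun v hv x Γ' hc h => ((hS' v hv x Γ' hc).1 h ⟨1, by simp⟩).symm
  have hΓ1 : ∀ v x, Γ v x 1 = φ (v, x) := fun v x => IccExtend_of_mem _ _ (by simp)
  have hneg : ∀ v ∈ Metric.ball (0 : E) δ, -v ∈ Metric.ball (0 : E) δ := by simp
  have hsmul : ∀ v ∈ Metric.ball (0 : E) δ, ∀ t ∈ Icc (0 : ℝ) 1, t • v ∈ Metric.ball (0 : E) δ := by
    intro v hv t ht
    rw [mem_ball_zero_iff] at hv ⊢
    rw [norm_smul, Real.norm_of_nonneg ht.1]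
    exact (mul_le_of_le_one_left (norm_nonneg _) ht.2).trans_lt hv
  -- By linearity in v, the time-one map for t • v is the time-t map for v. The trajectory is thus
  -- visible through φ alone.
  have hscale : ∀ v ∈ Metric.ball (0 : E) δ, ∀ x, ∀ t ∈ Icc (0 : ℝ) 1,
      φ (t • v, x) = Γ v x t := by
    intro v hv x t ht
    rw [hone (t • v) (hsmul v hv t ht) x (fun s => Γ v x (t * s))
      ((hΓc v x).comp (by fun_prop)) ?_, mul_one]
    intro s hs
    have h1 : t * s ∈ Icc (0 : ℝ) 1 := ⟨mul_nonneg ht.1 hs.1, mul_le_one₀ ht.2 hs.1 hs.2⟩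
    change Γ v x (t * s) = _
    rw [hΓ v hv x _ h1]
    congr 1
    simp only [map_smul]
    rw [intervalIntegral.integral_smul,
      intervalIntegral.smul_integral_comp_mul_left (fun s => A (Γ v x s) v) t, mul_zero]
  refine ⟨δ, hδ, φ, hφ, ?_, ?_, ?_, ?_⟩
  · intro x
    rw [hone 0 (by simpa using hδ) x (fun _ => x) continuous_const (by simp)]
  · intro v hv x
    -- The trajectory run backwards solves the equation for -v.
    rw [hone (-v) (hneg v hv) _ (fun s => Γ v x (1 - s)) ((hΓc v x).comp (by fun_prop)) ?_]
    · change Γ v x (1 - 1) = x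
      rw [hΓ v hv x _ (by simp)]; simp
    · intro s hs
      have h1 : 1 - s ∈ Icc (0 : ℝ) 1 := ⟨by linarith [hs.2], by linarith [hs.1]⟩
      change Γ v x (1 - s) = _
      simp only [map_neg]
      rw [intervalIntegral.integral_neg,
        intervalIntegral.integral_comp_sub_left (fun s => A (Γ v x s) v) 1, sub_zero,
        ← hΓ1, hΓ v hv x _ h1, hΓ v hv x 1 (by simp),
        ← intervalIntegral.integral_add_adjacent_intervals
          ((hint v x).intervalIntegrable 0 (1 - s)) ((hint v x).intervalIntegrable (1 - s) 1)]
      abel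
  · intro v hv x hx
    rw [hone v hv x (fun _ => x) continuous_const (by simp [hx])]
  · intro v hv x t ht
    rw [hscale v hv x t ht]
    have h1 : HasDerivAt (fun τ => x + ∫ s in (0 : ℝ)..τ, A (Γ v x s) v) (A (Γ v x t) v) t :=
      (intervalIntegral.integral_hasDerivAt_right ((hint v x).intervalIntegrable _ _)
        (hint v x).stronglyMeasurable.stronglyMeasurableAtFilter
        (hint v x).continuousAt).const_add x
    exact h1.hasDerivWithinAt.congr (fun τ hτ => by rw [hscale v hv x τ hτ, hΓ v hv x τ hτ])
      (by rw [hscale v hv x t ht, hΓ v hv x t ht])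

end Flow

/-! ### One-forms along curves, and the exterior derivative on surfaces -/

section Forms

variable {F : Type*} [NormedAddCommGroup F] [NormedSpace ℝ F]
  {H : Type*} [TopologicalSpace H] {I : ModelWithCorners ℝ F H}
  {M : Type*} [TopologicalSpace M] [ChartedSpace H M]

/-- The value of a 1-form on the velocity vector of a curve. -/
def OneForm.ev (α : OneForm I M) (γ : ℝ → M) (t : ℝ) : ℝ := α (γ t) (velocity I γ t)

theorem velocity_congr {γ γ' : ℝ → M} {t : ℝ} (h : γ =ᶠ[nhds t] γ') :
    (show F from velocity I γ t) = (show F from velocity I γ' t) := by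
  have h1 := h.mfderiv_eq (I := 𝓘(ℝ, ℝ)) (I' := I)
  exact congrArg (fun A : ℝ →L[ℝ] F => A 1) h1

theorem OneForm.congr_point (α : OneForm I M) {x y : M} (h : x = y) (v : F) :
    (show F →L[ℝ] ℝ from α x) v = (show F →L[ℝ] ℝ from α y) v := by rw [h]

theorem OneForm.ev_congr (α : OneForm I M) {γ γ' : ℝ → M} {t : ℝ} (h : γ =ᶠ[nhds t] γ') :
    α.ev γ t = α.ev γ' t := by
  have h1 := velocity_congr (I := I) h
  change (show F →L[ℝ] ℝ from α (γ t)) (show F from velocity I γ t) = _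
  rw [h1]
  exact α.congr_point h.eq_of_nhds _

theorem velocity_eq_deriv {γ : ℝ → M} {t : ℝ} (hγ : MDifferentiableAt 𝓘(ℝ, ℝ) I γ t) :
    (show F from velocity I γ t) = deriv (extChartAt I (γ t) ∘ γ) t := by
  have h : HasFDerivWithinAt (extChartAt I (γ t) ∘ γ)
      (show ℝ →L[ℝ] F from mfderiv 𝓘(ℝ, ℝ) I γ t) (range (id : ℝ → ℝ)) t := hγ.hasMFDerivAt.2
  rw [range_id, hasFDerivWithinAt_univ] at h
  exact h.hasDerivAt.deriv.symm

theorem hasMFDerivAt_extChartAt_symm [I.Boundaryless] [IsManifold I 1 M] {x : M} {y : F}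
    (hy : y ∈ (extChartAt I x).target) :
    HasMFDerivAt 𝓘(ℝ, F) I (extChartAt I x).symm y
      (mfderiv 𝓘(ℝ, F) I (extChartAt I x).symm y) := by
  have h := mdifferentiableWithinAt_extChartAt_symm (I := I) hy
  rw [I.range_eq_univ, mdifferentiableWithinAt_univ] at h
  exact h.hasMFDerivAt

/-- Near t the curve is the inverse chart applied to its chart expression, so the chain rule
applies. The base point x of the chart is free: one chart has to serve all points of a small
surface. -/
theorem OneForm.ev_eq_inChart [I.Boundaryless] [IsManifold I 1 M] (α : OneForm I M) (x : M)
    {γ : ℝ → M} {t : ℝ} (hγ : MDifferentiableAt 𝓘(ℝ, ℝ) I γ t) (hx : γ t ∈ (extChartAt I x).source) :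
    α.ev γ t = α.inChart x (extChartAt I x (γ t)) (deriv (extChartAt I x ∘ γ) t) := by
  have hev : γ =ᶠ[nhds t] (extChartAt I x).symm ∘ (extChartAt I x ∘ γ) := by
    filter_upwards [hγ.continuousAt.preimage_mem_nhds
      ((isOpen_extChartAt_source (I := I) x).mem_nhds hx)] with s hs
    exact ((extChartAt I x).left_inv hs).symm
  have h1 : HasMFDerivAt 𝓘(ℝ, ℝ) 𝓘(ℝ, F) (extChartAt I x ∘ γ) t
      ((mfderiv I 𝓘(ℝ, F) (extChartAt I x) (γ t)).comp (mfderiv 𝓘(ℝ, ℝ) I γ t)) :=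
    ((mdifferentiableAt_extChartAt (by rwa [extChartAt_source] at hx)).hasMFDerivAt).comp t
      hγ.hasMFDerivAt
  have h2 := (hasMFDerivAt_extChartAt_symm ((extChartAt I x).map_source hx)).comp t h1
  have h3 : (show F from mfderiv I 𝓘(ℝ, F) (extChartAt I x) (γ t) (velocity I γ t)) =
      deriv (extChartAt I x ∘ γ) t := by
    have h4 : HasFDerivAt (extChartAt I x ∘ γ)
      (show ℝ →L[ℝ] F from (mfderiv I 𝓘(ℝ, F) (extChartAt I x) (γ t)).comp
        (mfderiv 𝓘(ℝ, ℝ) I γ t)) t := h1.hasFDerivAt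
    exact h4.hasDerivAt.deriv.symm
  rw [α.ev_congr hev]
  have h5 : (show F from velocity I ((extChartAt I x).symm ∘ (extChartAt I x ∘ γ)) t) =
      (show F →L[ℝ] F from mfderiv 𝓘(ℝ, F) I (extChartAt I x).symm (extChartAt I x (γ t)))
        (deriv (extChartAt I x ∘ γ) t) := by
    rw [← h3]
    exact congrArg (fun A : ℝ →L[ℝ] F => A 1) h2.mfderiv
  change (show F →L[ℝ] ℝ from α ((extChartAt I x).symm (extChartAt I x (γ t))))
    (show F from velocity I ((extChartAt I x).symm ∘ (extChartAt I x ∘ γ)) t) = _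
  rw [h5]
  rfl

/-- In finite dimension, smoothness of a covector-valued map can be tested on fixed vectors v. There
it is smoothness of α along the image of the constant section v under the tangent map of the inverse
chart. -/
theorem OneForm.IsSmooth.contDiffOn_inChart [I.Boundaryless] [IsManifold I ∞ M]
    [FiniteDimensional ℝ F] {α : OneForm I M} (hα : α.IsSmooth) (x : M) :
    ContDiffOn ℝ ∞ (α.inChart x) (extChartAt I x).target := by
  have ho : IsOpen (extChartAt I x).target := isOpen_extChartAt_target x
  rw [contDiffOn_clm_apply]
  intro v
  have h1 : ContMDiffOn 𝓘(ℝ, F) I ∞ (extChartAt I x).symm (extChartAt I x).target :=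
    contMDiffOn_extChartAt_symm x
  have h2 := h1.contMDiffOn_tangentMapWithin (m := ∞) (by simp) ho.uniqueMDiffOn
  have h3 : ContMDiffOn 𝓘(ℝ, F) 𝓘(ℝ, F).tangent ∞
      (fun y : F => (⟨y, v⟩ : TangentBundle 𝓘(ℝ, F) F)) (extChartAt I x).target := by
    exact (contMDiffOn_vectorSpace_iff_contDiffOn (V := fun _ : F => v)).2 contDiffOn_const
  have h4 := hα.comp_contMDiffOn (h2.comp h3 (fun y hy => hy))
  refine (contMDiffOn_iff_contDiffOn.1 h4).congr fun y hy => ?_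
  simp only [Function.comp, tangentMapWithin, mfderivWithin_of_isOpen ho hy]
  rfl

/-- The exterior derivative on the coordinate vectors of a parametrized surface. -/
theorem OneForm.d_velocity_velocity [I.Boundaryless] [IsManifold I ∞ M]
    [FiniteDimensional ℝ F] {α : OneForm I M} (hα : α.IsSmooth) {G : ℝ × ℝ → M} {a b : ℝ}
    (hG : ContMDiffAt 𝓘(ℝ, ℝ × ℝ) I 2 G (a, b)) :
    α.d (G (a, b)) (velocity I (fun τ => G (τ, b)) a) (velocity I (fun ε => G (a, ε)) b) =
      deriv (fun τ => α.ev (fun ε => G (τ, ε)) b) a -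
        deriv (fun ε => α.ev (fun τ => G (τ, ε)) a) b := by
  have : IsManifold I 1 M := IsManifold.of_le (n := ∞) (by simp)
  have : IsManifold I 2 M := IsManifold.of_le (n := ∞) (by norm_cast)
  set x := G (a, b) with hx
  set c := extChartAt I x with hc
  set g : ℝ × ℝ → F := fun q => c (G q) with hg
  have hgs : ContDiffAt ℝ 2 g (a, b) := by
    rw [← contMDiffAt_iff_contDiffAt]
    exact (contMDiffAt_extChartAt (x := x)).comp (a, b) hG
  have hsrc : ∀ᶠ q in nhds (a, b), G q ∈ c.source :=
    hG.continuousAt.preimage_mem_nhds (extChartAt_source_mem_nhds x)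
  have hGd : ∀ᶠ q in nhds (a, b), MDifferentiableAt 𝓘(ℝ, ℝ × ℝ) I G q :=
    (contMDiffAt_iff_contMDiffAt_nhds (by simp) |>.1 hG).mono fun q hq => hq.mdifferentiableAt (by simp)
  have hgd : ∀ᶠ q in nhds (a, b), DifferentiableAt ℝ g q :=
    (hgs.eventually (by simp)).mono fun q hq => hq.differentiableAt (by simp)
  have hmk1 : ∀ q : ℝ × ℝ, MDifferentiableAt 𝓘(ℝ, ℝ) 𝓘(ℝ, ℝ × ℝ) (fun τ : ℝ => (τ, q.2)) q.1 :=
    fun q => (by fun_prop : DifferentiableAt ℝ (fun τ : ℝ => (τ, q.2)) q.1).mdifferentiableAt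
  have hmk2 : ∀ q : ℝ × ℝ, MDifferentiableAt 𝓘(ℝ, ℝ) 𝓘(ℝ, ℝ × ℝ) (fun ε : ℝ => (q.1, ε)) q.2 :=
    fun q => (by fun_prop : DifferentiableAt ℝ (fun ε : ℝ => (q.1, ε)) q.2).mdifferentiableAt
  -- the coordinate curves in the chart
  have hd1 : ∀ q, DifferentiableAt ℝ g q →
      deriv (fun τ => g (τ, q.2)) q.1 = fderiv ℝ g q (1, 0) := by
    intro q hq
    have h1 : HasDerivAt (fun τ : ℝ => (τ, q.2)) ((1 : ℝ), (0 : ℝ)) q.1 :=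
      (hasDerivAt_id _).prodMk (hasDerivAt_const _ _)
    exact (hq.hasFDerivAt.comp_hasDerivAt (f := fun τ : ℝ => (τ, q.2)) q.1 h1).deriv
  have hd2 : ∀ q, DifferentiableAt ℝ g q →
      deriv (fun ε => g (q.1, ε)) q.2 = fderiv ℝ g q (0, 1) := by
    intro q hq
    have h1 : HasDerivAt (fun ε : ℝ => (q.1, ε)) ((0 : ℝ), (1 : ℝ)) q.2 :=
      (hasDerivAt_const _ _).prodMk (hasDerivAt_id _)
    exact (hq.hasFDerivAt.comp_hasDerivAt (f := fun ε : ℝ => (q.1, ε)) q.2 h1).deriv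
  have hab := hgd.self_of_nhds
  have hv1 : (show F from velocity I (fun τ => G (τ, b)) a) = fderiv ℝ g (a, b) (1, 0) := by
    rw [← hd1 _ hab]
    exact velocity_eq_deriv ((hGd.self_of_nhds).comp a (hmk1 (a, b)))
  have hv2 : (show F from velocity I (fun ε => G (a, ε)) b) = fderiv ℝ g (a, b) (0, 1) := by
    rw [← hd2 _ hab]
    exact velocity_eq_deriv ((hGd.self_of_nhds).comp b (hmk2 (a, b)))
  set l : F → F →L[ℝ] ℝ := α.inChart x with hl
  have hld : DifferentiableAt ℝ l (g (a, b)) :=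
    ((hα.contDiffOn_inChart x).contDiffAt (extChartAt_target_mem_nhds x)).differentiableAt
      (by simp)
  have hg2 : HasFDerivAt (fderiv ℝ g) (fderiv ℝ (fderiv ℝ g) (a, b)) (a, b) :=
    ((hgs.fderiv_right (m := 1) (by norm_num)).differentiableAt (by simp)).hasFDerivAt
  have key : ∀ (e e' : ℝ × ℝ) (γ : ℝ → ℝ × ℝ) (s : ℝ), γ s = (a, b) → HasDerivAt γ e s →
      HasDerivAt (fun τ => l (g (γ τ)) (fderiv ℝ g (γ τ) e'))
        (fderiv ℝ l (g (a, b)) (fderiv ℝ g (a, b) e) (fderiv ℝ g (a, b) e') +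
          l (g (a, b)) (fderiv ℝ (fderiv ℝ g) (a, b) e e')) s := by
    intro e e' γ s hγ hγ'
    have h1 : HasDerivAt (fun τ => g (γ τ)) (fderiv ℝ g (a, b) e) s := by
      refine HasFDerivAt.comp_hasDerivAt (l := g) (f := γ) s ?_ hγ'
      rw [hγ]; exact hab.hasFDerivAt
    have h2 : HasDerivAt (fun τ => l (g (γ τ))) (fderiv ℝ l (g (a, b)) (fderiv ℝ g (a, b) e)) s := by
      refine HasFDerivAt.comp_hasDerivAt (l := l) (f := fun τ => g (γ τ)) s ?_ h1
      rw [hγ]; exact hld.hasFDerivAt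
    have h3 : HasDerivAt (fun τ => fderiv ℝ g (γ τ)) (fderiv ℝ (fderiv ℝ g) (a, b) e) s := by
      refine HasFDerivAt.comp_hasDerivAt (l := fderiv ℝ g) (f := γ) s ?_ hγ'
      rw [hγ]; exact hg2
    have h4 := h2.clm_apply (h3.clm_apply (hasDerivAt_const s e'))
    simpa [hγ] using h4
  have e1 : (fun τ => α.ev (fun ε => G (τ, ε)) b) =ᶠ[nhds a]
      fun τ => l (g (τ, b)) (fderiv ℝ g (τ, b) (0, 1)) := by
    have hcont : ContinuousAt (fun τ : ℝ => (τ, b)) a := by fun_prop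
    filter_upwards [hcont.eventually hsrc, hcont.eventually hGd, hcont.eventually hgd]
      with τ h1 h2 h3
    rw [← hd2 _ h3]
    exact α.ev_eq_inChart x (h2.comp b (hmk2 (τ, b))) h1
  have e2 : (fun ε => α.ev (fun τ => G (τ, ε)) a) =ᶠ[nhds b]
      fun ε => l (g (a, ε)) (fderiv ℝ g (a, ε) (1, 0)) := by
    have hcont : ContinuousAt (fun ε : ℝ => (a, ε)) b := by fun_prop
    filter_upwards [hcont.eventually hsrc, hcont.eventually hGd, hcont.eventually hgd]
      with ε h1 h2 h3
    rw [← hd1 _ h3]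
    exact α.ev_eq_inChart x (h2.comp a (hmk1 (a, ε))) h1
  -- The two mixed second derivatives of the surface cancel in the difference, leaving only the
  -- derivatives of the form.
  have hsymm : fderiv ℝ (fderiv ℝ g) (a, b) (1, 0) (0, 1) =
      fderiv ℝ (fderiv ℝ g) (a, b) (0, 1) (1, 0) :=
    (hgs.isSymmSndFDerivAt (by simp)).eq _ _
  rw [e1.deriv_eq, e2.deriv_eq,
    (key (1, 0) (0, 1) (fun τ => (τ, b)) a rfl
      ((hasDerivAt_id _).prodMk (hasDerivAt_const _ _))).deriv,
    (key (0, 1) (1, 0) (fun ε => (a, ε)) b rfl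
      ((hasDerivAt_const _ _).prodMk (hasDerivAt_id _))).deriv, hsymm]
  change (show F →L[ℝ] F →L[ℝ] ℝ from fderiv ℝ l (c x)) (show F from velocity I _ a)
      (show F from velocity I _ b) - (show F →L[ℝ] F →L[ℝ] ℝ from fderiv ℝ l (c x))
      (show F from velocity I _ b) (show F from velocity I _ a) = _
  rw [hv1, hv2]
  change fderiv ℝ l (c x) _ _ - fderiv ℝ l (c x) _ _ = _
  simp only [hg, ← hx]
  ring

end Forms

/-! ### Calculus of velocities; isotopies preserving a primitive are Hamiltonian -/

section Velocity

variable {F : Type*} [NormedAddCommGroup F] [NormedSpace ℝ F]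
  {H : Type*} [TopologicalSpace H] {I : ModelWithCorners ℝ F H}
  {M : Type*} [TopologicalSpace M] [ChartedSpace H M]
  {F' : Type*} [NormedAddCommGroup F'] [NormedSpace ℝ F']
  {H' : Type*} [TopologicalSpace H'] {I' : ModelWithCorners ℝ F' H'}
  {M' : Type*} [TopologicalSpace M'] [ChartedSpace H' M']

theorem velocity_comp {φ : M → M'} {γ : ℝ → M} {t : ℝ} (hφ : MDifferentiableAt I I' φ (γ t))
    (hγ : MDifferentiableAt 𝓘(ℝ, ℝ) I γ t) :
    velocity I' (fun τ => φ (γ τ)) t = mfderiv I I' φ (γ t) (velocity I γ t) := by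
  have h := mfderiv_comp t hφ hγ
  exact congrArg (fun A : ℝ →L[ℝ] F' => A 1) h

theorem velocity_reparam {γ : ℝ → M} {σ : ℝ → ℝ} {t : ℝ}
    (hγ : MDifferentiableAt 𝓘(ℝ, ℝ) I γ (σ t)) (hσ : DifferentiableAt ℝ σ t) :
    (show F from velocity I (fun τ => γ (σ τ)) t) =
      deriv σ t • (show F from velocity I γ (σ t)) := by
  have h := mfderiv_comp t hγ hσ.mdifferentiableAt
  have h1 : (show ℝ from mfderiv 𝓘(ℝ, ℝ) 𝓘(ℝ, ℝ) σ t (1 : ℝ)) = deriv σ t := by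
    rw [mfderiv_eq_fderiv]; rfl
  have h2 : (show F from velocity I (fun τ => γ (σ τ)) t) =
      (show ℝ →L[ℝ] F from mfderiv 𝓘(ℝ, ℝ) I γ (σ t))
        (show ℝ from mfderiv 𝓘(ℝ, ℝ) 𝓘(ℝ, ℝ) σ t (1 : ℝ)) :=
    congrArg (fun A : ℝ →L[ℝ] F => A 1) h
  rw [h2, h1]
  have h3 := (show ℝ →L[ℝ] F from mfderiv 𝓘(ℝ, ℝ) I γ (σ t)).map_smul (deriv σ t) 1
  rw [smul_eq_mul, mul_one] at h3
  exact h3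

theorem OneForm.ev_reparam (α : OneForm I M) {γ : ℝ → M} {σ : ℝ → ℝ} {t : ℝ}
    (hγ : MDifferentiableAt 𝓘(ℝ, ℝ) I γ (σ t)) (hσ : DifferentiableAt ℝ σ t) :
    α.ev (fun τ => γ (σ τ)) t = deriv σ t * α.ev γ (σ t) := by
  change (show F →L[ℝ] ℝ from α (γ (σ t))) (show F from velocity I (fun τ => γ (σ τ)) t) = _
  rw [velocity_reparam hγ hσ, map_smul]
  rfl

theorem OneForm.ev_const (α : OneForm I M) (x : M) (t : ℝ) : α.ev (fun _ => x) t = 0 := by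
  unfold OneForm.ev velocity
  rw [mfderiv_const]
  exact (α x).map_zero

/-- The chain rule applied to (1, 1) = (1, 0) + (0, 1); it is the source of the product rule for f_t
∘ g_t. -/
theorem velocity_diag {G : ℝ × ℝ → M} {t : ℝ} (hG : MDifferentiableAt 𝓘(ℝ, ℝ × ℝ) I G (t, t)) :
    (show F from velocity I (fun τ => G (τ, τ)) t) =
      (show F from velocity I (fun τ => G (τ, t)) t) +
        (show F from velocity I (fun τ => G (t, τ)) t) := by
  have hd : ∀ (γ : ℝ → ℝ × ℝ) (v : ℝ × ℝ), γ t = (t, t) → HasDerivAt γ v t →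
      (show F from velocity I (fun τ => G (γ τ)) t) =
        (show ℝ × ℝ →L[ℝ] F from mfderiv 𝓘(ℝ, ℝ × ℝ) I G (t, t)) v := by
    intro γ v hγ hv
    have hG' : HasMFDerivAt 𝓘(ℝ, ℝ × ℝ) I G (γ t) (mfderiv 𝓘(ℝ, ℝ × ℝ) I G (t, t)) := by
      rw [hγ]; exact hG.hasMFDerivAt
    have h2 := (hG'.comp t hv.hasFDerivAt.hasMFDerivAt).mfderiv
    have h3 := congrArg (fun A : ℝ →L[ℝ] F => A 1) h2
    refine h3.trans ?_
    change (show ℝ × ℝ →L[ℝ] F from mfderiv 𝓘(ℝ, ℝ × ℝ) I G (t, t)) ((1 : ℝ) • v) = _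
    rw [one_smul]
  rw [hd (fun τ => (τ, τ)) (1, 1) rfl ((hasDerivAt_id t).prodMk (hasDerivAt_id t)),
    hd (fun τ => (τ, t)) (1, 0) rfl ((hasDerivAt_id t).prodMk (hasDerivAt_const t t)),
    hd (fun τ => (t, τ)) (0, 1) rfl ((hasDerivAt_const t t).prodMk (hasDerivAt_id t)), ← map_add]
  simp

theorem OneForm.ev_diag (α : OneForm I M) {G : ℝ × ℝ → M} {t : ℝ}
    (hG : MDifferentiableAt 𝓘(ℝ, ℝ × ℝ) I G (t, t)) :
    α.ev (fun τ => G (τ, τ)) t = α.ev (fun τ => G (τ, t)) t + α.ev (fun τ => G (t, τ)) t := by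
  change (show F →L[ℝ] ℝ from α (G (t, t))) (show F from velocity I (fun τ => G (τ, τ)) t) = _
  rw [velocity_diag hG, map_add]
  rfl

/-- Every tangent vector is the velocity of a curve that is smooth near `0`. -/
theorem exists_curve [I.Boundaryless] [IsManifold I ∞ M] (x : M) (w : F) :
    ∃ γ : ℝ → M, ContMDiffAt 𝓘(ℝ, ℝ) I ∞ γ 0 ∧ γ 0 = x ∧ (show F from velocity I γ 0) = w := by
  set c := extChartAt I x with hc
  let γ : ℝ → M := fun ε => c.symm (c x + ε • w)
  have hγ0 : γ 0 = x := by simp [γ, hc]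
  have hmem : c x + (0 : ℝ) • w ∈ c.target := by simp [hc]
  have hline : ContMDiffAt 𝓘(ℝ, ℝ) 𝓘(ℝ, F) ∞ (fun ε : ℝ => c x + ε • w) 0 := by
    rw [contMDiffAt_iff_contDiffAt]; fun_prop
  have ho : IsOpen c.target := isOpen_extChartAt_target x
  have hs : ContMDiffAt 𝓘(ℝ, F) I ∞ c.symm (c x + (0 : ℝ) • w) :=
    (contMDiffOn_extChartAt_symm x).contMDiffAt (ho.mem_nhds hmem)
  have hγ : ContMDiffAt 𝓘(ℝ, ℝ) I ∞ γ 0 := hs.comp (0 : ℝ) hline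
  refine ⟨γ, hγ, hγ0, ?_⟩
  rw [velocity_eq_deriv (hγ.mdifferentiableAt (by simp)), hγ0]
  have hev : (extChartAt I x ∘ γ) =ᶠ[nhds 0] fun ε => c x + ε • w := by
    have hcont : ContinuousAt (fun ε : ℝ => c x + ε • w) 0 := by fun_prop
    filter_upwards [hcont.preimage_mem_nhds (ho.mem_nhds hmem)] with ε hε
    exact c.right_inv hε
  rw [hev.deriv_eq]
  simpa using (((hasDerivAt_id (0 : ℝ)).smul_const w).const_add (c x)).deriv

variable {F₁ : Type*} [NormedAddCommGroup F₁] [NormedSpace ℝ F₁]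
  {H₁ : Type*} [TopologicalSpace H₁] {J : ModelWithCorners ℝ F₁ H₁}
  {N : Type*} [TopologicalSpace N] [ChartedSpace H₁ N]

/-- The value of a smooth 1-form on the velocities of a smooth family of curves is smooth. -/
theorem OneForm.IsSmooth.contMDiff_ev [IsManifold I ∞ M] [IsManifold J ∞ N]
    {α : OneForm I M} (hα : α.IsSmooth)
    {G : N × ℝ → M} (hG : ContMDiff (J.prod 𝓘(ℝ, ℝ)) I ∞ G) :
    ContMDiff (J.prod 𝓘(ℝ, ℝ)) 𝓘(ℝ, ℝ) ∞
      (fun q : N × ℝ => α.ev (fun τ => G (q.1, τ)) q.2) := by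
  have : IsManifold J (∞ + 1) N := by simpa
  have : IsManifold J 1 N := IsManifold.of_le (n := ∞) (by simp)
  have : IsManifold I 1 M := IsManifold.of_le (n := ∞) (by simp)
  have h1 : ContMDiff (J.prod 𝓘(ℝ, ℝ)) (J.prod 𝓘(ℝ, ℝ)).tangent ∞
      (fun q : N × ℝ => (equivTangentBundleProd J N 𝓘(ℝ, ℝ) ℝ).symm
        (⟨q.1, 0⟩, ⟨q.2, (1 : ℝ)⟩)) := by
    refine contMDiff_equivTangentBundleProd_symm.comp (ContMDiff.prodMk ?_ ?_)
    · exact (Bundle.contMDiff_zeroSection ℝ (TangentSpace J (M := N))).comp contMDiff_fst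
    · have h2 : ContMDiff 𝓘(ℝ, ℝ) 𝓘(ℝ, ℝ).tangent ∞
          (fun y : ℝ => (⟨y, (1 : ℝ)⟩ : TangentBundle 𝓘(ℝ, ℝ) ℝ)) :=
        (contMDiff_vectorSpace_iff_contDiff (V := fun _ : ℝ => (1 : ℝ))).2 contDiff_const
      exact h2.comp contMDiff_snd
  have h3 := hα.comp ((hG.contMDiff_tangentMap (m := ∞) (by simp)).comp h1)
  refine h3.congr fun q => ?_
  have h4 : HasMFDerivAt 𝓘(ℝ, ℝ) (J.prod 𝓘(ℝ, ℝ)) (fun τ : ℝ => (q.1, τ)) q.2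
      ((0 : ℝ →L[ℝ] F₁).prod (ContinuousLinearMap.id ℝ ℝ)) :=
    (hasMFDerivAt_const q.1 q.2).prodMk (hasMFDerivAt_id q.2)
  have h5 : HasMFDerivAt (J.prod 𝓘(ℝ, ℝ)) I G (q.1, q.2) _ :=
    (hG.mdifferentiable (by simp) (q.1, q.2)).hasMFDerivAt
  have h6 := (h5.comp q.2 h4).mfderiv
  have h7 := congrArg (fun A : ℝ →L[ℝ] F => A 1) h6
  exact congrArg (fun v : F => (show F →L[ℝ] ℝ from α (G q)) v) h7

/-- A smooth isotopy that preserves a smooth primitive `α` of the symplectic form is Hamiltonian,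
and its Hamiltonian is the value of `α` on its velocity. -/
theorem isHamiltonianIsotopy_of_preserves [I.Boundaryless] [IsManifold I ∞ M]
    [FiniteDimensional ℝ F] {α : OneForm I M} (hα : α.IsSmooth) {Ψ : ℝ → Equiv.Perm M}
    (hΨ : IsSmoothFamily I Ψ) (h0 : Ψ 0 = 1)
    (hpres : ∀ t (γ : ℝ → M), ContMDiffAt 𝓘(ℝ, ℝ) I ∞ γ 0 →
      α.ev (fun ε => Ψ t (γ ε)) 0 = α.ev γ 0) :
    IsHamiltonianIsotopy α (fun t z => α.ev (fun τ => Ψ τ ((Ψ t).symm z)) t) Ψ := by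
  have hswap : ContMDiff (I.prod 𝓘(ℝ, ℝ)) I ∞ (fun q : M × ℝ => Ψ q.2 q.1) :=
    hΨ.1.comp (contMDiff_snd.prodMk contMDiff_fst)
  have hsm : ContMDiff (𝓘(ℝ, ℝ).prod I) 𝓘(ℝ, ℝ) ∞
      (fun q : ℝ × M => α.ev (fun τ => Ψ τ ((Ψ q.1).symm q.2)) q.1) :=
    (hα.contMDiff_ev hswap).comp (hΨ.2.prodMk contMDiff_fst)
  refine ⟨hsm, hΨ, h0, ?_⟩
  intro t
  set h : M → ℝ := fun z => α.ev (fun τ => Ψ τ ((Ψ t).symm z)) t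
  have hh : ContMDiff I 𝓘(ℝ, ℝ) ∞ h := hsm.comp (contMDiff_const.prodMk contMDiff_id)
  -- Cartan's formula, read on the surface (τ, ε) ↦ Ψ_τ (γ ε): the value of α on ∂_ε does not depend
  -- on τ because Ψ preserves α, so only minus the ε-derivative of α (∂_τ), the claimed Hamiltonian,
  -- survives.
  have main : ∀ γ : ℝ → M, ContMDiffAt 𝓘(ℝ, ℝ) I ∞ γ 0 →
      α.d (Ψ t (γ 0)) (velocity I (fun τ => Ψ τ (γ 0)) t) (velocity I (fun ε => Ψ t (γ ε)) 0) =
        -(show ℝ from mfderiv I 𝓘(ℝ, ℝ) h (Ψ t (γ 0)) (velocity I (fun ε => Ψ t (γ ε)) 0)) := by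
    intro γ hγ
    have hG : ContMDiffAt 𝓘(ℝ, ℝ × ℝ) I ∞ (fun q : ℝ × ℝ => Ψ q.1 (γ q.2)) (t, 0) := by
      have hγ' : ContMDiffAt 𝓘(ℝ, ℝ) I ∞ γ (Prod.snd (t, (0 : ℝ))) := hγ
      have h2 : ContMDiffAt 𝓘(ℝ, ℝ × ℝ) 𝓘(ℝ, ℝ) ∞ (Prod.snd : ℝ × ℝ → ℝ) (t, 0) := by
        rw [contMDiffAt_iff_contDiffAt]; fun_prop
      have h1 : ContMDiffAt 𝓘(ℝ, ℝ × ℝ) 𝓘(ℝ, ℝ) ∞ (Prod.fst : ℝ × ℝ → ℝ) (t, 0) := by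
        rw [contMDiffAt_iff_contDiffAt]; fun_prop
      exact hΨ.1.contMDiffAt.comp (t, (0 : ℝ)) (h1.prodMk (hγ'.comp (t, (0 : ℝ)) h2))
    have h1 := OneForm.d_velocity_velocity hα (hG.of_le (by norm_cast))
    refine h1.trans ?_
    have h2 : (fun τ => α.ev (fun ε => Ψ τ (γ ε)) 0) = fun _ => α.ev γ 0 :=
      funext fun τ => hpres τ γ hγ
    have h3 : (fun ε => α.ev (fun τ => Ψ τ (γ ε)) t) = fun ε => h (Ψ t (γ ε)) := by
      funext ε
      simp [h]
    change deriv (fun τ => α.ev (fun ε => Ψ τ (γ ε)) 0) t -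
      deriv (fun ε => α.ev (fun τ => Ψ τ (γ ε)) t) 0 = _
    rw [h2, h3, deriv_const, zero_sub]
    congr 1
    have h4 : MDifferentiableAt 𝓘(ℝ, ℝ) I (fun ε => Ψ t (γ ε)) 0 :=
      ((hΨ.contMDiff t).mdifferentiable (by simp) _).comp (0 : ℝ)
        (hγ.mdifferentiableAt (by simp))
    have h5 := velocity_comp (γ := fun ε => Ψ t (γ ε)) (hh.mdifferentiable (by simp) _) h4
    refine Eq.trans ?_ h5
    unfold velocity
    rw [mfderiv_eq_fderiv]
    rfl
  intro z w
  -- Any w is realized by pulling a curve through Ψ_t z back by Ψ_t; the equalities of base points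
  -- then hold only propositionally, hence the transport in `fin`.
  obtain ⟨c, hc, hc0, hcw⟩ := exists_curve (I := I) (Ψ t z) w
  have hγ : ContMDiffAt 𝓘(ℝ, ℝ) I ∞ (fun ε => (Ψ t).symm (c ε)) 0 :=
    (hΨ.inv.contMDiff t).contMDiffAt.comp (0 : ℝ) hc
  have hm := main _ hγ
  have hγ0 : (Ψ t).symm (c 0) = z := by rw [hc0]; simp
  have hcw' : (show F from velocity I (fun ε => Ψ t ((Ψ t).symm (c ε))) 0) = w := by
    refine (velocity_congr (Filter.Eventually.of_forall fun ε => ?_)).trans hcw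
    exact (Ψ t).apply_symm_apply _
  generalize hv : (show F from velocity I (fun ε => Ψ t ((Ψ t).symm (c ε))) 0) = v at hcw'
  subst hcw'
  have fin : ∀ (z' : M) (v' : F), z' = z → v' = v →
      α.d (Ψ t z') (velocity I (fun τ => Ψ τ z') t) v' =
        -(show ℝ from mfderiv I 𝓘(ℝ, ℝ) h (Ψ t z') v') →
      α.d (Ψ t z) (velocity I (fun τ => Ψ τ z) t) v =
        -(show ℝ from mfderiv I 𝓘(ℝ, ℝ) h (Ψ t z) v) := by
    rintro z' v' rfl rfl hh
    exact hh
  exact fin _ _ hγ0 hv hm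

theorem IsSmoothFamily.mdifferentiableAt_trajectory {f : ℝ → Equiv.Perm M}
    (hf : IsSmoothFamily I f) (x : M) (t : ℝ) :
    MDifferentiableAt 𝓘(ℝ, ℝ) I (fun τ => f τ x) t :=
  (hf.1.comp (contMDiff_id.prodMk contMDiff_const)).mdifferentiable (by simp) t

end Velocity

/-! ### Hamilton's equation on a surface containing a trajectory -/

section HamiltonianSurface

variable {F : Type*} [NormedAddCommGroup F] [NormedSpace ℝ F]
  {H : Type*} [TopologicalSpace H] {I : ModelWithCorners ℝ F H}
  {M : Type*} [TopologicalSpace M] [ChartedSpace H M]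

/-- Hamilton's equation is tested against ∂_ε G. Only the edge ε = 0 must be a trajectory, so h can
be probed in a direction about which the flow says nothing. -/
theorem IsHamiltonianIsotopy.deriv_eq [I.Boundaryless] [IsManifold I ∞ M]
    [FiniteDimensional ℝ F] {α : OneForm I M} (hα : α.IsSmooth) {h : ℝ → M → ℝ}
    {Ψ : ℝ → Equiv.Perm M} (hΨ : IsHamiltonianIsotopy α h Ψ) {z : M} {t : ℝ} {G : ℝ × ℝ → M}
    (hG : ContMDiffAt 𝓘(ℝ, ℝ × ℝ) I 2 G (t, 0)) (hz : ∀ τ, G (τ, 0) = Ψ τ z) :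
    deriv (fun τ => α.ev (fun ε => G (τ, ε)) 0) t - deriv (fun ε => α.ev (fun τ => G (τ, ε)) t) 0 =
      -deriv (fun ε => h t (G (t, ε))) 0 := by
  have h1 : ∀ γ : ℝ → M, (γ = fun τ => Ψ τ z) → ∀ w : F,
      α.d (γ t) (velocity I γ t) w = -(show ℝ from mfderiv I 𝓘(ℝ, ℝ) (h t) (γ t) w) := by
    rintro _ rfl w
    exact hΨ.2.2.2 t z w
  rw [← OneForm.d_velocity_velocity hα hG]
  refine (h1 (fun τ => G (τ, 0)) (funext hz) _).trans ?_
  congr 1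
  have h2 : ContMDiff I 𝓘(ℝ, ℝ) ∞ (h t) := hΨ.1.comp (contMDiff_const.prodMk contMDiff_id)
  have h3 : MDifferentiableAt 𝓘(ℝ, ℝ) I (fun ε => G (t, ε)) 0 := by
    have h4 : DifferentiableAt ℝ (fun ε : ℝ => (t, ε)) 0 := by fun_prop
    exact (hG.mdifferentiableAt (by simp)).comp (0 : ℝ) h4.mdifferentiableAt
  have h5 := velocity_comp (γ := fun ε => G (t, ε)) (h2.mdifferentiable (by simp) _) h3
  refine h5.symm.trans ?_
  unfold velocity
  rw [mfderiv_eq_fderiv]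
  rfl

end HamiltonianSurface

/-! ### Conformal factors and velocities of contact isotopies -/

section ContactFamilies

variable {E : Type*} [NormedAddCommGroup E] [NormedSpace ℝ E]
  {V : Type*} [TopologicalSpace V] [ChartedSpace E V] [IsManifold 𝓘(ℝ, E) ∞ V]
  {lam : ContactForm E V} (a : ReebCircleAction lam)

/-- The conformal factor of a contactomorphism: the factor by which it scales `lam` along the
Reeb direction. -/
def conf (φ : V → V) (x : V) : ℝ := lam.form.ev (fun τ => φ (a.e τ x)) 0

theorem contMDiff_orbit (x : V) : ContMDiff 𝓘(ℝ, ℝ) 𝓘(ℝ, E) ∞ (fun τ => a.e τ x) :=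
  a.smooth.comp (contMDiff_id.prodMk contMDiff_const)

/-- The factor is read off on the Reeb field, where the contact form equals 1. This turns the
existential factor in `PreservesContact` into a formula that is visibly smooth in families. -/
theorem conf_spec {φ : V → V} (hφ : PreservesContact lam φ) (hs : ContMDiff 𝓘(ℝ, E) 𝓘(ℝ, E) ∞ φ)
    (x : V) : 0 < conf a φ x ∧ ∀ v : TangentSpace 𝓘(ℝ, E) x,
      lam.form (φ x) (mfderiv 𝓘(ℝ, E) 𝓘(ℝ, E) φ x v) = conf a φ x * lam.form x v := by
  obtain ⟨g, hg⟩ := hφ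
  have h : conf a φ x = g x := by
    have h1 := velocity_comp (γ := fun τ => a.e τ x) (t := 0)
      (hs.mdifferentiable (by simp) _) ((contMDiff_orbit a x).mdifferentiable (by simp) _)
    have h2 := (hg (a.e 0 x)).2 (velocity 𝓘(ℝ, E) (fun τ => a.e τ x) 0)
    rw [a.form_velocity, mul_one] at h2
    have h3 : conf a φ x = g (a.e 0 x) := by
      refine Eq.trans ?_ h2
      exact congrArg (fun w : E => (show E →L[ℝ] ℝ from lam.form (φ (a.e 0 x))) w) h1
    rw [h3, a.zero]
  rw [h]
  exact hg x

/-- The action of a contactomorphism on the value of the contact form on a velocity. -/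
theorem ev_comp_contact {φ : V → V} (hφ : PreservesContact lam φ)
    (hs : ContMDiff 𝓘(ℝ, E) 𝓘(ℝ, E) ∞ φ) {γ : ℝ → V} {t : ℝ}
    (hγ : MDifferentiableAt 𝓘(ℝ, ℝ) 𝓘(ℝ, E) γ t) :
    lam.form.ev (fun τ => φ (γ τ)) t = conf a φ (γ t) * lam.form.ev γ t := by
  have h1 := velocity_comp (hs.mdifferentiable (by simp) _) hγ
  refine Eq.trans ?_ ((conf_spec a hφ hs (γ t)).2 (velocity 𝓘(ℝ, E) γ t))
  exact congrArg (fun w : E => (show E →L[ℝ] ℝ from lam.form (φ (γ t))) w) h1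

variable (lam) in
/-- A smooth family of contactomorphisms. -/
def IsContactFamily {P : Type*} [NormedAddCommGroup P] [NormedSpace ℝ P]
    (f : P → Equiv.Perm V) : Prop :=
  IsSmoothFamily 𝓘(ℝ, E) f ∧ ∀ p, PreservesContact lam (f p)

variable {P : Type*} [NormedAddCommGroup P] [NormedSpace ℝ P] {f g : P → Equiv.Perm V}

theorem IsContactFamily.mul (hf : IsContactFamily lam f) (hg : IsContactFamily lam g) :
    IsContactFamily lam (f * g) :=
  ⟨hf.1.mul hg.1, fun p => (hf.2 p).comp (hg.2 p) (hf.1.contMDiff p) (hg.1.contMDiff p)⟩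

theorem IsContactFamily.inv (hf : IsContactFamily lam f) : IsContactFamily lam f⁻¹ :=
  ⟨hf.1.inv, fun p => (hf.2 p).symm (hf.1.contMDiff p) (hf.1.inv.contMDiff p)⟩

theorem IsContactFamily.comp (hf : IsContactFamily lam f) {Q : Type*} [NormedAddCommGroup Q]
    [NormedSpace ℝ Q] {σ : Q → P} (hσ : ContDiff ℝ ∞ σ) :
    IsContactFamily lam (fun q => f (σ q)) :=
  ⟨hf.1.comp hσ, fun q => hf.2 (σ q)⟩

theorem IsContactFamily.conf_pos (hf : IsContactFamily lam f) (p : P) (x : V) :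
    0 < conf a (f p) x :=
  (conf_spec a (hf.2 p) (hf.1.contMDiff p) x).1

theorem IsContactFamily.contMDiff_conf (hf : IsContactFamily lam f) :
    ContMDiff (𝓘(ℝ, P).prod 𝓘(ℝ, E)) 𝓘(ℝ, ℝ) ∞ (fun q : P × V => conf a (f q.1) q.2) := by
  have h : ContMDiff ((𝓘(ℝ, P).prod 𝓘(ℝ, E)).prod 𝓘(ℝ, ℝ)) 𝓘(ℝ, E) ∞
      (fun q : (P × V) × ℝ => f q.1.1 (a.e q.2 q.1.2)) :=
    hf.1.1.comp ((contMDiff_fst.comp contMDiff_fst).prodMk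
      (a.smooth.comp (contMDiff_snd.prodMk (contMDiff_snd.comp contMDiff_fst))))
  exact (lam.smooth.contMDiff_ev h).comp (contMDiff_id.prodMk contMDiff_const)

variable (lam) in
/-- The value of the contact form on the velocity at time `t` of the trajectory of `x`. -/
def cham (f : ℝ → Equiv.Perm V) (t : ℝ) (x : V) : ℝ := lam.form.ev (fun τ => f τ x) t

/-- The velocity of f_t g_t x is that of f at g_t x plus the image under f_t of that of g; f_t
scales the contact form by its conformal factor. As this factor is positive, signs add up under
products. -/
theorem cham_mul {f g : ℝ → Equiv.Perm V} (hf : IsContactFamily lam f)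
    (hg : IsContactFamily lam g) (t : ℝ) (x : V) :
    cham lam (f * g) t x = cham lam f t (g t x) + conf a (f t) (g t x) * cham lam g t x := by
  have hG : MDifferentiableAt 𝓘(ℝ, ℝ × ℝ) 𝓘(ℝ, E) (fun q : ℝ × ℝ => f q.1 (g q.2 x)) (t, t) := by
    have h1 : ContMDiff 𝓘(ℝ, ℝ × ℝ) 𝓘(ℝ, ℝ) ∞ (Prod.fst : ℝ × ℝ → ℝ) := contDiff_fst.contMDiff
    have h2 : ContMDiff 𝓘(ℝ, ℝ × ℝ) 𝓘(ℝ, ℝ) ∞ (Prod.snd : ℝ × ℝ → ℝ) := contDiff_snd.contMDiff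
    exact (hf.1.1.comp (h1.prodMk (hg.1.1.comp (h2.prodMk contMDiff_const)))).mdifferentiable
      (by simp) _
  refine (lam.form.ev_diag hG).trans ?_
  congr 1
  exact ev_comp_contact a (hf.2 t) (hf.1.contMDiff t) (hg.1.mdifferentiableAt_trajectory x t)

theorem contMDiff_cham {f : ℝ → Equiv.Perm V} (hf : IsSmoothFamily 𝓘(ℝ, E) f) :
    ContMDiff (𝓘(ℝ, ℝ).prod 𝓘(ℝ, E)) 𝓘(ℝ, ℝ) ∞ (fun q : ℝ × V => cham lam f q.1 q.2) := by
  have h : ContMDiff (𝓘(ℝ, E).prod 𝓘(ℝ, ℝ)) 𝓘(ℝ, E) ∞ (fun q : V × ℝ => f q.2 q.1) :=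
    hf.1.comp (contMDiff_snd.prodMk contMDiff_fst)
  exact (lam.smooth.contMDiff_ev h).comp (contMDiff_snd.prodMk contMDiff_fst)

theorem cham_reparam {f : ℝ → Equiv.Perm V} (hf : IsSmoothFamily 𝓘(ℝ, E) f) {σ : ℝ → ℝ} {t : ℝ}
    (hσ : DifferentiableAt ℝ σ t) (x : V) :
    cham lam (fun τ => f (σ τ)) t x = deriv σ t * cham lam f (σ t) x :=
  lam.form.ev_reparam (hf.mdifferentiableAt_trajectory x (σ t)) hσ

theorem cham_const (φ : Equiv.Perm V) (t : ℝ) (x : V) : cham lam (fun _ => φ) t x = 0 :=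
  lam.form.ev_const _ t

theorem cham_congr {f g : ℝ → Equiv.Perm V} {t : ℝ} (h : f =ᶠ[nhds t] g) (x : V) :
    cham lam f t x = cham lam g t x :=
  lam.form.ev_congr (h.mono fun _ hτ => DFunLike.congr_fun hτ x)

end ContactFamilies

/-! ### Lifts to the symplectization and contact Hamiltonians -/

section Lift

variable {E : Type*} [NormedAddCommGroup E] [NormedSpace ℝ E]
  {V : Type*} [TopologicalSpace V] [ChartedSpace E V] [IsManifold 𝓘(ℝ, E) ∞ V]
  {lam : ContactForm E V}

theorem liouville_ev {γ : ℝ → SV V} {t : ℝ} (hγ : MDifferentiableAt 𝓘(ℝ, ℝ) (modelSV E) γ t) :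
    (liouville lam).ev γ t = ((γ t).2 : ℝ) * lam.form.ev (fun τ => (γ τ).1) t := by
  have h1 := velocity_comp (φ := (Prod.fst : SV V → V)) (I := modelSV E) (I' := 𝓘(ℝ, E))
    mdifferentiableAt_fst hγ
  rw [mfderiv_fst] at h1
  change ((γ t).2 : ℝ) * (show E →L[ℝ] ℝ from lam.form (γ t).1)
    (show E × ℝ from velocity (modelSV E) γ t).1 = _
  congr 1
  exact (congrArg (fun w : E => (show E →L[ℝ] ℝ from lam.form (γ t).1) w) h1).symm

theorem liouville_isSmooth : (liouville lam).IsSmooth := by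
  have h1 := (contMDiff_fst (I := 𝓘(ℝ, E)) (J := 𝓘(ℝ, ℝ)) (M := V) (N := PosReals)
    (n := ∞)).contMDiff_tangentMap (m := ∞) (by simp)
  have h2 := lam.smooth.comp h1
  have h3 : ContMDiff (modelSV E).tangent 𝓘(ℝ, ℝ) ∞
      (fun p : TangentBundle (modelSV E) (SV V) => ((p.1.2 : ℝ))) :=
    contMDiff_subtype_val.comp (contMDiff_snd.comp (Bundle.contMDiff_proj _))
  refine (h3.mul h2).congr fun p => ?_
  change _ = ((p.1.2 : ℝ)) * (show E →L[ℝ] ℝ from lam.form p.1.1)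
    (tangentMap (modelSV E) 𝓘(ℝ, E) (Prod.fst : SV V → V) p).2
  rw [tangentMap_prodFst]
  rfl

/-- The lift to the symplectization of a contactomorphism with conformal factor `g`. -/
def lift (φ : Equiv.Perm V) (g : V → ℝ) (hg : ∀ x, 0 < g x) : Equiv.Perm (SV V) where
  toFun z := (φ z.1, ⟨z.2 / g z.1, div_pos (mem_Ioi.1 z.2.2) (hg _)⟩)
  invFun z := (φ.symm z.1, ⟨z.2 * g (φ.symm z.1), mul_pos (mem_Ioi.1 z.2.2) (hg _)⟩)
  left_inv z := by
    refine Prod.ext (by simp) (Subtype.ext ?_)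
    simp [(hg z.1).ne']
  right_inv z := by
    refine Prod.ext (by simp) (Subtype.ext ?_)
    simp [(hg (φ.symm z.1)).ne']

variable (a : ReebCircleAction lam) {P : Type*} [NormedAddCommGroup P] [NormedSpace ℝ P]
  {f : P → Equiv.Perm V}

/-- The lift of a smooth family of contactomorphisms to the symplectization. -/
def liftFamily (hf : IsContactFamily lam f) (p : P) : Equiv.Perm (SV V) :=
  lift (f p) (conf a (f p)) (hf.conf_pos a p)

theorem liftFamily_isSmooth (hf : IsContactFamily lam f) :
    IsSmoothFamily (modelSV E) (liftFamily a hf) := by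
  have hp : ContMDiff (𝓘(ℝ, P).prod (modelSV E)) 𝓘(ℝ, P) ∞ (fun q : P × SV V => q.1) :=
    contMDiff_fst
  have hx : ContMDiff (𝓘(ℝ, P).prod (modelSV E)) 𝓘(ℝ, E) ∞ (fun q : P × SV V => q.2.1) :=
    contMDiff_fst.comp contMDiff_snd
  have hs : ContMDiff (𝓘(ℝ, P).prod (modelSV E)) 𝓘(ℝ, ℝ) ∞
      (fun q : P × SV V => (q.2.2 : ℝ)) :=
    contMDiff_subtype_val.comp (contMDiff_snd.comp contMDiff_snd)
  have hy := hf.1.2.comp (hp.prodMk hx)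
  refine ⟨(hf.1.1.comp (hp.prodMk hx)).prodMk ?_, hy.prodMk ?_⟩
  · rw [← ContMDiff.subtypeVal_comp_iff]
    have hc := (hf.contMDiff_conf a).comp (hp.prodMk hx)
    exact hs.div₀ hc fun q => (hf.conf_pos a _ _).ne'
  · rw [← ContMDiff.subtypeVal_comp_iff]
    have hc := (hf.contMDiff_conf a).comp (hp.prodMk hy)
    exact hs.mul hc

/-- The lift divides s by the conformal factor, which cancels the scaling of the contact form. -/
theorem liouville_ev_liftFamily (hf : IsContactFamily lam f) (p : P) {γ : ℝ → SV V} {t : ℝ}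
    (hγ : MDifferentiableAt 𝓘(ℝ, ℝ) (modelSV E) γ t) :
    (liouville lam).ev (fun ε => liftFamily a hf p (γ ε)) t = (liouville lam).ev γ t := by
  have h1 : MDifferentiableAt 𝓘(ℝ, ℝ) (modelSV E) (fun ε => liftFamily a hf p (γ ε)) t :=
    (((liftFamily_isSmooth a hf).contMDiff p).mdifferentiable (by simp) _).comp t hγ
  have h2 : MDifferentiableAt 𝓘(ℝ, ℝ) 𝓘(ℝ, E) (fun ε => (γ ε).1) t :=
    (mdifferentiableAt_fst (I := 𝓘(ℝ, E)) (I' := 𝓘(ℝ, ℝ))).comp t hγ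
  rw [liouville_ev h1, liouville_ev hγ]
  have h3 := ev_comp_contact a (hf.2 p) (hf.1.contMDiff p) h2
  have h4 := (hf.conf_pos a p (γ t).1).ne'
  change ((γ t).2 : ℝ) / conf a (f p) (γ t).1 * lam.form.ev (fun τ => f p ((γ τ).1)) t = _
  rw [h3]
  field_simp

theorem conf_one (x : V) : conf a (1 : Equiv.Perm V) x = 1 := a.form_velocity 0 x

theorem liftFamily_of_eq_one (hf : IsContactFamily lam f) {p : P} (hp : f p = 1) :
    liftFamily a hf p = 1 := by
  ext1 z
  refine Prod.ext ?_ (Subtype.ext ?_)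
  · change f p z.1 = z.1
    rw [hp]; rfl
  · change (z.2 : ℝ) / conf a (f p) z.1 = z.2
    rw [hp, conf_one, div_one]

/-- The contact Hamiltonian of a contact isotopy. -/
theorem isContactHamiltonian_cham [FiniteDimensional ℝ E] (a : ReebCircleAction lam) {f : ℝ → Equiv.Perm V}
    (hf : IsContactFamily lam f) (h0 : f 0 = 1) :
    IsContactHamiltonian lam (fun t z => (z.2 : ℝ) * cham lam f t ((f t).symm z.1)) f := by
  refine ⟨fun t c z => ?_, liftFamily a hf, ?_, fun t z => rfl⟩
  · change c.1 * (z.2 : ℝ) * _ = _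
    rw [mul_assoc]; rfl
  · have h1 := isHamiltonianIsotopy_of_preserves liouville_isSmooth (liftFamily_isSmooth a hf)
      (liftFamily_of_eq_one a hf h0)
      (fun t γ hγ => liouville_ev_liftFamily a hf t (hγ.mdifferentiableAt (by simp)))
    convert h1 using 3 with t z
    have h2 : MDifferentiableAt 𝓘(ℝ, ℝ) (modelSV E)
        (fun τ => liftFamily a hf τ ((liftFamily a hf t).symm z)) t :=
      ((liftFamily_isSmooth a hf).1.comp
        (contMDiff_id.prodMk contMDiff_const)).mdifferentiable (by simp) t
    rw [liouville_ev h2, Equiv.apply_symm_apply]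
    rfl

/-- Euler's identity for the homogeneous function h: on the surface of dilated trajectories e^ε ·
Ψ_τ w the form vanishes on ∂_ε, while its value on ∂_τ and the value of h both scale by e^ε.
Differentiating at ε = 0 gives h. Hence the Hamiltonian is determined by the isotopy of V, whichever
lift Ψ is used. -/
theorem IsContactHamiltonian.eq_cham [FiniteDimensional ℝ E] {h : ℝ → SV V → ℝ}
    {f : ℝ → Equiv.Perm V} (hh : IsContactHamiltonian lam h f) (t : ℝ) (z : SV V) :
    h t z = (z.2 : ℝ) * cham lam f t ((f t).symm z.1) := by
  obtain ⟨hom, Ψ, hΨ, hΨf⟩ := hh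
  obtain ⟨w, rfl⟩ := (Ψ t).surjective z
  let ex : ℝ → PosReals := fun ε => ⟨Real.exp ε, Real.exp_pos ε⟩
  let G : ℝ × ℝ → SV V := fun q => scaleSV (ex q.2) (Ψ q.1 w)
  have h1 : ContMDiff 𝓘(ℝ, ℝ × ℝ) 𝓘(ℝ, ℝ) ∞ (Prod.fst : ℝ × ℝ → ℝ) := contDiff_fst.contMDiff
  have hΨw : ContMDiff 𝓘(ℝ, ℝ × ℝ) (modelSV E) ∞ (fun q : ℝ × ℝ => Ψ q.1 w) :=
    hΨ.2.1.1.comp (h1.prodMk contMDiff_const)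
  have hG : ContMDiff 𝓘(ℝ, ℝ × ℝ) (modelSV E) ∞ G := by
    refine (contMDiff_fst.comp hΨw).prodMk ?_
    rw [← ContMDiff.subtypeVal_comp_iff]
    have h2 : ContMDiff 𝓘(ℝ, ℝ × ℝ) 𝓘(ℝ, ℝ) ∞ (fun q : ℝ × ℝ => Real.exp q.2) :=
      ContDiff.contMDiff (by fun_prop)
    exact h2.mul (contMDiff_subtype_val.comp (contMDiff_snd.comp hΨw))
  have hz : ∀ τ, G (τ, 0) = Ψ τ w := by
    intro τ
    refine Prod.ext rfl (Subtype.ext ?_)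
    change Real.exp 0 * _ = _
    rw [Real.exp_zero, one_mul]
  have key := hΨ.deriv_eq liouville_isSmooth (t := t)
    (hG.contMDiffAt.of_le (by norm_cast)) hz
  have hGd : ∀ q, MDifferentiableAt 𝓘(ℝ, ℝ × ℝ) (modelSV E) G q :=
    hG.mdifferentiable (by simp)
  have e1 : (fun τ => (liouville lam).ev (fun ε => G (τ, ε)) 0) = fun _ => 0 := by
    funext τ
    have hd : DifferentiableAt ℝ (fun ε : ℝ => (τ, ε)) 0 := by fun_prop
    rw [liouville_ev (γ := fun ε => G (τ, ε)) ((hGd _).comp (0 : ℝ) hd.mdifferentiableAt)]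
    change _ * lam.form.ev (fun _ => (Ψ τ w).1) 0 = 0
    rw [lam.form.ev_const, mul_zero]
  have e2 : (fun ε => (liouville lam).ev (fun τ => G (τ, ε)) t) =
      fun ε => Real.exp ε * (((Ψ t w).2 : ℝ) * cham lam f t w.1) := by
    funext ε
    have hd : DifferentiableAt ℝ (fun τ : ℝ => (τ, ε)) t := by fun_prop
    rw [liouville_ev (γ := fun τ => G (τ, ε)) ((hGd _).comp t hd.mdifferentiableAt)]
    change Real.exp ε * ((Ψ t w).2 : ℝ) * lam.form.ev (fun τ => (Ψ τ w).1) t = _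
    rw [mul_assoc]
    simp only [hΨf]
    rfl
  have e3 : (fun ε => h t (G (t, ε))) = fun ε => Real.exp ε * h t (Ψ t w) := by
    funext ε
    exact hom t (ex ε) _
  have hexp : ∀ c : ℝ, deriv (fun ε => Real.exp ε * c) 0 = c := by
    intro c
    rw [((Real.hasDerivAt_exp 0).mul_const c).deriv, Real.exp_zero, one_mul]
  rw [e1, e2, e3, hexp, hexp, deriv_const] at key
  rw [hΨf, Equiv.symm_apply_apply]
  linarith

end Lift

/-! ### Calculus on the circle ℝ/ℤ -/

section CircleCalculus

theorem coe_chartAt_circle {θ₀ θ : UnitAddCircle} (h : θ ∈ (chartAt ℝ θ₀).source) :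
    ((chartAt ℝ θ₀ θ : ℝ) : UnitAddCircle) = θ :=
  (AddCircle.openPartialHomeomorphCoe (1 : ℝ) (circleLift θ₀ - 1 / 2)).right_inv h

theorem periodic_circleLift {X : Type*} {Q : ℝ → X} (hper : ∀ t, Q (t + 1) = Q t) {θ : UnitAddCircle}
    {t : ℝ} (h : (t : UnitAddCircle) = θ) : Q (circleLift θ) = Q t := by
  have hp : Function.Periodic Q 1 := hper
  have h1 := hp.lift_coe (circleLift θ)
  have h2 := hp.lift_coe t
  rw [← h1, ← h2, circleLift_coe, h]

variable {F₁ : Type*} [NormedAddCommGroup F₁] [NormedSpace ℝ F₁]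
  {H₁ : Type*} [TopologicalSpace H₁] {J : ModelWithCorners ℝ F₁ H₁}
  {N : Type*} [TopologicalSpace N] [ChartedSpace H₁ N]
  {F : Type*} [NormedAddCommGroup F] [NormedSpace ℝ F]
  {H : Type*} [TopologicalSpace H] {I : ModelWithCorners ℝ F H}
  {M : Type*} [TopologicalSpace M] [ChartedSpace H M]

/-- A smooth function that is periodic in one variable descends to a smooth function on the
product with the circle. -/
theorem contMDiff_circleLift {Q : ℝ × N → M} (hQ : ContMDiff (𝓘(ℝ, ℝ).prod J) I ∞ Q)
    (hper : ∀ t n, Q (t + 1, n) = Q (t, n)) :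
    ContMDiff (𝓘(ℝ, ℝ).prod J) I ∞ (fun q : UnitAddCircle × N => Q (circleLift q.1, q.2)) := by
  rintro ⟨θ₀, n₀⟩
  have hc : ContMDiffAt 𝓘(ℝ, ℝ) 𝓘(ℝ, ℝ) ∞ (chartAt ℝ θ₀) θ₀ := by
    simpa using contMDiffAt_extChartAt (I := 𝓘(ℝ, ℝ)) (n := ∞) (x := θ₀)
  have hc' : ContMDiffAt (𝓘(ℝ, ℝ).prod J) 𝓘(ℝ, ℝ) ∞
      (fun q : UnitAddCircle × N => chartAt ℝ θ₀ q.1) (θ₀, n₀) :=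
    ContMDiffAt.comp (θ₀, n₀) (f := Prod.fst) (g := chartAt ℝ θ₀) hc contMDiffAt_fst
  have h1 : ContMDiffAt (𝓘(ℝ, ℝ).prod J) I ∞
      (fun q : UnitAddCircle × N => Q (chartAt ℝ θ₀ q.1, q.2)) (θ₀, n₀) :=
    hQ.contMDiffAt.comp (θ₀, n₀) (hc'.prodMk contMDiffAt_snd)
  -- `circleLift` jumps at 0, but a periodic Q does not distinguish it from the chart coordinate,
  -- which is smooth near θ₀.
  refine h1.congr_of_eventuallyEq ?_
  have h2 : ∀ᶠ q : UnitAddCircle × N in nhds (θ₀, n₀), q.1 ∈ (chartAt ℝ θ₀).source :=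
    continuous_fst.continuousAt.preimage_mem_nhds (chart_source_mem_nhds ℝ θ₀)
  filter_upwards [h2] with q hq
  exact periodic_circleLift (Q := fun t => Q (t, q.2)) (fun t => hper t q.2)
    (coe_chartAt_circle hq)

theorem contMDiff_coe_circle :
    ContMDiff 𝓘(ℝ, ℝ) 𝓘(ℝ, ℝ) ∞ (fun t : ℝ => (t : UnitAddCircle)) := by
  intro t
  set θ₀ : UnitAddCircle := (t : UnitAddCircle)
  have h1 : ContMDiffAt 𝓘(ℝ, ℝ) 𝓘(ℝ, ℝ) ∞ (chartAt ℝ θ₀).symm (chartAt ℝ θ₀ θ₀) :=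
    (contMDiffOn_chart_symm (I := 𝓘(ℝ, ℝ)) (x := θ₀)).contMDiffAt
      ((chartAt ℝ θ₀).open_target.mem_nhds (mem_chart_target ℝ θ₀))
  have h2 : (fun s : ℝ => (s : UnitAddCircle)) =
      fun s => (chartAt ℝ θ₀).symm (s + (chartAt ℝ θ₀ θ₀ - t)) := by
    funext s
    change (s : UnitAddCircle) = ((s + (chartAt ℝ θ₀ θ₀ - t) : ℝ) : UnitAddCircle)
    rw [AddCircle.coe_add, AddCircle.coe_sub, coe_chartAt_circle (mem_chart_source ℝ θ₀),
      sub_self, add_zero]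
  rw [h2]
  have h3 : ContMDiffAt 𝓘(ℝ, ℝ) 𝓘(ℝ, ℝ) ∞ (fun s : ℝ => s + (chartAt ℝ θ₀ θ₀ - t)) t := by
    rw [contMDiffAt_iff_contDiffAt]; fun_prop
  refine ContMDiffAt.comp t (g := (chartAt ℝ θ₀).symm) ?_ h3
  simpa using h1

theorem velocity_coe_circle (t : ℝ) :
    (show ℝ from velocity 𝓘(ℝ, ℝ) (fun s : ℝ => (s : UnitAddCircle)) t) = 1 := by
  set θ₀ : UnitAddCircle := (t : UnitAddCircle) with hθ₀
  rw [velocity_eq_deriv (contMDiff_coe_circle.mdifferentiable (by simp) t)]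
  have hs : ∀ᶠ s : ℝ in nhds t, s + (chartAt ℝ θ₀ θ₀ - t) ∈ (chartAt ℝ θ₀).target := by
    have hc : ContinuousAt (fun s : ℝ => s + (chartAt ℝ θ₀ θ₀ - t)) t := by fun_prop
    refine hc.preimage_mem_nhds ((chartAt ℝ θ₀).open_target.mem_nhds ?_)
    simp
  have h1 : (extChartAt 𝓘(ℝ, ℝ) θ₀ ∘ fun s : ℝ => (s : UnitAddCircle)) =ᶠ[nhds t]
      fun s => s + (chartAt ℝ θ₀ θ₀ - t) := by
    filter_upwards [hs] with s hs
    have h2 : (s : UnitAddCircle) = (chartAt ℝ θ₀).symm (s + (chartAt ℝ θ₀ θ₀ - t)) := by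
      change (s : UnitAddCircle) = ((s + (chartAt ℝ θ₀ θ₀ - t) : ℝ) : UnitAddCircle)
      rw [AddCircle.coe_add, AddCircle.coe_sub, coe_chartAt_circle (mem_chart_source ℝ θ₀),
        sub_self, add_zero]
    simp only [Function.comp, h2, mfld_simps]
    exact (chartAt ℝ θ₀).right_inv hs
  rw [h1.deriv_eq]
  simp

/-- The 1-form `dt` on the circle. -/
def circleForm : OneForm 𝓘(ℝ, ℝ) UnitAddCircle := fun _ => ContinuousLinearMap.id ℝ ℝ

/-- On a chart domain dt is the differential of the chart, because the projection ℝ → ℝ/ℤ inverts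
the chart and has velocity 1. -/
theorem circleForm_isSmooth : circleForm.IsSmooth := by
  rintro ⟨θ₀, v₀⟩
  have h1 : ContMDiffOn 𝓘(ℝ, ℝ) 𝓘(ℝ, ℝ) ∞ (chartAt ℝ θ₀) (chartAt ℝ θ₀).source :=
    contMDiffOn_chart
  have ho := (chartAt ℝ θ₀).open_source
  have h2 := h1.contMDiffOn_tangentMapWithin (m := ∞) (by simp) ho.uniqueMDiffOn
  have h3 := (contMDiff_snd_tangentBundle_modelSpace ℝ 𝓘(ℝ, ℝ) (n := ∞)).comp_contMDiffOn h2
  have hmem : Bundle.TotalSpace.proj ⁻¹' (chartAt ℝ θ₀).source ∈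
      nhds (⟨θ₀, v₀⟩ : TangentBundle 𝓘(ℝ, ℝ) UnitAddCircle) :=
    (FiberBundle.continuous_proj ℝ _).continuousAt.preimage_mem_nhds (chart_source_mem_nhds ℝ θ₀)
  refine (h3.contMDiffAt hmem).congr_of_eventuallyEq ?_
  filter_upwards [hmem] with p hp
  have hp' : p.1 ∈ (chartAt ℝ θ₀).source := hp
  simp only [Function.comp, tangentMapWithin, mfderivWithin_of_isOpen ho hp']
  have h4 : MDifferentiableAt 𝓘(ℝ, ℝ) 𝓘(ℝ, ℝ) (chartAt ℝ θ₀) p.1 :=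
    (h1.contMDiffAt (ho.mem_nhds hp')).mdifferentiableAt (by simp)
  have h5 := (contMDiff_coe_circle.mdifferentiable (by simp) (chartAt ℝ θ₀ p.1)).hasMFDerivAt.comp
    p.1 h4.hasMFDerivAt
  have h6 : (fun t : ℝ => (t : UnitAddCircle)) ∘ chartAt ℝ θ₀ =ᶠ[nhds p.1] id := by
    filter_upwards [ho.mem_nhds hp'] with θ hθ
    exact coe_chartAt_circle hθ
  have h7 := h6.mfderiv_eq (I := 𝓘(ℝ, ℝ)) (I' := 𝓘(ℝ, ℝ))
  have h8 := congrArg (fun A : ℝ →L[ℝ] ℝ => A p.2) (h5.mfderiv.symm.trans h7)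
  rw [mfderiv_id] at h8
  have h9 := velocity_coe_circle (chartAt ℝ θ₀ p.1)
  set w : ℝ := mfderiv 𝓘(ℝ, ℝ) 𝓘(ℝ, ℝ) (chartAt ℝ θ₀) p.1 p.2
  have h10 := (show ℝ →L[ℝ] ℝ from mfderiv 𝓘(ℝ, ℝ) 𝓘(ℝ, ℝ) (fun t : ℝ => (t : UnitAddCircle))
    (chartAt ℝ θ₀ p.1)).map_smul w 1
  have h11 : w = (show ℝ from p.2) := by
    have h12 : (show ℝ →L[ℝ] ℝ from mfderiv 𝓘(ℝ, ℝ) 𝓘(ℝ, ℝ) (fun t : ℝ => (t : UnitAddCircle))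
      (chartAt ℝ θ₀ p.1)) 1 = 1 := h9
    rw [h12, smul_eq_mul, mul_one] at h10
    exact h10.symm.trans h8
  exact h11.symm

end CircleCalculus

/-! ### Suspension of contractible loops, and displacement in the stabilization -/

section Stabilization

variable {E : Type*} [NormedAddCommGroup E] [NormedSpace ℝ E]
  {V : Type*} [TopologicalSpace V] [ChartedSpace E V] [IsManifold 𝓘(ℝ, E) ∞ V]
  {lam : ContactForm E V}

theorem stabLiouville_ev {γ : ℝ → StabSV V} {t : ℝ}
    (hγ : MDifferentiableAt 𝓘(ℝ, ℝ) (modelStabSV E) γ t) :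
    (stabLiouville lam).ev γ t = (liouville lam).ev (fun τ => (γ τ).1) t +
      (γ t).2.2 * circleForm.ev (fun τ => (γ τ).2.1) t := by
  have h1 := velocity_comp (φ := (Prod.fst : StabSV V → SV V)) (I := modelStabSV E)
    (I' := modelSV E) mdifferentiableAt_fst hγ
  rw [mfderiv_fst] at h1
  have h2 : MDifferentiableAt 𝓘(ℝ, ℝ) (𝓘(ℝ, ℝ).prod 𝓘(ℝ, ℝ)) (fun τ => (γ τ).2) t :=
    (mdifferentiableAt_snd (I := modelSV E) (I' := 𝓘(ℝ, ℝ).prod 𝓘(ℝ, ℝ))).comp t hγ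
  have h3 := velocity_comp (φ := (Prod.snd : StabSV V → UnitAddCircle × ℝ)) (I := modelStabSV E)
    (I' := 𝓘(ℝ, ℝ).prod 𝓘(ℝ, ℝ)) mdifferentiableAt_snd hγ
  have h4 := velocity_comp (φ := (Prod.fst : UnitAddCircle × ℝ → UnitAddCircle))
    (I := 𝓘(ℝ, ℝ).prod 𝓘(ℝ, ℝ)) (I' := 𝓘(ℝ, ℝ)) mdifferentiableAt_fst h2
  rw [mfderiv_snd] at h3
  rw [mfderiv_fst] at h4
  have h5 : (show ℝ from velocity 𝓘(ℝ, ℝ) (fun τ => (γ τ).2.1) t) =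
      (show (E × ℝ) × (ℝ × ℝ) from velocity (modelStabSV E) γ t).2.1 :=
    h4.trans (congrArg (fun w : ℝ × ℝ => w.1) h3)
  change (show E × ℝ →L[ℝ] ℝ from liouville lam (γ t).1)
      (show (E × ℝ) × (ℝ × ℝ) from velocity (modelStabSV E) γ t).1 +
    (γ t).2.2 * (show (E × ℝ) × (ℝ × ℝ) from velocity (modelStabSV E) γ t).2.1 = _
  rw [← h5]
  congr 1
  exact (congrArg (fun w : E × ℝ => (show E × ℝ →L[ℝ] ℝ from liouville lam (γ t).1) w) h1).symm

theorem stabLiouville_isSmooth : (stabLiouville lam).IsSmooth := by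
  have h1 := (contMDiff_fst (I := modelSV E) (J := 𝓘(ℝ, ℝ).prod 𝓘(ℝ, ℝ)) (M := SV V)
    (N := UnitAddCircle × ℝ) (n := ∞)).contMDiff_tangentMap (m := ∞) (by simp)
  have h2 := (contMDiff_snd (I := modelSV E) (J := 𝓘(ℝ, ℝ).prod 𝓘(ℝ, ℝ)) (M := SV V)
    (N := UnitAddCircle × ℝ) (n := ∞)).contMDiff_tangentMap (m := ∞) (by simp)
  have h3 := (contMDiff_fst (I := 𝓘(ℝ, ℝ)) (J := 𝓘(ℝ, ℝ)) (M := UnitAddCircle)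
    (N := ℝ) (n := ∞)).contMDiff_tangentMap (m := ∞) (by simp)
  have h4 : ContMDiff (modelStabSV E).tangent 𝓘(ℝ, ℝ) ∞
      (fun p : TangentBundle (modelStabSV E) (StabSV V) => p.1.2.2) :=
    contMDiff_snd.comp (contMDiff_snd.comp (Bundle.contMDiff_proj _))
  have h5 := (liouville_isSmooth (lam := lam)).comp h1
  have h6 := circleForm_isSmooth.comp (h3.comp h2)
  refine (h5.add (h4.mul h6)).congr fun p => ?_
  change _ = (show E × ℝ →L[ℝ] ℝ from liouville lam p.1.1)
      (tangentMap (modelStabSV E) (modelSV E) (Prod.fst : StabSV V → SV V) p).2 +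
    p.1.2.2 * (show ℝ from (tangentMap (𝓘(ℝ, ℝ).prod 𝓘(ℝ, ℝ)) 𝓘(ℝ, ℝ)
      (Prod.fst : UnitAddCircle × ℝ → UnitAddCircle)
        (tangentMap (modelStabSV E) (𝓘(ℝ, ℝ).prod 𝓘(ℝ, ℝ))
          (Prod.snd : StabSV V → UnitAddCircle × ℝ) p)).2)
  rw [tangentMap_prodFst, tangentMap_prodSnd, tangentMap_prodFst]
  rfl

variable (a : ReebCircleAction lam) {f : ℝ × ℝ → Equiv.Perm V}

theorem liftFamily_congr {P : Type*} [NormedAddCommGroup P] [NormedSpace ℝ P]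
    {f : P → Equiv.Perm V} (hf : IsContactFamily lam f) {p q : P} (h : f p = f q) :
    liftFamily a hf p = liftFamily a hf q := by
  simp only [liftFamily, h]

/-- The contact Hamiltonian, with respect to the second parameter, of a two-parameter family of
contactomorphisms. -/
def loopHam (lam : ContactForm E V) (f : ℝ × ℝ → Equiv.Perm V) (u t : ℝ) (w : SV V) : ℝ :=
  (w.2 : ℝ) * cham lam (fun τ => f (u, τ)) t ((f (u, t)).symm w.1)

theorem loopHam_periodic (hper : ∀ u t, f (u, t + 1) = f (u, t)) (u t : ℝ) (w : SV V) :
    loopHam lam f u (t + 1) w = loopHam lam f u t w := by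
  unfold loopHam
  rw [hper]
  congr 1
  unfold cham OneForm.ev
  have h : ∀ x : V, lam.form (f (u, t + 1) x) (velocity 𝓘(ℝ, E) (fun τ => f (u, τ) x) (t + 1)) =
      lam.form (f (u, t) x) (velocity 𝓘(ℝ, E) (fun τ => f (u, τ) x) t) := by
    intro x
    by_cases hd : MDifferentiableAt 𝓘(ℝ, ℝ) 𝓘(ℝ, E) (fun τ => f (u, τ) x) (t + 1)
    · have h1 := lam.form.ev_reparam (γ := fun τ => f (u, τ) x) (σ := fun τ => τ + 1) (t := t) hd
        (by fun_prop)
      simp only [hper] at h1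
      have h2 : deriv (fun τ : ℝ => τ + 1) t = 1 := by simp
      rw [h2, one_mul] at h1
      exact h1.symm
    -- No smoothness of f is assumed: where differentiability fails at t + 1 it fails at t, and both
    -- velocities take the default value 0.
    · have hd' : ¬ MDifferentiableAt 𝓘(ℝ, ℝ) 𝓘(ℝ, E) (fun τ => f (u, τ) x) t := by
        intro h
        apply hd
        have h1 : DifferentiableAt ℝ (fun τ : ℝ => τ - 1) (t + 1) := by fun_prop
        have h2 : MDifferentiableAt 𝓘(ℝ, ℝ) 𝓘(ℝ, E) (fun τ => f (u, τ) x) (t + 1 - 1) := by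
          rwa [add_sub_cancel_right]
        have h3 := MDifferentiableAt.comp (t + 1) (f := fun τ : ℝ => τ - 1) h2 h1.mdifferentiableAt
        convert h3 using 1
        funext τ
        simp only [Function.comp]
        rw [← hper u (τ - 1), sub_add_cancel]
      unfold velocity
      rw [mfderiv_zero_of_not_mdifferentiableAt hd, mfderiv_zero_of_not_mdifferentiableAt hd']
      exact ((lam.form _).map_zero).trans ((lam.form _).map_zero).symm
  exact h _

theorem contMDiff_cham_snd (hf : IsContactFamily lam f) :
    ContMDiff (𝓘(ℝ, ℝ × ℝ).prod 𝓘(ℝ, E)) 𝓘(ℝ, ℝ) ∞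
      (fun q : (ℝ × ℝ) × V => cham lam (fun τ => f (q.1.1, τ)) q.1.2 q.2) := by
  have e1 : ContMDiff 𝓘(ℝ, ℝ × ℝ) 𝓘(ℝ, ℝ) ∞ (Prod.fst : ℝ × ℝ → ℝ) := contDiff_fst.contMDiff
  have e2 : ContMDiff 𝓘(ℝ, ℝ × ℝ) 𝓘(ℝ, ℝ) ∞ (Prod.snd : ℝ × ℝ → ℝ) := contDiff_snd.contMDiff
  have h : ContMDiff ((𝓘(ℝ, ℝ).prod 𝓘(ℝ, E)).prod 𝓘(ℝ, ℝ)) 𝓘(ℝ, E) ∞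
      (fun q : (ℝ × V) × ℝ => f (q.1.1, q.2) q.1.2) := by
    refine hf.1.1.comp (ContMDiff.prodMk ?_ (contMDiff_snd.comp contMDiff_fst))
    exact (contMDiff_fst.comp contMDiff_fst).prodMk_space contMDiff_snd
  exact (lam.smooth.contMDiff_ev h).comp
    (((e1.comp contMDiff_fst).prodMk contMDiff_snd).prodMk (e2.comp contMDiff_fst))

theorem contMDiff_loopHam (hf : IsContactFamily lam f) :
    ContMDiff (𝓘(ℝ, ℝ × ℝ).prod (modelSV E)) 𝓘(ℝ, ℝ) ∞
      (fun q : (ℝ × ℝ) × SV V => loopHam lam f q.1.1 q.1.2 q.2) := by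
  have hs : ContMDiff (𝓘(ℝ, ℝ × ℝ).prod (modelSV E)) 𝓘(ℝ, ℝ) ∞
      (fun q : (ℝ × ℝ) × SV V => (q.2.2 : ℝ)) :=
    contMDiff_subtype_val.comp (contMDiff_snd.comp contMDiff_snd)
  have hx : ContMDiff (𝓘(ℝ, ℝ × ℝ).prod (modelSV E)) (𝓘(ℝ, ℝ × ℝ).prod 𝓘(ℝ, E)) ∞
      (fun q : (ℝ × ℝ) × SV V => (q.1, (f q.1).symm q.2.1)) :=
    contMDiff_fst.prodMk (hf.1.2.comp (contMDiff_fst.prodMk (contMDiff_fst.comp contMDiff_snd)))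
  exact hs.mul ((contMDiff_cham_snd hf).comp hx)

/-- The Hamiltonian isotopy of the stabilization that is suspended from a family of loops of
contactomorphisms. -/
def suspension (hf : IsContactFamily lam f) (u : ℝ) : Equiv.Perm (StabSV V) where
  toFun z :=
    (liftFamily a hf (u, circleLift z.2.1) z.1, (z.2.1, z.2.2 - loopHam lam f u (circleLift z.2.1)
      (liftFamily a hf (u, circleLift z.2.1) z.1)))
  invFun z :=
    ((liftFamily a hf (u, circleLift z.2.1)).symm z.1, (z.2.1, z.2.2 +
      loopHam lam f u (circleLift z.2.1) z.1))
  left_inv z := by simp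
  right_inv z := by simp

/-- All components are smooth functions of a real time t that are 1-periodic in t, so they descend
to the circle. -/
theorem suspension_isSmooth (hf : IsContactFamily lam f) (hper : ∀ u t, f (u, t + 1) = f (u, t)) :
    IsSmoothFamily (modelStabSV E) (suspension a hf) := by
  have hL := liftFamily_isSmooth a hf
  -- reordering of the variables `(u, z, θ)` and of their lifts
  have ht : ContMDiff (𝓘(ℝ, ℝ).prod (𝓘(ℝ, ℝ).prod (modelSV E))) 𝓘(ℝ, ℝ × ℝ) ∞
      (fun q : ℝ × (ℝ × SV V) => (q.2.1, q.1)) :=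
    (contMDiff_fst.comp contMDiff_snd).prodMk_space contMDiff_fst
  have hw : ContMDiff (𝓘(ℝ, ℝ).prod (𝓘(ℝ, ℝ).prod (modelSV E))) (modelSV E) ∞
      (fun q : ℝ × (ℝ × SV V) => q.2.2) := contMDiff_snd.comp contMDiff_snd
  have hr : ContMDiff (𝓘(ℝ, ℝ).prod (modelStabSV E))
      (𝓘(ℝ, ℝ).prod (𝓘(ℝ, ℝ).prod (modelSV E))) ∞
      (fun q : ℝ × StabSV V => (q.2.2.1, (q.1, q.2.1))) :=
    (contMDiff_fst.comp (contMDiff_snd.comp contMDiff_snd)).prodMk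
      (contMDiff_fst.prodMk (contMDiff_fst.comp contMDiff_snd))
  have hθ : ContMDiff (𝓘(ℝ, ℝ).prod (modelStabSV E)) 𝓘(ℝ, ℝ) ∞
      (fun q : ℝ × StabSV V => q.2.2.1) := contMDiff_fst.comp (contMDiff_snd.comp contMDiff_snd)
  have hρ : ContMDiff (𝓘(ℝ, ℝ).prod (modelStabSV E)) 𝓘(ℝ, ℝ) ∞
      (fun q : ℝ × StabSV V => q.2.2.2) := contMDiff_snd.comp (contMDiff_snd.comp contMDiff_snd)
  have per : ∀ u t, liftFamily a hf (u, t + 1) = liftFamily a hf (u, t) := fun u t =>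
    liftFamily_congr a hf (hper u t)
  have h1 := (contMDiff_circleLift (hL.1.comp (ht.prodMk hw)) (fun t n => by
    simp only [Function.comp, per])).comp hr
  have h2 := (contMDiff_circleLift (hL.2.comp (ht.prodMk hw)) (fun t n => by
    simp only [Function.comp, per])).comp hr
  have h3 := (contMDiff_circleLift ((contMDiff_loopHam hf).comp (ht.prodMk hw)) (fun t n => by
    simp only [Function.comp, loopHam_periodic hper])).comp hr
  have h4 := (contMDiff_circleLift
    ((contMDiff_loopHam hf).comp (ht.prodMk (hL.1.comp (ht.prodMk hw)))) (fun t n => by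
      simp only [Function.comp, loopHam_periodic hper, per])).comp hr
  exact ⟨h1.prodMk (hθ.prodMk (hρ.sub h4)), h2.prodMk (hθ.prodMk (hρ.add h3))⟩

/-- Letting the loop time vary along with the point adds H dt to the pullback of s λ, where H is the
Hamiltonian of the loop at the image point. The shift of r by -H changes r dt by exactly the
opposite amount. -/
theorem suspension_preserves (hf : IsContactFamily lam f) (hper : ∀ u t, f (u, t + 1) = f (u, t))
    (u : ℝ) {γ : ℝ → StabSV V} (hγ : ContMDiffAt 𝓘(ℝ, ℝ) (modelStabSV E) ∞ γ 0) :
    (stabLiouville lam).ev (fun ε => suspension a hf u (γ ε)) 0 = (stabLiouville lam).ev γ 0 := by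
  have hL := liftFamily_isSmooth a hf
  have hγd : MDifferentiableAt 𝓘(ℝ, ℝ) (modelStabSV E) γ 0 := hγ.mdifferentiableAt (by simp)
  have hsγ : MDifferentiableAt 𝓘(ℝ, ℝ) (modelStabSV E) (fun ε => suspension a hf u (γ ε)) 0 :=
    (((suspension_isSmooth a hf hper).contMDiff u).mdifferentiable (by simp) _).comp (0 : ℝ) hγd
  rw [stabLiouville_ev hγd, stabLiouville_ev hsγ]
  set θ : ℝ → UnitAddCircle := fun ε => (γ ε).2.1 with hθ
  set w : ℝ → SV V := fun ε => (γ ε).1 with hw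
  have hwd : ContMDiffAt 𝓘(ℝ, ℝ) (modelSV E) ∞ w 0 :=
    ContMDiffAt.comp (0 : ℝ) (g := Prod.fst) contMDiffAt_fst hγ
  have hθd : ContMDiffAt 𝓘(ℝ, ℝ) 𝓘(ℝ, ℝ) ∞ θ 0 :=
    ContMDiffAt.comp (0 : ℝ) (g := Prod.fst) contMDiffAt_fst
      (ContMDiffAt.comp (0 : ℝ) (g := Prod.snd) contMDiffAt_snd hγ)
  set c := chartAt ℝ (θ 0) with hc
  have hcd : ContMDiffAt 𝓘(ℝ, ℝ) 𝓘(ℝ, ℝ) ∞ (fun ε => c (θ ε)) 0 := by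
    have h1 : ContMDiffAt 𝓘(ℝ, ℝ) 𝓘(ℝ, ℝ) ∞ c (θ 0) := by
      simpa using contMDiffAt_extChartAt (I := 𝓘(ℝ, ℝ)) (n := ∞) (x := θ 0)
    exact h1.comp (0 : ℝ) hθd
  have hvel : circleForm.ev θ 0 = deriv (fun ε => c (θ ε)) 0 := by
    refine (velocity_eq_deriv (hθd.mdifferentiableAt (by simp))).trans ?_
    congr 1
  have hev : (fun ε => (suspension a hf u (γ ε)).1) =ᶠ[nhds 0]
      fun ε => liftFamily a hf (u, c (θ ε)) (w ε) := by
    filter_upwards [hθd.continuousAt.preimage_mem_nhds (chart_source_mem_nhds ℝ (θ 0))] with ε hε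
    have h1 := periodic_circleLift (Q := fun t => liftFamily a hf (u, t))
      (fun t => liftFamily_congr a hf (hper u t)) (coe_chartAt_circle hε)
    change liftFamily a hf (u, circleLift (θ ε)) (w ε) = _
    rw [h1]
  have hG : ContMDiffAt 𝓘(ℝ, ℝ × ℝ) (modelSV E) ∞
      (fun q : ℝ × ℝ => liftFamily a hf (u, c (θ q.1)) (w q.2)) (0, 0) := by
    have e1 : ContMDiffAt 𝓘(ℝ, ℝ × ℝ) 𝓘(ℝ, ℝ) ∞ (Prod.fst : ℝ × ℝ → ℝ) (0, 0) :=
      contDiff_fst.contMDiff.contMDiffAt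
    have e2 : ContMDiffAt 𝓘(ℝ, ℝ × ℝ) 𝓘(ℝ, ℝ) ∞ (Prod.snd : ℝ × ℝ → ℝ) (0, 0) :=
      contDiff_snd.contMDiff.contMDiffAt
    have e3 : ContMDiffAt 𝓘(ℝ, ℝ × ℝ) 𝓘(ℝ, ℝ) ∞ (fun q : ℝ × ℝ => c (θ q.1)) (0, 0) :=
      ContMDiffAt.comp ((0 : ℝ), (0 : ℝ)) (g := fun ε => c (θ ε)) hcd e1
    have e4 : ContMDiffAt 𝓘(ℝ, ℝ × ℝ) (modelSV E) ∞ (fun q : ℝ × ℝ => w q.2) (0, 0) :=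
      ContMDiffAt.comp ((0 : ℝ), (0 : ℝ)) (g := w) hwd e2
    exact hL.1.contMDiffAt.comp ((0 : ℝ), (0 : ℝ))
      ((contMDiffAt_const.prodMk_space e3).prodMk e4)
  have htr : ∀ (z : SV V) (t : ℝ), MDifferentiableAt 𝓘(ℝ, ℝ) (modelSV E)
      (fun τ => liftFamily a hf (u, τ) z) t := by
    intro z t
    have h1 : ContMDiff 𝓘(ℝ, ℝ) 𝓘(ℝ, ℝ × ℝ) ∞ (fun τ : ℝ => (u, τ)) :=
      ContDiff.contMDiff (by fun_prop)
    exact (hL.1.comp (h1.prodMk contMDiff_const)).mdifferentiable (by simp) t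
  have hham : ∀ (z : SV V) (t : ℝ), (liouville lam).ev (fun τ => liftFamily a hf (u, τ) z) t =
      loopHam lam f u t (liftFamily a hf (u, t) z) := by
    intro z t
    rw [liouville_ev (htr z t)]
    change _ = _ * cham lam (fun τ => f (u, τ)) t ((f (u, t)).symm (f (u, t) z.1))
    rw [Equiv.symm_apply_apply]
    rfl
  have hL0 := periodic_circleLift (Q := fun t => liftFamily a hf (u, t))
    (fun t => liftFamily_congr a hf (hper u t)) (coe_chartAt_circle (mem_chart_source ℝ (θ 0)))
  have hH0 : ∀ z, loopHam lam f u (circleLift (θ 0)) z = loopHam lam f u (c (θ 0)) z := fun z =>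
    periodic_circleLift (Q := fun t => loopHam lam f u t z)
      (fun t => loopHam_periodic hper u t z) (coe_chartAt_circle (mem_chart_source ℝ (θ 0)))
  -- The motion splits into that of the loop time, which contributes H times the velocity on the
  -- circle, and that of the point at frozen time, which the lift leaves invariant.
  have hdiag := (liouville lam).ev_diag (hG.mdifferentiableAt (by simp))
  have hrep := (liouville lam).ev_reparam (σ := fun ε => c (θ ε)) (t := 0)
    (htr (w 0) (c (θ 0))) (hcd.mdifferentiableAt (by simp)).differentiableAt
  rw [(liouville lam).ev_congr hev, hdiag, hrep, hham]
  change _ + (liouville lam).ev (fun ε => liftFamily a hf (u, c (θ 0)) (w ε)) 0 + _ = _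
  rw [liouville_ev_liftFamily a hf _ (hwd.mdifferentiableAt (by simp)), ← hvel]
  change _ + ((γ 0).2.2 - loopHam lam f u (circleLift (θ 0))
    (liftFamily a hf (u, circleLift (θ 0)) (w 0))) * circleForm.ev θ 0 = _
  rw [hH0]
  have hL0' : liftFamily a hf (u, circleLift (θ 0)) = liftFamily a hf (u, c (θ 0)) := hL0
  rw [hL0']
  ring

/-- A loop of contactomorphisms that is contractible and positive over the compact set of a pair
displaces the pair stably. -/
theorem not_stableIntersectionProperty [FiniteDimensional ℝ E] (a : ReebCircleAction lam)
    (hf : IsContactFamily lam f)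
    (hper : ∀ u t, f (u, t + 1) = f (u, t)) (h0 : ∀ t, f (0, t) = 1) {A B : Set (SV V)}
    (hpos : ∀ t x, f (1, t) x ∈ Prod.fst '' B → 0 < cham lam (fun τ => f (1, τ)) t x) :
    ¬ StableIntersectionProperty lam A B := by
  rintro ⟨-, -, hAB⟩
  have hsm := suspension_isSmooth a hf hper
  have hone : suspension a hf 0 = 1 := by
    ext1 z
    have hL : liftFamily a hf (0, circleLift z.2.1) = 1 := liftFamily_of_eq_one a hf (h0 _)
    have hH : ∀ w, loopHam lam f 0 (circleLift z.2.1) w = 0 := by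
      intro w
      unfold loopHam
      simp only [h0]
      rw [cham_const, mul_zero]
    change (liftFamily a hf (0, circleLift z.2.1) z.1, (z.2.1, z.2.2 - loopHam lam f 0 _ _)) = z
    rw [hL, hH, sub_zero]
    rfl
  have hham := isHamiltonianIsotopy_of_preserves stabLiouville_isSmooth hsm hone
    (fun u γ hγ => suspension_preserves a hf hper u hγ)
  -- The isotopy in u fixes the circle coordinate, so r dt contributes nothing to the Hamiltonian.
  -- What remains is s times a function independent of s and r, hence homogeneous of degree one.
  have hcomp : ∀ u (z : StabSV V),
      (stabLiouville lam).ev (fun τ => suspension a hf τ ((suspension a hf u).symm z)) u =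
        (z.1.2 : ℝ) * cham lam (fun τ => f (τ, circleLift z.2.1)) u
          ((f (u, circleLift z.2.1)).symm z.1.1) := by
    intro u z
    rw [stabLiouville_ev (hsm.mdifferentiableAt_trajectory _ u)]
    have h1 : circleForm.ev
        (fun τ => (suspension a hf τ ((suspension a hf u).symm z)).2.1) u = 0 :=
      circleForm.ev_const z.2.1 u
    rw [h1, mul_zero, add_zero]
    set L := liftFamily a hf (u, circleLift z.2.1)
    have h2 : MDifferentiableAt 𝓘(ℝ, ℝ) (modelSV E)
        (fun τ => liftFamily a hf (τ, circleLift z.2.1) (L.symm z.1)) u := by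
      have h3 : ContMDiff 𝓘(ℝ, ℝ) 𝓘(ℝ, ℝ × ℝ) ∞ (fun τ : ℝ => (τ, circleLift z.2.1)) :=
        ContDiff.contMDiff (by fun_prop)
      exact ((liftFamily_isSmooth a hf).1.comp
        (h3.prodMk contMDiff_const)).mdifferentiable (by simp) u
    refine (liouville_ev h2).trans ?_
    have h4 : liftFamily a hf (u, circleLift z.2.1) (L.symm z.1) = z.1 := L.apply_symm_apply _
    rw [h4]
    rfl
  have hhom : ∀ u c z,
      (stabLiouville lam).ev
        (fun τ => suspension a hf τ ((suspension a hf u).symm (scaleStabSV c z))) u =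
      c.1 * (stabLiouville lam).ev (fun τ => suspension a hf τ ((suspension a hf u).symm z)) u := by
    intro u c z
    simp only [hcomp]
    change c.1 * (z.1.2 : ℝ) * _ = _
    rw [mul_assoc]
    rfl
  obtain ⟨_, ⟨z, hz, rfl⟩, hzB⟩ := hAB (suspension a hf 1) ⟨_, suspension a hf, hhom, hham, rfl⟩
  have h1 : (suspension a hf 1 z).2.2 = 0 := hzB.2
  have h2 : (suspension a hf 1 z).1 ∈ B := hzB.1
  have h3 : z.2.2 = 0 := hz.2
  set t := circleLift z.2.1
  set y := liftFamily a hf (1, t) z.1 with hy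
  -- A point of Stab(A) starts at r = 0. Landing in Stab(B) would force the Hamiltonian to vanish at
  -- a point y of B, where it is positive.
  have h4 : z.2.2 - loopHam lam f 1 t y = 0 := h1
  have h5 : (f (1, t)).symm y.1 = z.1.1 := (f (1, t)).symm_apply_apply z.1.1
  rw [h3, zero_sub, neg_eq_zero] at h4
  unfold loopHam at h4
  rw [h5] at h4
  have h6 := hpos t z.1.1 ⟨y, h2, rfl⟩
  have h7 : (0 : ℝ) < y.2 := mem_Ioi.1 y.2.2
  exact (mul_pos h7 h6).ne' h4

end Stabilization

/-! ### Contact vector fields in a chart with prescribed value at a point -/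

section LocalContactFields

variable {E : Type*} [NormedAddCommGroup E] [NormedSpace ℝ E]

/-- The exterior derivative of a 1-form on a normed space, as a bilinear map. -/
def extD (l : E → E →L[ℝ] ℝ) (y : E) : E →L[ℝ] E →L[ℝ] ℝ := fderiv ℝ l y - (fderiv ℝ l y).flip

theorem extD_apply (l : E → E →L[ℝ] ℝ) (y v w : E) :
    extD l y v w = fderiv ℝ l y v w - fderiv ℝ l y w v := rfl

theorem extD_antisymm (l : E → E →L[ℝ] ℝ) (y v w : E) : extD l y v w = -extD l y w v := by
  rw [extD_apply, extD_apply]; ring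

/-- The isomorphism `v ↦ ι_v dl + l(v) l` between vectors and covectors that is associated with a
contact form `l`. -/
def contactIso (l : E → E →L[ℝ] ℝ) (y : E) : E →L[ℝ] E →L[ℝ] ℝ :=
  extD l y + (l y).smulRight (l y)

theorem contactIso_apply (l : E → E →L[ℝ] ℝ) (y v w : E) :
    contactIso l y v w = extD l y v w + l y v * l y w := rfl

/-- If v is in the kernel, pairing with v itself kills the antisymmetric part and leaves l(v)² = 0;
nondegeneracy on ker l then gives v = 0. Equal finite dimensions do the rest. -/
theorem exists_equiv_contactIso [FiniteDimensional ℝ E] {l : E → E →L[ℝ] ℝ} {y : E}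
    (hnd : ∀ v, l y v = 0 → v ≠ 0 → ∃ w, l y w = 0 ∧ extD l y v w ≠ 0) :
    ∃ e : E ≃L[ℝ] (E →L[ℝ] ℝ), (e : E →L[ℝ] E →L[ℝ] ℝ) = contactIso l y := by
  have hinj : Function.Injective (contactIso l y) := by
    rw [injective_iff_map_eq_zero]
    intro v hv
    have h1 : ∀ w, extD l y v w + l y v * l y w = 0 := fun w => by
      rw [← contactIso_apply, hv]; rfl
    have h2 : l y v = 0 := by
      have h3 := h1 v
      rw [extD_apply, sub_self, zero_add] at h3
      exact mul_self_eq_zero.1 h3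
    by_contra hne
    obtain ⟨w, -, hw⟩ := hnd v h2 hne
    have h4 := h1 w
    rw [h2, zero_mul, add_zero] at h4
    exact hw h4
  have hfr : Module.finrank ℝ E = Module.finrank ℝ (E →L[ℝ] ℝ) := by
    rw [← Subspace.dual_finrank_eq (K := ℝ) (V := E)]
    exact (LinearMap.toContinuousLinearMap (𝕜 := ℝ) (E := E) (F' := ℝ)).finrank_eq
  refine ⟨(LinearMap.linearEquivOfInjective (contactIso l y : E →ₗ[ℝ] E →L[ℝ] ℝ) hinj
    hfr).toContinuousLinearEquiv, ?_⟩
  ext v w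
  rfl

/-- A linear family of compactly supported contact vector fields for the contact form `l` on `Ω`
that takes all values at `y₀`. -/
theorem exists_contactFields [FiniteDimensional ℝ E] {l : E → E →L[ℝ] ℝ} {Ω : Set E}
    (hΩ : IsOpen Ω) (hl : ContDiffOn ℝ ∞ l Ω)
    (hnd : ∀ y ∈ Ω, ∀ v, l y v = 0 → v ≠ 0 → ∃ w, l y w = 0 ∧ extD l y v w ≠ 0)
    (hR : ∀ y ∈ Ω, ∃ r, l y r = 1 ∧ ∀ w, extD l y r w = 0) {y₀ : E} (hy₀ : y₀ ∈ Ω) :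
    ∃ A : E → E →L[ℝ] E, ContDiff ℝ ∞ A ∧ HasCompactSupport A ∧ tsupport A ⊆ Ω ∧
      A y₀ = ContinuousLinearMap.id ℝ E ∧ ∃ ρ : E → E →L[ℝ] ℝ, ContinuousOn ρ Ω ∧
        ∀ y ∈ Ω, ∀ v w, extD l y (A y v) w + fderiv ℝ (fun y => l y (A y v)) y w =
          ρ y v * l y w := by
  have hlat : ∀ y ∈ Ω, ContDiffAt ℝ ∞ l y := fun y hy => hl.contDiffAt (hΩ.mem_nhds hy)
  have hdl : ∀ y ∈ Ω, ContDiffAt ℝ ∞ (fderiv ℝ l) y := fun y hy =>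
    (hlat y hy).fderiv_right (by simp)
  have hsmulR : ∀ {f g : E → E →L[ℝ] ℝ} {y : E}, ContDiffAt ℝ ∞ f y → ContDiffAt ℝ ∞ g y →
      ContDiffAt ℝ ∞ (fun y => (f y).smulRight (g y)) y := by
    intro f g y hf hg
    exact hf.smulRight hg
  have hflip : ∀ {f : E → E →L[ℝ] E →L[ℝ] ℝ} {y : E}, ContDiffAt ℝ ∞ f y →
      ContDiffAt ℝ ∞ (fun y => (f y).flip) y := by
    intro f y hf
    have h : ContDiff ℝ ∞ (fun T : E →L[ℝ] E →L[ℝ] ℝ => T.flip) :=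
      contDiff_clm_apply_iff.2 fun w => contDiff_clm_apply_iff.2 fun u =>
        (contDiff_id.clm_apply contDiff_const).clm_apply contDiff_const
    exact h.contDiffAt.comp y hf
  have hB : ∀ y ∈ Ω, ContDiffAt ℝ ∞ (contactIso l) y := fun y hy =>
    ((hdl y hy).sub (hflip (hdl y hy))).add (hsmulR (hlat y hy) (hlat y hy))
  set Bi : E → (E →L[ℝ] ℝ) →L[ℝ] E := fun y => (contactIso l y).inverse with hBi
  have hBis : ∀ y ∈ Ω, ContDiffAt ℝ ∞ Bi y := by
    intro y hy
    obtain ⟨e, he⟩ := exists_equiv_contactIso (hnd y hy)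
    have h1 := contDiffAt_map_inverse (n := ∞) e
    rw [he] at h1
    exact h1.comp y (hB y hy)
  have hBi1 : ∀ y ∈ Ω, ∀ v, Bi y (contactIso l y v) = v := by
    intro y hy v
    obtain ⟨e, he⟩ := exists_equiv_contactIso (hnd y hy)
    simp only [hBi, ← he, ContinuousLinearMap.inverse_equiv]
    exact e.symm_apply_apply v
  have hBi2 : ∀ y ∈ Ω, ∀ μ, contactIso l y (Bi y μ) = μ := by
    intro y hy μ
    obtain ⟨e, he⟩ := exists_equiv_contactIso (hnd y hy)
    simp only [hBi, ← he, ContinuousLinearMap.inverse_equiv]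
    exact e.apply_symm_apply μ
  -- The Reeb field: its image under `contactIso` is l. This presents it as a smooth function of y.
  set R : E → E := fun y => Bi y (l y) with hRdef
  have hR1 : ∀ y ∈ Ω, l y (R y) = 1 ∧ ∀ w, extD l y (R y) w = 0 := by
    intro y hy
    obtain ⟨r, hr1, hr2⟩ := hR y hy
    have h1 : contactIso l y r = l y := by
      ext w
      rw [contactIso_apply, hr1, hr2]; simp
    have h2 : R y = r := by rw [hRdef]; simp only; rw [← h1, hBi1 y hy]
    rw [h2]
    exact ⟨hr1, hr2⟩
  obtain ⟨ε, hε, hεΩ⟩ := Metric.nhds_basis_closedBall.mem_iff.1 (hΩ.mem_nhds hy₀)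
  let χ : ContDiffBump y₀ := ⟨ε / 2, ε, by positivity, by linarith⟩
  -- The contact Hamiltonian of the field for v, prescribed to first order: a contact field with
  -- value v at y₀ requires H(y₀) = l(v) and, with dH(R) = 0, dH = -dl(v, ·). The cut-off keeps the
  -- support inside Ω.
  set H : E → E →L[ℝ] ℝ := fun y => χ y • (l y₀ - (extD l y₀).flip (y - y₀)) with hH
  have hHs : ContDiff ℝ ∞ H := by
    have h1 : ContDiff ℝ ∞ (fun y => χ y) := χ.contDiff
    exact h1.smul (by fun_prop)
  have hdH : ContDiff ℝ ∞ (fderiv ℝ H) := hHs.fderiv_right (by simp)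
  -- The contact field X with Hamiltonian H satisfies ι_X dl = -dH + dH(R) l and l(X) = H, so
  -- `contactIso` sends it to this covector. By Cartan's formula the Lie derivative of l along X is
  -- dH(R) l, which explains the choice of ρ.
  set Q : E → E →L[ℝ] E →L[ℝ] ℝ := fun y =>
    -(fderiv ℝ H y).flip + (fderiv ℝ H y (R y)).smulRight (l y) + (H y).smulRight (l y) with hQ
  set A : E → E →L[ℝ] E := fun y => (Bi y).comp (Q y) with hA
  have hRs : ∀ y ∈ Ω, ContDiffAt ℝ ∞ R y := fun y hy => (hBis y hy).clm_apply (hlat y hy)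
  have hAs : ∀ y ∈ Ω, ContDiffAt ℝ ∞ A y := by
    intro y hy
    refine (hBis y hy).clm_comp ?_
    exact ((hflip hdH.contDiffAt).neg.add
      (hsmulR (hdH.contDiffAt.clm_apply (hRs y hy)) (hlat y hy))).add
      (hsmulR hHs.contDiffAt (hlat y hy))
  have hsupp : Function.support A ⊆ Metric.closedBall y₀ ε := by
    intro y hy
    by_contra hyn
    have h1 : H =ᶠ[nhds y] fun _ => 0 := by
      filter_upwards [Metric.isClosed_closedBall.isOpen_compl.mem_nhds hyn] with z hz
      have h2 : χ z = 0 := χ.zero_of_le_dist (by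
        have : ¬ dist z y₀ ≤ ε := hz
        exact (not_le.1 this).le)
      simp [hH, h2]
    have h3 : fderiv ℝ H y = 0 := by rw [h1.fderiv_eq]; simp
    have h4 : H y = 0 := h1.eq_of_nhds
    apply hy
    ext v
    simp [hA, hQ, h3, h4]
  have htsupp : tsupport A ⊆ Metric.closedBall y₀ ε :=
    closure_minimal hsupp Metric.isClosed_closedBall
  have hlA : ∀ y ∈ Ω, ∀ v, l y (A y v) = H y v ∧
      ∀ w, extD l y (A y v) w = -(fderiv ℝ H y w v) + fderiv ℝ H y (R y) v * l y w := by
    intro y hy v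
    have h1 : ∀ w, extD l y (A y v) w + l y (A y v) * l y w =
        -(fderiv ℝ H y w v) + fderiv ℝ H y (R y) v * l y w + H y v * l y w := by
      intro w
      rw [← contactIso_apply]
      change contactIso l y (Bi y (Q y v)) w = _
      rw [hBi2 y hy]
      rfl
    have h2 : l y (A y v) = H y v := by
      have h3 := h1 (R y)
      rw [extD_antisymm, (hR1 y hy).2, (hR1 y hy).1] at h3
      linarith
    refine ⟨h2, fun w => ?_⟩
    have h3 := h1 w
    rw [h2] at h3
    linarith
  refine ⟨A, ?_, ?_, htsupp.trans hεΩ, ?_, fun y => fderiv ℝ H y (R y), ?_, ?_⟩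
  · rw [contDiff_iff_contDiffAt]
    intro y
    by_cases hy : y ∈ Ω
    · exact hAs y hy
    · have h1 : A =ᶠ[nhds y] fun _ => 0 := by
        filter_upwards [Metric.isClosed_closedBall.isOpen_compl.mem_nhds
          (fun h => hy (hεΩ h))] with z hz
        by_contra hne
        exact hz (hsupp hne)
      exact contDiffAt_const.congr_of_eventuallyEq h1
  · exact HasCompactSupport.of_support_subset_isCompact (isCompact_closedBall y₀ ε) hsupp
  · have h1 : H =ᶠ[nhds y₀] fun y => l y₀ - (extD l y₀).flip (y - y₀) := by
      filter_upwards [χ.eventuallyEq_one] with z hz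
      simp [hH, hz]
    have h2 : HasFDerivAt (fun y => l y₀ - (extD l y₀).flip (y - y₀))
        (-(extD l y₀).flip) y₀ :=
      (((extD l y₀).flip.hasFDerivAt.comp y₀ ((hasFDerivAt_id y₀).sub_const y₀))).const_sub (l y₀)
    have h3 : fderiv ℝ H y₀ = -(extD l y₀).flip := by rw [h1.fderiv_eq, h2.fderiv]
    have h4 : H y₀ = l y₀ := by rw [h1.eq_of_nhds]; simp
    ext v
    have h5 : Q y₀ v = contactIso l y₀ v := by
      ext w
      have h6 : (fderiv ℝ H y₀ (R y₀)) v = 0 := by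
        rw [h3]
        change -(extD l y₀ v (R y₀)) = 0
        rw [extD_antisymm, (hR1 y₀ hy₀).2]; simp
      change -(fderiv ℝ H y₀ w v) + (fderiv ℝ H y₀ (R y₀)) v * l y₀ w + H y₀ v * l y₀ w = _
      rw [h6, h3, h4, contactIso_apply]
      simp
    change Bi y₀ (Q y₀ v) = v
    rw [h5, hBi1 y₀ hy₀]
  · exact fun y hy => ((hdH.continuous.continuousAt).clm_apply
      (hRs y hy).continuousAt).continuousWithinAt
  · intro y hy v w
    have h1 : (fun y => l y (A y v)) =ᶠ[nhds y] fun y => H y v := by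
      filter_upwards [hΩ.mem_nhds hy] with z hz
      exact (hlA z hz v).1
    have h2 : HasFDerivAt (fun y => H y v) ((fderiv ℝ H y).flip v) y := by
      have := (hHs.differentiable (by simp) y).hasFDerivAt.clm_apply (hasFDerivAt_const v y)
      refine this.congr_fderiv ?_
      ext w
      simp
    rw [h1.fderiv_eq, h2.fderiv, (hlA y hy v).2]
    simp

end LocalContactFields

/-! ### Flows of contact fields scale the contact form -/

section ContactFlow

variable {E : Type*} [NormedAddCommGroup E] [NormedSpace ℝ E]

/-- A solution of a linear equation `z' = r z` is multiplied by a factor that depends only on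
`r`. -/
theorem exists_factor_of_linear_ode {r : ℝ → ℝ} (hr : ContinuousOn r (Icc 0 1)) :
    ∃ g > 0, ∀ z : ℝ → ℝ, (∀ t ∈ Icc (0 : ℝ) 1, HasDerivAt z (r t * z t) t) → z 1 = g * z 0 := by
  set r' : ℝ → ℝ := IccExtend zero_le_one ((Icc (0 : ℝ) 1).domRestrict r)
  have hr' : Continuous r' := (continuousOn_iff_continuous_domRestrict.1 hr).Icc_extend'
  have hrr : ∀ t ∈ Icc (0 : ℝ) 1, r' t = r t := fun t ht => IccExtend_of_mem _ _ ht
  set S : ℝ → ℝ := fun t => ∫ s in (0 : ℝ)..t, r' s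
  have hS : ∀ t, HasDerivAt S (r' t) t := fun t =>
    intervalIntegral.integral_hasDerivAt_right (hr'.intervalIntegrable _ _)
      hr'.stronglyMeasurable.stronglyMeasurableAtFilter hr'.continuousAt
  refine ⟨Real.exp (S 1), Real.exp_pos _, fun z hz => ?_⟩
  have hq : ∀ t ∈ Icc (0 : ℝ) 1, HasDerivAt (fun t => Real.exp (-S t) * z t) 0 t := by
    intro t ht
    have h1 := ((hS t).neg.exp).mul (hz t ht)
    refine h1.congr_deriv ?_
    rw [hrr t ht]
    simp only [Pi.neg_apply]
    ring
  have h1 := constant_of_has_deriv_right_zero (f := fun t => Real.exp (-S t) * z t) (a := 0)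
    (b := 1) (fun t ht => (hq t ht).continuousAt.continuousWithinAt)
    (fun t ht => (hq t (Ico_subset_Icc_self ht)).hasDerivWithinAt) 1 (by simp)
  have h2 : S 0 = 0 := intervalIntegral.integral_same
  simp only [h2, neg_zero, Real.exp_zero, one_mul] at h1
  rw [← h1, ← mul_assoc, ← Real.exp_add]
  simp

/-- The flow of the fields of `exists_contactFields` scales the contact form. -/
theorem flow_scales [CompleteSpace E] {l : E → E →L[ℝ] ℝ} {Ω : Set E}
    (hΩ : IsOpen Ω) (hl : ContDiffOn ℝ ∞ l Ω) {A : E → E →L[ℝ] E} (hA : ContDiff ℝ ∞ A)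
    {ρ : E → E →L[ℝ] ℝ} (hρ : ContinuousOn ρ Ω)
    (hAρ : ∀ y ∈ Ω, ∀ v w, extD l y (A y v) w + fderiv ℝ (fun y => l y (A y v)) y w =
      ρ y v * l y w) {δ : ℝ} {φ : E × E → E}
    (hφ : ContDiffOn ℝ ∞ φ (Metric.ball 0 δ ×ˢ univ)) (hφ0 : ∀ x, φ (0, x) = x)
    (hode : ∀ v ∈ Metric.ball (0 : E) δ, ∀ x, ∀ t ∈ Icc (0 : ℝ) 1,
        HasDerivWithinAt (fun τ : ℝ => φ (τ • v, x)) (A (φ (t • v, x)) v) (Icc 0 1) t)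
    (hmem : ∀ v ∈ Metric.ball (0 : E) δ, ∀ y ∈ Ω, φ (v, y) ∈ Ω)
    {v : E} (hv : v ∈ Metric.ball (0 : E) δ) {y : E} (hy : y ∈ Ω) :
    ∃ g > 0, ∀ w, l (φ (v, y)) (fderiv ℝ (fun x => φ (v, x)) y w) = g * l y w := by
  have hsmul : ∀ t ∈ Icc (0 : ℝ) 1, t • v ∈ Metric.ball (0 : E) δ := by
    intro t ht
    rw [mem_ball_zero_iff] at hv ⊢
    rw [norm_smul, Real.norm_of_nonneg ht.1]
    exact (mul_le_of_le_one_left (norm_nonneg _) ht.2).trans_lt hv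
  have hφat : ∀ q : E × E, q.1 ∈ Metric.ball (0 : E) δ → ContDiffAt ℝ ∞ φ q := fun q hq =>
    hφ.contDiffAt ((Metric.isOpen_ball.prod isOpen_univ).mem_nhds ⟨hq, mem_univ _⟩)
  have hrc : ContinuousOn (fun t : ℝ => ρ (φ (t • v, y)) v) (Icc 0 1) := by
    have h1 : ContinuousOn (fun t : ℝ => φ (t • v, y)) (Icc 0 1) := by
      intro t ht
      have h2 : ContinuousAt (fun t : ℝ => (t • v, y)) t := by fun_prop
      exact (ContinuousAt.comp (f := fun t : ℝ => (t • v, y)) (g := φ)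
        (hφat (t • v, y) (hsmul t ht)).continuousAt h2).continuousWithinAt
    exact (hρ.comp h1 fun t ht => hmem _ (hsmul t ht) y hy).clm_apply continuousOn_const
  obtain ⟨g, hg, hg'⟩ := exists_factor_of_linear_ode hrc
  refine ⟨g, hg, fun w => ?_⟩
  let G : ℝ × ℝ → E := fun q => φ (q.1 • v, y + q.2 • w)
  have hG : ∀ t ∈ Icc (0 : ℝ) 1, ∀ ε, ContDiffAt ℝ ∞ G (t, ε) := by
    intro t ht ε
    have h1 : ContDiffAt ℝ ∞ (fun q : ℝ × ℝ => (q.1 • v, y + q.2 • w)) (t, ε) := by fun_prop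
    exact ContDiffAt.comp (t, ε) (g := φ) (f := fun q : ℝ × ℝ => (q.1 • v, y + q.2 • w))
      (hφat _ (hsmul t ht)) h1
  have hG1 : ∀ t ∈ Icc (0 : ℝ) 1, ∀ ε, fderiv ℝ G (t, ε) (1, 0) = A (G (t, ε)) v := by
    intro t ht ε
    have h1 : HasDerivAt (fun τ : ℝ => (τ, ε)) ((1 : ℝ), (0 : ℝ)) t :=
      (hasDerivAt_id _).prodMk (hasDerivAt_const _ _)
    have h2 := ((hG t ht ε).differentiableAt (by simp)).hasFDerivAt.comp_hasDerivAt
      (f := fun τ : ℝ => (τ, ε)) t h1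
    exact ((uniqueDiffOn_Icc zero_lt_one) t ht).eq_deriv _ h2.hasDerivWithinAt
      (hode v hv (y + ε • w) t ht)
  -- The transported vector w; it solves the linearized equation along the trajectory, since the
  -- mixed derivatives of G commute.
  let W : ℝ → E := fun t => fderiv ℝ G (t, 0) (0, 1)
  have hW : ∀ t ∈ Icc (0 : ℝ) 1,
      HasDerivAt W (fderiv ℝ (fun x => A x v) (G (t, 0)) (W t)) t := by
    intro t ht
    have hd : HasFDerivAt (fderiv ℝ G) (fderiv ℝ (fderiv ℝ G) (t, 0)) (t, 0) :=
      (((hG t ht 0).fderiv_right (m := 1) (by norm_cast)).differentiableAt (by simp)).hasFDerivAt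
    have h1 : HasDerivAt (fun τ : ℝ => (τ, (0 : ℝ))) ((1 : ℝ), (0 : ℝ)) t :=
      (hasDerivAt_id _).prodMk (hasDerivAt_const _ _)
    have h2 : HasDerivAt (fun ε : ℝ => (t, ε)) ((0 : ℝ), (1 : ℝ)) 0 :=
      (hasDerivAt_const _ _).prodMk (hasDerivAt_id _)
    have h3 : HasDerivAt W (fderiv ℝ (fderiv ℝ G) (t, 0) (1, 0) (0, 1)) t := by
      have := (hd.comp_hasDerivAt (f := fun τ : ℝ => (τ, (0 : ℝ))) t h1).clm_apply
        (hasDerivAt_const t ((0 : ℝ), (1 : ℝ)))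
      simpa using this
    have h4 : HasDerivAt (fun ε => fderiv ℝ G (t, ε) (1, 0))
        (fderiv ℝ (fderiv ℝ G) (t, 0) (0, 1) (1, 0)) 0 := by
      have := (hd.comp_hasDerivAt (f := fun ε : ℝ => (t, ε)) 0 h2).clm_apply
        (hasDerivAt_const (0 : ℝ) ((1 : ℝ), (0 : ℝ)))
      simpa using this
    have h5 : HasDerivAt (fun ε => G (t, ε)) (W t) 0 :=
      ((hG t ht 0).differentiableAt (by simp)).hasFDerivAt.comp_hasDerivAt
        (f := fun ε : ℝ => (t, ε)) 0 h2
    have hX : HasFDerivAt (fun x => A x v) (fderiv ℝ (fun x => A x v) (G (t, 0))) (G (t, 0)) :=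
      ((hA.clm_apply contDiff_const).differentiable (by simp) _).hasFDerivAt
    have h6 := hX.comp_hasDerivAt (f := fun ε => G (t, ε)) 0 h5
    have h7 : (fun ε => fderiv ℝ G (t, ε) (1, 0)) = (fun x => A x v) ∘ fun ε => G (t, ε) :=
      funext fun ε => hG1 t ht ε
    rw [h7] at h4
    have hsymm : fderiv ℝ (fderiv ℝ G) (t, 0) (1, 0) (0, 1) =
        fderiv ℝ (fderiv ℝ G) (t, 0) (0, 1) (1, 0) :=
      ((hG t ht 0).isSymmSndFDerivAt (by simp; norm_cast)).eq _ _
    rw [hsymm, h4.unique h6] at h3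
    exact h3
  -- The derivative of l(W) is the Lie derivative of l evaluated on W, that is ρ l(W). The
  -- coefficient depends on the trajectory but not on w, so one factor g serves all w.
  have hz : ∀ t ∈ Icc (0 : ℝ) 1, HasDerivAt (fun t => l (G (t, 0)) (W t))
      (ρ (φ (t • v, y)) v * l (G (t, 0)) (W t)) t := by
    intro t ht
    have hGΩ : G (t, 0) ∈ Ω := by
      have := hmem _ (hsmul t ht) y hy
      simpa [G] using this
    have hld : DifferentiableAt ℝ l (G (t, 0)) :=
      (hl.contDiffAt (hΩ.mem_nhds hGΩ)).differentiableAt (by simp)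
    have h1 : HasDerivAt (fun τ : ℝ => (τ, (0 : ℝ))) ((1 : ℝ), (0 : ℝ)) t :=
      (hasDerivAt_id _).prodMk (hasDerivAt_const _ _)
    have h2 : HasDerivAt (fun τ => G (τ, 0)) (A (G (t, 0)) v) t := by
      rw [← hG1 t ht 0]
      exact ((hG t ht 0).differentiableAt (by simp)).hasFDerivAt.comp_hasDerivAt
        (f := fun τ : ℝ => (τ, (0 : ℝ))) t h1
    have h3 := (hld.hasFDerivAt.comp_hasDerivAt (f := fun τ => G (τ, 0)) t h2).clm_apply (hW t ht)
    refine h3.congr_deriv ?_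
    have hX : DifferentiableAt ℝ (fun x => A x v) (G (t, 0)) :=
      (hA.clm_apply contDiff_const).differentiable (by simp) _
    have h4 := hAρ _ hGΩ v (W t)
    rw [(hld.hasFDerivAt.clm_apply hX.hasFDerivAt).fderiv, extD_apply] at h4
    have h5 : φ (t • v, y) = G (t, 0) := by simp [G]
    rw [h5, ← h4]
    simp only [Function.comp, add_apply, ContinuousLinearMap.comp_apply,
      ContinuousLinearMap.flip_apply]
    ring
  have hfin := hg' _ hz
  have hWt : ∀ t ∈ Icc (0 : ℝ) 1, W t = fderiv ℝ (fun x => φ (t • v, x)) y w := by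
    intro t ht
    have h2 : HasDerivAt (fun ε : ℝ => (t, ε)) ((0 : ℝ), (1 : ℝ)) 0 :=
      (hasDerivAt_const _ _).prodMk (hasDerivAt_id _)
    have h5 : HasDerivAt (fun ε => G (t, ε)) (W t) 0 :=
      ((hG t ht 0).differentiableAt (by simp)).hasFDerivAt.comp_hasDerivAt
        (f := fun ε : ℝ => (t, ε)) 0 h2
    have h6 : DifferentiableAt ℝ (fun x => φ (t • v, x)) y := by
      have h7 : DifferentiableAt ℝ (fun x : E => (t • v, x)) y := by fun_prop
      exact DifferentiableAt.comp y (f := fun x : E => (t • v, x)) (g := φ)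
        ((hφat _ (hsmul t ht)).differentiableAt (by simp)) h7
    have h8 : HasDerivAt (fun ε : ℝ => y + ε • w) w 0 := by
      simpa using ((hasDerivAt_id (0 : ℝ)).smul_const w).const_add y
    have h9 : HasFDerivAt (fun x => φ (t • v, x)) (fderiv ℝ (fun x => φ (t • v, x)) y)
        (y + (0 : ℝ) • w) := by simpa using h6.hasFDerivAt
    exact h5.unique (h9.comp_hasDerivAt (f := fun ε : ℝ => y + ε • w) 0 h8)
  rw [hWt 1 (by simp), hWt 0 (by simp)] at hfin
  simpa [G, hφ0] using hfin

end ContactFlow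

/-! ### Extending chart diffeomorphisms by the identity -/

section Transport

variable {E : Type*} [NormedAddCommGroup E] [NormedSpace ℝ E]
  {V : Type*} [TopologicalSpace V] [ChartedSpace E V]

open scoped Classical in
/-- The bijection of a manifold that is `ψ` in the chart around `x₀` and the identity outside. -/
def chartPerm (x₀ : V) (ψ : Equiv.Perm E)
    (hψ : ∀ y, y ∈ (chartAt E x₀).target ↔ ψ y ∈ (chartAt E x₀).target) : Equiv.Perm V where
  toFun x := if x ∈ (chartAt E x₀).source then (chartAt E x₀).symm (ψ (chartAt E x₀ x)) else x
  invFun x :=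
    if x ∈ (chartAt E x₀).source then (chartAt E x₀).symm (ψ.symm (chartAt E x₀ x)) else x
  left_inv x := by
    by_cases hx : x ∈ (chartAt E x₀).source
    · have h1 := (hψ _).1 ((chartAt E x₀).map_source hx)
      have h2 := (chartAt E x₀).map_target h1
      simp [hx, h1, h2, (chartAt E x₀).left_inv hx]
    · simp [hx]
  right_inv x := by
    by_cases hx : x ∈ (chartAt E x₀).source
    · have h1 : ψ.symm (chartAt E x₀ x) ∈ (chartAt E x₀).target := by
        rw [hψ, Equiv.apply_symm_apply]; exact (chartAt E x₀).map_source hx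
      have h2 := (chartAt E x₀).map_target h1
      simp [hx, h1, h2, (chartAt E x₀).left_inv hx]
    · simp [hx]

variable {x₀ : V} {ψ : Equiv.Perm E}
  {hψ : ∀ y, y ∈ (chartAt E x₀).target ↔ ψ y ∈ (chartAt E x₀).target}

theorem chartPerm_of_mem {x : V} (hx : x ∈ (chartAt E x₀).source) :
    chartPerm x₀ ψ hψ x = (chartAt E x₀).symm (ψ (chartAt E x₀ x)) := if_pos hx

theorem chartPerm_of_notMem {x : V} (hx : x ∉ (chartAt E x₀).source) :
    chartPerm x₀ ψ hψ x = x := if_neg hx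

theorem chartPerm_symm (hψ' : ∀ y, y ∈ (chartAt E x₀).target ↔ ψ.symm y ∈ (chartAt E x₀).target) :
    (chartPerm x₀ ψ hψ).symm = chartPerm x₀ ψ.symm hψ' := rfl

/-- The image of K in V is compact, hence closed as V is Hausdorff, so a point outside the chart
domain has a neighbourhood that misses it. This makes the extension by the identity smooth. -/
theorem chartPerm_eventuallyEq_id [T2Space V] {K : Set E} (hK : IsCompact K)
    (hKt : K ⊆ (chartAt E x₀).target) (hsupp : ∀ y ∉ K, ψ y = y) {x : V}
    (hx : x ∉ (chartAt E x₀).source) : chartPerm x₀ ψ hψ =ᶠ[nhds x] id := by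
  have hc : IsClosed ((chartAt E x₀).symm '' K) :=
    (hK.image_of_continuousOn ((chartAt E x₀).continuousOn_symm.mono hKt)).isClosed
  have hxK : x ∉ (chartAt E x₀).symm '' K := by
    rintro ⟨y, hy, rfl⟩
    exact hx ((chartAt E x₀).map_target (hKt hy))
  filter_upwards [hc.isOpen_compl.mem_nhds hxK] with z hz
  by_cases hzs : z ∈ (chartAt E x₀).source
  · rw [chartPerm_of_mem hzs, hsupp, (chartAt E x₀).left_inv hzs]
    · rfl
    · exact fun h => hz ⟨_, h, (chartAt E x₀).left_inv hzs⟩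
  · exact chartPerm_of_notMem hzs

theorem contMDiff_chartPerm [T2Space V] [IsManifold 𝓘(ℝ, E) ∞ V] {K : Set E} (hK : IsCompact K)
    (hKt : K ⊆ (chartAt E x₀).target) (hsupp : ∀ y ∉ K, ψ y = y) (hs : ContDiff ℝ ∞ ψ) :
    ContMDiff 𝓘(ℝ, E) 𝓘(ℝ, E) ∞ (chartPerm x₀ ψ hψ) := by
  intro x
  by_cases hx : x ∈ (chartAt E x₀).source
  · have h1 : ContMDiffAt 𝓘(ℝ, E) 𝓘(ℝ, E) ∞ (chartAt E x₀) x :=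
      contMDiffOn_chart.contMDiffAt ((chartAt E x₀).open_source.mem_nhds hx)
    have h2 : ContMDiffAt 𝓘(ℝ, E) 𝓘(ℝ, E) ∞ (chartAt E x₀).symm (ψ (chartAt E x₀ x)) :=
      contMDiffOn_chart_symm.contMDiffAt ((chartAt E x₀).open_target.mem_nhds
        ((hψ _).1 ((chartAt E x₀).map_source hx)))
    have h3 := h2.comp x (hs.contMDiff.contMDiffAt.comp x h1)
    refine h3.congr_of_eventuallyEq ?_
    filter_upwards [(chartAt E x₀).open_source.mem_nhds hx] with z hz
    exact chartPerm_of_mem hz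
  · exact contMDiffAt_id.congr_of_eventuallyEq (chartPerm_eventuallyEq_id hK hKt hsupp hx)

/-- Every tangent vector is the velocity of a curve, and for curves inside the chart domain the
claim becomes `hscale`. -/
theorem preservesContact_chartPerm [T2Space V] [IsManifold 𝓘(ℝ, E) ∞ V] {lam : ContactForm E V}
    {K : Set E} (hK : IsCompact K)
    (hKt : K ⊆ (chartAt E x₀).target) (hsupp : ∀ y ∉ K, ψ y = y) (hs : ContDiff ℝ ∞ ψ)
    (hscale : ∀ y ∈ (chartAt E x₀).target, ∃ g > 0, ∀ w,
      lam.form.inChart x₀ (ψ y) (fderiv ℝ ψ y w) = g * lam.form.inChart x₀ y w) :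
    PreservesContact lam (chartPerm x₀ ψ hψ) := by
  have : IsManifold 𝓘(ℝ, E) 1 V := IsManifold.of_le (n := ∞) (by simp)
  have hf := contMDiff_chartPerm (hψ := hψ) hK hKt hsupp hs
  have main : ∀ x, ∃ g : ℝ, 0 < g ∧ ∀ v : TangentSpace 𝓘(ℝ, E) x,
      lam.form (chartPerm x₀ ψ hψ x) (mfderiv 𝓘(ℝ, E) 𝓘(ℝ, E) (chartPerm x₀ ψ hψ) x v) =
        g * lam.form x v := by
    intro x
    have hcurve : ∀ γ : ℝ → V, ContMDiffAt 𝓘(ℝ, ℝ) 𝓘(ℝ, E) ∞ γ 0 → γ 0 = x →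
        ∀ g : ℝ, lam.form.ev (fun ε => chartPerm x₀ ψ hψ (γ ε)) 0 = g * lam.form.ev γ 0 →
        lam.form (chartPerm x₀ ψ hψ x) (mfderiv 𝓘(ℝ, E) 𝓘(ℝ, E) (chartPerm x₀ ψ hψ) x
          (show E from velocity 𝓘(ℝ, E) γ 0)) = g * lam.form x (show E from velocity 𝓘(ℝ, E) γ 0) := by
      rintro γ hγ rfl g hg
      have h1 := velocity_comp (hf.mdifferentiable (by simp) (γ 0))
        (hγ.mdifferentiableAt (by simp))
      refine Eq.trans ?_ hg
      exact (congrArg (fun w : E => (show E →L[ℝ] ℝ from lam.form (chartPerm x₀ ψ hψ (γ 0))) w)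
        h1).symm
    by_cases hx : x ∈ (chartAt E x₀).source
    · obtain ⟨g, hg, hg'⟩ := hscale _ ((chartAt E x₀).map_source hx)
      refine ⟨g, hg, fun v => ?_⟩
      obtain ⟨γ, hγ, hγ0, rfl⟩ := exists_curve (I := 𝓘(ℝ, E)) x v
      refine hcurve γ hγ hγ0 g ?_
      have hγd := hγ.mdifferentiableAt (n := ∞) (by simp)
      have hγs : γ 0 ∈ (chartAt E x₀).source := by rw [hγ0]; exact hx
      have hev : extChartAt 𝓘(ℝ, E) x₀ ∘ (fun ε => chartPerm x₀ ψ hψ (γ ε)) =ᶠ[nhds 0]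
          fun ε => ψ ((extChartAt 𝓘(ℝ, E) x₀ ∘ γ) ε) := by
        filter_upwards [hγ.continuousAt.preimage_mem_nhds
          ((chartAt E x₀).open_source.mem_nhds hγs)] with ε hε
        simp only [Function.comp, chartPerm_of_mem (show γ ε ∈ _ from hε), mfld_simps]
        exact (chartAt E x₀).right_inv ((hψ _).1 ((chartAt E x₀).map_source hε))
      have himg : chartPerm x₀ ψ hψ (γ 0) ∈ (extChartAt 𝓘(ℝ, E) x₀).source := by
        rw [extChartAt_source, chartPerm_of_mem hγs]
        exact (chartAt E x₀).map_target ((hψ _).1 ((chartAt E x₀).map_source hγs))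
      have hcd : DifferentiableAt ℝ (extChartAt 𝓘(ℝ, E) x₀ ∘ γ) 0 := by
        have h1 : MDifferentiableAt 𝓘(ℝ, E) 𝓘(ℝ, E) (extChartAt 𝓘(ℝ, E) x₀) (γ 0) :=
          mdifferentiableAt_extChartAt hγs
        exact (h1.comp (0 : ℝ) hγd).differentiableAt
      have hder : deriv (extChartAt 𝓘(ℝ, E) x₀ ∘ (fun ε => chartPerm x₀ ψ hψ (γ ε))) 0 =
          fderiv ℝ ψ (extChartAt 𝓘(ℝ, E) x₀ (γ 0)) (deriv (extChartAt 𝓘(ℝ, E) x₀ ∘ γ) 0) := by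
        rw [hev.deriv_eq]
        exact (((hs.differentiable (by simp) _).hasFDerivAt).comp_hasDerivAt (0 : ℝ)
          hcd.hasDerivAt).deriv
      have hpt : extChartAt 𝓘(ℝ, E) x₀ (chartPerm x₀ ψ hψ (γ 0)) =
          ψ (extChartAt 𝓘(ℝ, E) x₀ (γ 0)) := hev.eq_of_nhds
      rw [lam.form.ev_eq_inChart x₀ hγd (by rwa [extChartAt_source]),
        lam.form.ev_eq_inChart x₀ (γ := fun ε => chartPerm x₀ ψ hψ (γ ε))
          ((hf.mdifferentiable (by simp) _).comp (0 : ℝ) hγd) himg, hder, hpt]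
      have h2 : extChartAt 𝓘(ℝ, E) x₀ (γ 0) = chartAt E x₀ x := by rw [hγ0]; simp
      rw [h2]
      exact hg' _
    · refine ⟨1, one_pos, fun v => ?_⟩
      obtain ⟨γ, hγ, hγ0, rfl⟩ := exists_curve (I := 𝓘(ℝ, E)) x v
      refine hcurve γ hγ hγ0 1 ?_
      rw [one_mul]
      have h1 := chartPerm_eventuallyEq_id (hψ := hψ) hK hKt hsupp hx
      rw [← hγ0] at h1
      exact lam.form.ev_congr (hγ.continuousAt.eventually h1)
  choose g hg using main
  exact ⟨g, hg⟩

end Transport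

/-! ### Transitivity of the contactomorphism group -/

section Transitivity

variable {E : Type*} [NormedAddCommGroup E] [NormedSpace ℝ E] [FiniteDimensional ℝ E]
  {V : Type*} [TopologicalSpace V] [ChartedSpace E V] [IsManifold 𝓘(ℝ, E) ∞ V]
  {lam : ContactForm E V}

theorem hasDerivAt_lineApply {l : E → E →L[ℝ] ℝ} {y : E} (hl : DifferentiableAt ℝ l y)
    (u u' : E) : HasDerivAt (fun ε : ℝ => l (y + ε • u) u') (fderiv ℝ l y u u') 0 := by
  have hline : HasDerivAt (fun ε : ℝ => y + ε • u) u 0 := by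
    simpa using ((hasDerivAt_id (0 : ℝ)).smul_const u).const_add y
  have h1 : HasFDerivAt l (fderiv ℝ l y) (y + (0 : ℝ) • u) := by
    rw [zero_smul, add_zero]; exact hl.hasFDerivAt
  exact (ContinuousLinearMap.apply ℝ ℝ u').hasFDerivAt.comp_hasDerivAt (0 : ℝ)
    (h1.comp_hasDerivAt (0 : ℝ) hline)

theorem velocity_chartLine [IsManifold 𝓘(ℝ, E) 1 V] (x₀ : V) {z : E}
    (hz : z ∈ (extChartAt 𝓘(ℝ, E) x₀).target) (u : E) :
    (show E from velocity 𝓘(ℝ, E) (fun ε : ℝ => (extChartAt 𝓘(ℝ, E) x₀).symm (z + ε • u)) 0) =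
      (show E from mfderiv 𝓘(ℝ, E) 𝓘(ℝ, E) (extChartAt 𝓘(ℝ, E) x₀).symm z u) := by
  set c := extChartAt 𝓘(ℝ, E) x₀ with hc
  have ho : IsOpen c.target := isOpen_extChartAt_target x₀
  have h0 : MDifferentiableAt 𝓘(ℝ, E) 𝓘(ℝ, E) c.symm z :=
    ((contMDiffOn_extChartAt_symm (n := 1) x₀).contMDiffAt (ho.mem_nhds hz)).mdifferentiableAt
      (by simp)
  have h1 : HasDerivAt (fun ε : ℝ => z + ε • u) u 0 := by
    simpa using ((hasDerivAt_id (0 : ℝ)).smul_const u).const_add z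
  have hz0 : z + (0 : ℝ) • u = z := by rw [zero_smul, add_zero]
  have h2 : HasMFDerivAt 𝓘(ℝ, E) 𝓘(ℝ, E) c.symm ((fun ε : ℝ => z + ε • u) 0)
      (show E →L[ℝ] E from mfderiv 𝓘(ℝ, E) 𝓘(ℝ, E) c.symm z) := by
    have h3 : ∀ p, p = z → HasMFDerivAt 𝓘(ℝ, E) 𝓘(ℝ, E) c.symm p
      (show E →L[ℝ] E from mfderiv 𝓘(ℝ, E) 𝓘(ℝ, E) c.symm z) := by
      rintro p rfl; exact h0.hasMFDerivAt
    exact h3 _ hz0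
  have h4 := (h2.comp (0 : ℝ) h1.hasFDerivAt.hasMFDerivAt).mfderiv
  refine (congrArg (fun A : ℝ →L[ℝ] E => A 1) h4).trans ?_
  change (show E →L[ℝ] E from mfderiv 𝓘(ℝ, E) 𝓘(ℝ, E) c.symm z) ((1 : ℝ) • u) = _
  rw [one_smul]
  rfl

theorem OneForm.ev_chartLine [IsManifold 𝓘(ℝ, E) 1 V] (α : OneForm 𝓘(ℝ, E) V) (x₀ : V) {z : E}
    (hz : z ∈ (extChartAt 𝓘(ℝ, E) x₀).target) (u : E) :
    α.ev (fun ε : ℝ => (extChartAt 𝓘(ℝ, E) x₀).symm (z + ε • u)) 0 = α.inChart x₀ z u := by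
  have hz0 : z + (0 : ℝ) • u = z := by rw [zero_smul, add_zero]
  change (show E →L[ℝ] ℝ from α ((extChartAt 𝓘(ℝ, E) x₀).symm (z + (0 : ℝ) • u)))
    (show E from velocity 𝓘(ℝ, E) (fun ε : ℝ => (extChartAt 𝓘(ℝ, E) x₀).symm (z + ε • u)) 0) = _
  rw [velocity_chartLine x₀ hz u]
  exact α.congr_point (congrArg _ hz0) _

/-- The exterior derivative of a form in an arbitrary chart. -/
theorem d_eq_extD_inChart (x₀ : V) {y : E} (hy : y ∈ (extChartAt 𝓘(ℝ, E) x₀).target) (v w : E) :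
    lam.form.d ((extChartAt 𝓘(ℝ, E) x₀).symm y)
      (mfderiv 𝓘(ℝ, E) 𝓘(ℝ, E) (extChartAt 𝓘(ℝ, E) x₀).symm y v)
      (mfderiv 𝓘(ℝ, E) 𝓘(ℝ, E) (extChartAt 𝓘(ℝ, E) x₀).symm y w) =
      extD (lam.form.inChart x₀) y v w := by
  have : IsManifold 𝓘(ℝ, E) 1 V := IsManifold.of_le (n := ∞) (by simp)
  have ho : IsOpen (extChartAt 𝓘(ℝ, E) x₀).target := isOpen_extChartAt_target x₀
  have hld : DifferentiableAt ℝ (lam.form.inChart x₀) y :=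
    ((lam.smooth.contDiffOn_inChart x₀).contDiffAt (ho.mem_nhds hy)).differentiableAt (by simp)
  have hy0 : y + (0 : ℝ) • v + (0 : ℝ) • w = y := by rw [zero_smul, zero_smul, add_zero, add_zero]
  -- The definition of d uses the preferred chart at the point itself. The surface formula is
  -- independent of charts, so evaluating it on a coordinate plane of the chart around x₀ compares
  -- the two.
  have hG : ContMDiffAt 𝓘(ℝ, ℝ × ℝ) 𝓘(ℝ, E) 2
      (fun q : ℝ × ℝ => (extChartAt 𝓘(ℝ, E) x₀).symm (y + q.1 • v + q.2 • w)) (0, 0) := by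
    have h1 : ContMDiffAt 𝓘(ℝ, ℝ × ℝ) 𝓘(ℝ, E) ∞ (fun q : ℝ × ℝ => y + q.1 • v + q.2 • w) (0, 0) := by
      rw [contMDiffAt_iff_contDiffAt]; fun_prop
    have h2 : y + ((0 : ℝ), (0 : ℝ)).1 • v + ((0 : ℝ), (0 : ℝ)).2 • w ∈
        (extChartAt 𝓘(ℝ, E) x₀).target := by rw [hy0]; exact hy
    have h3 : ContMDiffAt 𝓘(ℝ, E) 𝓘(ℝ, E) ∞ (extChartAt 𝓘(ℝ, E) x₀).symm
        (y + ((0 : ℝ), (0 : ℝ)).1 • v + ((0 : ℝ), (0 : ℝ)).2 • w) :=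
      (contMDiffOn_extChartAt_symm x₀).contMDiffAt (ho.mem_nhds h2)
    exact (ContMDiffAt.comp ((0 : ℝ), (0 : ℝ)) h3 h1).of_le (by norm_cast)
  have key := OneForm.d_velocity_velocity lam.smooth hG
  have hmem : ∀ u : E, ∀ᶠ ε : ℝ in nhds 0, y + ε • u ∈ (extChartAt 𝓘(ℝ, E) x₀).target := fun u => by
    have h1 : ContinuousAt (fun ε : ℝ => y + ε • u) 0 := by fun_prop
    refine h1.preimage_mem_nhds (ho.mem_nhds ?_)
    rw [zero_smul, add_zero]; exact hy
  have e1 : (fun τ : ℝ => lam.form.ev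
      (fun ε : ℝ => (extChartAt 𝓘(ℝ, E) x₀).symm (y + τ • v + ε • w)) 0) =ᶠ[nhds 0]
      fun τ => lam.form.inChart x₀ (y + τ • v) w := by
    filter_upwards [hmem v] with τ hτ
    exact lam.form.ev_chartLine x₀ hτ w
  have e2 : (fun ε : ℝ => lam.form.ev
      (fun τ : ℝ => (extChartAt 𝓘(ℝ, E) x₀).symm (y + τ • v + ε • w)) 0) =ᶠ[nhds 0]
      fun ε => lam.form.inChart x₀ (y + ε • w) v := by
    filter_upwards [hmem w] with ε hε
    rw [← lam.form.ev_chartLine x₀ hε v]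
    congr 1
    funext τ
    rw [add_right_comm]
  have e1' := e1.deriv_eq.trans (hasDerivAt_lineApply hld v w).deriv
  have e2' := e2.deriv_eq.trans (hasDerivAt_lineApply hld w v).deriv
  have h1 : ∀ (z z' : V) (p q p' q' : E), z' = z → p = p' → q = q' →
      lam.form.d z p q = lam.form.d z' p' q' := by
    rintro z _ p q _ _ rfl rfl rfl; rfl
  rw [extD_apply, ← e1', ← e2']
  refine Eq.trans ?_ key
  refine h1 _ _ _ _ _ _ (congrArg _ hy0) ?_ ?_
  · refine (velocity_chartLine x₀ hy v).symm.trans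
      (velocity_congr (Filter.Eventually.of_forall fun τ => ?_))
    change _ = (extChartAt 𝓘(ℝ, E) x₀).symm (y + τ • v + (0 : ℝ) • w)
    rw [zero_smul, add_zero]
  · refine (velocity_chartLine x₀ hy w).symm.trans
      (velocity_congr (Filter.Eventually.of_forall fun τ => ?_))
    change _ = (extChartAt 𝓘(ℝ, E) x₀).symm (y + (0 : ℝ) • v + τ • w)
    rw [zero_smul, add_zero]

variable (lam) in
/-- The orbit of a point under the group of contactomorphisms. -/
def contactOrbit (x : V) : Set V := {y | ∃ g : Equiv.Perm V,
  IsContactFamily lam (fun _ : ℝ => g) ∧ g x = y}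

theorem isContactFamily_const {g : Equiv.Perm V} (h1 : ContMDiff 𝓘(ℝ, E) 𝓘(ℝ, E) ∞ g)
    (h2 : ContMDiff 𝓘(ℝ, E) 𝓘(ℝ, E) ∞ g.symm) (h3 : PreservesContact lam g) :
    IsContactFamily lam (fun _ : ℝ => g) :=
  ⟨⟨h1.comp contMDiff_snd, h2.comp contMDiff_snd⟩, fun _ => h3⟩

/-- Contactomorphisms move a point to all nearby points. -/
theorem contactOrbit_mem_nhds [T2Space V] (a : ReebCircleAction lam) (x₀ : V) :
    contactOrbit lam x₀ ∈ nhds x₀ := by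
  have : IsManifold 𝓘(ℝ, E) 1 V := IsManifold.of_le (n := ∞) (by simp)
  have : CompleteSpace E := FiniteDimensional.complete ℝ E
  set c := extChartAt 𝓘(ℝ, E) x₀ with hc
  set l := lam.form.inChart x₀
  have htgt : c.target = (chartAt E x₀).target := by simp [hc]
  set Ω := (chartAt E x₀).target
  have hΩ : IsOpen Ω := (chartAt E x₀).open_target
  have hl : ContDiffOn ℝ ∞ l Ω := by
    have := lam.smooth.contDiffOn_inChart x₀
    rwa [← hc, htgt] at this
  have hinv : ∀ y ∈ Ω, ∃ e : E ≃L[ℝ] E,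
      (e : E →L[ℝ] E) = mfderiv 𝓘(ℝ, E) 𝓘(ℝ, E) c.symm y := by
    intro y hy
    have h1 := isInvertible_mfderivWithin_extChartAt_symm (I := 𝓘(ℝ, E)) (x := x₀) (y := y)
      (by rw [← hc, htgt]; exact hy)
    rw [ModelWithCorners.range_eq_univ, mfderivWithin_univ] at h1
    exact h1
  have hnd : ∀ y ∈ Ω, ∀ v, l y v = 0 → v ≠ 0 → ∃ w, l y w = 0 ∧ extD l y v w ≠ 0 := by
    intro y hy v hv hv0
    obtain ⟨e, he⟩ := hinv y hy
    have hy' : y ∈ c.target := by rw [htgt]; exact hy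
    have happ : ∀ u, (show E from mfderiv 𝓘(ℝ, E) 𝓘(ℝ, E) c.symm y u) = e u := fun u => by
      exact (DFunLike.congr_fun he u).symm
    obtain ⟨w, hw1, hw2⟩ := lam.nondegenerate (c.symm y)
      (mfderiv 𝓘(ℝ, E) 𝓘(ℝ, E) c.symm y v) hv
      (fun h => hv0 (e.injective (by rw [map_zero]; exact (happ v).symm.trans h)))
    obtain ⟨w', hw'⟩ := e.surjective w
    have hw'' : (show E from mfderiv 𝓘(ℝ, E) 𝓘(ℝ, E) c.symm y w') = w := (happ w').trans hw'
    refine ⟨w', ?_, ?_⟩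
    · exact (congrArg (fun u : E => (show E →L[ℝ] ℝ from lam.form (c.symm y)) u) hw'').trans hw1
    · rw [← d_eq_extD_inChart x₀ hy' v w']
      intro h
      apply hw2
      refine Eq.trans ?_ h
      exact congrArg (fun u : E => lam.form.d (c.symm y)
        (mfderiv 𝓘(ℝ, E) 𝓘(ℝ, E) c.symm y v) u) hw''.symm
  have hR : ∀ y ∈ Ω, ∃ r, l y r = 1 ∧ ∀ w, extD l y r w = 0 := by
    intro y hy
    obtain ⟨e, he⟩ := hinv y hy
    have hy' : y ∈ c.target := by rw [htgt]; exact hy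
    have happ : ∀ u, (show E from mfderiv 𝓘(ℝ, E) 𝓘(ℝ, E) c.symm y u) = e u := fun u => by
      exact (DFunLike.congr_fun he u).symm
    set x := c.symm y
    obtain ⟨r', hr'1, hr'2⟩ : ∃ r' : E, lam.form x r' = 1 ∧ ∀ w : E, lam.form.d x r' w = 0 := by
      have h1 : ∀ z : V, z = x → (∃ r' : E, lam.form z r' = 1 ∧ ∀ w : E, lam.form.d z r' w = 0) →
          ∃ r' : E, lam.form x r' = 1 ∧ ∀ w : E, lam.form.d x r' w = 0 := by
        rintro _ rfl h; exact h
      exact h1 (a.e 0 x) (a.zero x) ⟨_, a.form_velocity 0 x, a.d_velocity 0 x⟩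
    obtain ⟨r, rfl⟩ := e.surjective r'
    refine ⟨r, ?_, fun w => ?_⟩
    · exact (congrArg (fun u : E => (show E →L[ℝ] ℝ from lam.form x) u) (happ r)).trans hr'1
    · rw [← d_eq_extD_inChart x₀ hy' r w]
      refine Eq.trans ?_ (hr'2 (mfderiv 𝓘(ℝ, E) 𝓘(ℝ, E) c.symm y w))
      exact congrArg (fun u : E => lam.form.d x u (mfderiv 𝓘(ℝ, E) 𝓘(ℝ, E) c.symm y w)) (happ r)
  set y₀ := chartAt E x₀ x₀
  have hy₀ : y₀ ∈ Ω := mem_chart_target E x₀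
  obtain ⟨A, hA, hAc, hAΩ, hA0, ρ, hρ, hAρ⟩ := exists_contactFields hΩ hl hnd hR hy₀
  obtain ⟨δ, hδ, φ, hφ, hφ0, hφinv, hφfix, hode⟩ := exists_flow hA hAc
  have hφat : ∀ q : E × E, q.1 ∈ Metric.ball (0 : E) δ → ContDiffAt ℝ ∞ φ q := fun q hq =>
    hφ.contDiffAt ((Metric.isOpen_ball.prod isOpen_univ).mem_nhds ⟨hq, mem_univ _⟩)
  have hneg : ∀ v ∈ Metric.ball (0 : E) δ, -v ∈ Metric.ball (0 : E) δ := by simp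
  let ψ : ∀ v ∈ Metric.ball (0 : E) δ, Equiv.Perm E := fun v hv =>
    ⟨fun x => φ (v, x), fun x => φ (-v, x), hφinv v hv, fun x => by
      have := hφinv (-v) (hneg v hv) x
      rwa [neg_neg] at this⟩
  have hsuppψ : ∀ v hv, ∀ y ∉ tsupport A, ψ v hv y = y := fun v hv y hy =>
    hφfix v hv y (image_eq_zero_of_notMem_tsupport hy)
  have hΩψ : ∀ v hv, ∀ y, y ∈ Ω ↔ ψ v hv y ∈ Ω := by
    intro v hv y
    by_cases hA0 : A y = 0
    · have : ψ v hv y = y := hφfix v hv y hA0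
      rw [this]
    -- Zeros of A are fixed points, so by injectivity no other point is carried to a zero. Hence
    -- both y and its image lie in the support of A, inside Ω.
    · have h1 : A (ψ v hv y) ≠ 0 := by
        intro h
        have h2 : ψ v hv (ψ v hv y) = ψ v hv y := hφfix v hv _ h
        have h3 := (ψ v hv).injective h2
        rw [h3] at h
        exact hA0 h
      exact ⟨fun _ => hAΩ (subset_tsupport _ h1), fun _ => hAΩ (subset_tsupport _ hA0)⟩
  have hψs : ∀ v hv, ContDiff ℝ ∞ (ψ v hv) := fun v hv => contDiff_iff_contDiffAt.2 fun x => by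
    have h1 : ContDiffAt ℝ ∞ (fun x : E => (v, x)) x := by fun_prop
    exact ContDiffAt.comp x (f := fun x : E => (v, x)) (g := φ) (hφat (v, x) hv) h1
  have hmove : ∀ v (hv : v ∈ Metric.ball (0 : E) δ),
      (chartAt E x₀).symm (φ (v, y₀)) ∈ contactOrbit lam x₀ := by
    intro v hv
    refine ⟨chartPerm x₀ (ψ v hv) (hΩψ v hv), isContactFamily_const ?_ ?_ ?_,
      chartPerm_of_mem (mem_chart_source E x₀)⟩
    · exact contMDiff_chartPerm hAc hAΩ (hsuppψ v hv) (hψs v hv)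
    · have hsymm : (ψ v hv).symm = ψ (-v) (hneg v hv) := by ext x; rfl
      rw [chartPerm_symm (by rw [hsymm]; exact hΩψ (-v) (hneg v hv))]
      refine contMDiff_chartPerm hAc hAΩ ?_ ?_
      · rw [hsymm]; exact hsuppψ (-v) (hneg v hv)
      · rw [hsymm]; exact hψs (-v) (hneg v hv)
    · refine preservesContact_chartPerm hAc hAΩ (hsuppψ v hv) (hψs v hv) fun y hy => ?_
      exact flow_scales hΩ hl hA hρ hAρ hφ hφ0 hode
        (fun v hv y hy => (hΩψ v hv y).1 hy) hv hy
  -- the time-one maps move `y₀` over a neighbourhood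
  set F : E → E := fun v => φ (v, y₀) with hF
  have hFs : ContDiffAt ℝ ∞ F 0 := by
    have h1 : ContDiffAt ℝ ∞ (fun v : E => (v, y₀)) 0 := by fun_prop
    exact ContDiffAt.comp (0 : E) (f := fun v : E => (v, y₀)) (g := φ)
      (hφat (0, y₀) (by simpa using hδ)) h1
  have hFstrict : HasStrictFDerivAt F (fderiv ℝ F 0) 0 :=
    hFs.hasStrictFDerivAt (by simp)
  -- F (τ v) is the trajectory through y₀ with initial velocity A(y₀) v = v. So DF(0) is the
  -- identity, and F maps a ball onto a neighbourhood of y₀.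
  have hFd : ∀ v ∈ Metric.ball (0 : E) δ, fderiv ℝ F 0 v = v := by
    intro v hv
    have h1 := hode v hv y₀ 0 (by simp)
    rw [zero_smul, hφ0, hA0] at h1
    have h2 : HasDerivAt (fun τ : ℝ => τ • v) v 0 := by
      simpa using (hasDerivAt_id (0 : ℝ)).smul_const v
    have h3 : HasFDerivAt F (fderiv ℝ F 0) ((0 : ℝ) • v) := by
      simpa using hFstrict.hasFDerivAt
    have h4 := (h3.comp_hasDerivAt (0 : ℝ) h2).hasDerivWithinAt (s := Icc 0 1)
    exact ((uniqueDiffOn_Icc zero_lt_one) 0 (by simp)).eq_deriv _ h4 h1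
  have hsurj : (fderiv ℝ F 0).range = ⊤ := by
    rw [LinearMap.range_eq_top]
    intro v
    obtain ⟨s, hs, hsv⟩ : ∃ s : ℝ, s ≠ 0 ∧ s • v ∈ Metric.ball (0 : E) δ := by
      have h1 : ContinuousAt (fun s : ℝ => s • v) 0 := by fun_prop
      have h2 : ∀ᶠ s : ℝ in nhds 0, s • v ∈ Metric.ball (0 : E) δ :=
        h1.preimage_mem_nhds (by simpa using Metric.ball_mem_nhds (0 : E) hδ)
      obtain ⟨η, hη, hη'⟩ := Metric.eventually_nhds_iff.1 h2
      refine ⟨η / 2, by positivity, hη' ?_⟩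
      rw [Real.dist_eq, sub_zero, abs_of_pos (by positivity)]
      linarith
    refine ⟨v, ?_⟩
    have h1 := hFd _ hsv
    rw [map_smul] at h1
    exact smul_right_injective E hs h1
  have hmap := hFstrict.map_nhds_eq_of_surj hsurj
  have hF0 : F 0 = y₀ := hφ0 y₀
  rw [hF0] at hmap
  have himg : F '' Metric.ball 0 δ ∈ nhds y₀ := by
    rw [← hmap]
    exact Filter.image_mem_map (Metric.ball_mem_nhds 0 hδ)
  have hcont : ContinuousAt (chartAt E x₀) x₀ :=
    (chartAt E x₀).continuousAt (mem_chart_source E x₀)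
  filter_upwards [hcont.preimage_mem_nhds himg, chart_source_mem_nhds E x₀] with x hx hxs
  obtain ⟨v, hv, hvx⟩ := hx
  have h1 := hmove v hv
  have h2 : φ (v, y₀) = chartAt E x₀ x := hvx
  rw [h2, (chartAt E x₀).left_inv hxs] at h1
  exact h1

/-- Contactomorphisms act transitively. -/
theorem exists_contactomorphism [T2Space V] [ConnectedSpace V] (a : ReebCircleAction lam)
    (x y : V) : ∃ g : Equiv.Perm V, IsContactFamily lam (fun _ : ℝ => g) ∧ g x = y := by
  have htrans : ∀ {p q r : V}, q ∈ contactOrbit lam p → r ∈ contactOrbit lam q →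
      r ∈ contactOrbit lam p := by
    rintro p _ _ ⟨g, hg, rfl⟩ ⟨k, hk, rfl⟩
    exact ⟨k * g, hk.mul hg, rfl⟩
  have hsymm : ∀ {p q : V}, q ∈ contactOrbit lam p → p ∈ contactOrbit lam q := by
    rintro p _ ⟨g, hg, rfl⟩
    exact ⟨g⁻¹, hg.inv, g.symm_apply_apply p⟩
  have hopen : IsOpen (contactOrbit lam x) := isOpen_iff_mem_nhds.2 fun p hp =>
    Filter.mem_of_superset (contactOrbit_mem_nhds a p) fun q hq => htrans hp hq
  -- The complement of an orbit is a union of orbits, each of them open.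
  have hclosed : IsClosed (contactOrbit lam x) := by
    rw [← isOpen_compl_iff, isOpen_iff_mem_nhds]
    intro p hp
    exact Filter.mem_of_superset (contactOrbit_mem_nhds a p) fun q hq hq' =>
      hp (htrans hq' (hsymm hq))
  have hne : (contactOrbit lam x).Nonempty := ⟨x, mem_of_mem_nhds (contactOrbit_mem_nhds a x)⟩
  have huniv := IsClopen.eq_univ ⟨hclosed, hopen⟩ hne
  have : y ∈ contactOrbit lam x := huniv ▸ mem_univ y
  exact this

end Transitivity

/-! ### Smooth time changes -/

section Stairs

/-- A smooth monotone function that is `0` for `t ≤ 1/3` and `1` for `t ≥ 2/3`. -/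
def ramp (t : ℝ) : ℝ := Real.smoothTransition (3 * t - 1)

theorem contDiff_ramp : ContDiff ℝ ∞ ramp :=
  Real.smoothTransition.contDiff.comp (by fun_prop)

theorem monotone_ramp : Monotone ramp := fun s t h =>
  Real.smoothTransition.monotone (by linarith)

theorem ramp_eq_zero {t : ℝ} (h : t ≤ 1 / 3) : ramp t = 0 :=
  Real.smoothTransition.zero_of_nonpos (by linarith)

theorem ramp_eq_one {t : ℝ} (h : 2 / 3 ≤ t) : ramp t = 1 :=
  Real.smoothTransition.one_of_one_le (by linarith)

theorem ramp_mem_Icc (t : ℝ) : ramp t ∈ Icc (0 : ℝ) 1 :=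
  ⟨Real.smoothTransition.nonneg _, Real.smoothTransition.le_one _⟩

theorem exists_ramp_eq {s : ℝ} (hs : s ∈ Icc (0 : ℝ) 1) : ∃ t, ramp t = s := by
  have h := intermediate_value_Icc (zero_le_one' ℝ) contDiff_ramp.continuous.continuousOn
  rw [ramp_eq_zero (t := 0) (by norm_num), ramp_eq_one (t := 1) (by norm_num)] at h
  obtain ⟨t, -, ht⟩ := h hs
  exact ⟨t, ht⟩

/-- A smooth monotone staircase, constant near the integers. -/
def stair (t : ℝ) : ℝ := ⌊t⌋ + ramp (Int.fract t)

/-- The ramp is flat near both ends of the unit interval, so one formula continues past the jump of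
the floor at n. These overlapping intervals give smoothness. -/
theorem stair_eq {n : ℤ} {t : ℝ} (h1 : n - 1 / 3 < t) (h2 : t < n + 1) :
    stair t = n + ramp (t - n) := by
  unfold stair
  rcases le_or_gt (n : ℝ) t with h | h
  · have hn : ⌊t⌋ = n := Int.floor_eq_iff.2 ⟨h, h2⟩
    rw [Int.fract, hn]
  · have hn : ⌊t⌋ = n - 1 := Int.floor_eq_iff.2 ⟨by push_cast; linarith, by push_cast; linarith⟩
    rw [Int.fract, hn, ramp_eq_one (by push_cast; linarith), ramp_eq_zero (by linarith)]
    push_cast; ring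

theorem stair_eventuallyEq (t : ℝ) :
    stair =ᶠ[nhds t] fun τ => ⌊t⌋ + ramp (τ - ⌊t⌋) := by
  have h1 := Int.floor_le t
  have h2 := Int.lt_floor_add_one t
  filter_upwards [Ioo_mem_nhds (show (⌊t⌋ : ℝ) - 1 / 3 < t by linarith) h2] with τ hτ
  exact stair_eq hτ.1 hτ.2

theorem contDiff_stair : ContDiff ℝ ∞ stair := contDiff_iff_contDiffAt.2 fun t => by
  have h : ContDiff ℝ ∞ (fun τ : ℝ => ⌊t⌋ + ramp (τ - ⌊t⌋)) :=
    contDiff_const.add (contDiff_ramp.comp (by fun_prop))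
  exact h.contDiffAt.congr_of_eventuallyEq (stair_eventuallyEq t)

theorem deriv_stair_nonneg (t : ℝ) : 0 ≤ deriv stair t := by
  rw [(stair_eventuallyEq t).deriv_eq]
  have h : Monotone (fun τ : ℝ => ⌊t⌋ + ramp (τ - ⌊t⌋)) := fun s s' h =>
    add_le_add_right (monotone_ramp (by linarith)) _
  exact h.deriv_nonneg

theorem stair_add_one (t : ℝ) : stair (t + 1) = stair t + 1 := by
  unfold stair
  rw [Int.floor_add_one, Int.fract_add_one]
  push_cast; ring

theorem stair_eq_int {n : ℤ} {t : ℝ} (h : |t - n| < 1 / 3) : stair t = n := by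
  rw [abs_lt] at h
  rw [stair_eq (n := n) (by linarith) (by linarith), ramp_eq_zero (by linarith), add_zero]

/-- A perturbation of the staircase with positive derivative. -/
def slope (ε t : ℝ) : ℝ := ε * t + (1 - ε) * stair t

theorem contDiff_slope (ε : ℝ) : ContDiff ℝ ∞ (slope ε) :=
  (contDiff_const.mul contDiff_id).add (contDiff_const.mul contDiff_stair)

theorem deriv_slope_pos {ε : ℝ} (h0 : 0 < ε) (h1 : ε ≤ 1) (t : ℝ) : 0 < deriv (slope ε) t := by
  have h2 := (contDiff_stair.differentiable (by simp) t).hasDerivAt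
  have h3 := ((hasDerivAt_id t).const_mul ε).add (h2.const_mul (1 - ε))
  have h4 : deriv (slope ε) t = ε * 1 + (1 - ε) * deriv stair t := h3.deriv
  rw [h4]
  have := mul_nonneg (sub_nonneg.2 h1) (deriv_stair_nonneg t)
  linarith

theorem slope_add_one (ε t : ℝ) : slope ε (t + 1) = slope ε t + 1 := by
  unfold slope
  rw [stair_add_one]; ring

/-- A loop reparametrized by `slope ε` stays ε/3-close to an integer time whenever |t - n| < 1/3. -/
theorem slope_eq {n : ℤ} {t : ℝ} (ε : ℝ) (h : |t - n| < 1 / 3) :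
    slope ε t = ε * (t - n) + n := by
  unfold slope
  rw [stair_eq_int h]; ring

end Stairs

/-! ### Making a non-negative contractible loop positive over a compact set -/

section Loops

variable {E : Type*} [NormedAddCommGroup E] [NormedSpace ℝ E]
  {V : Type*} [TopologicalSpace V] [ChartedSpace E V] [IsManifold 𝓘(ℝ, E) ∞ V]
  {lam : ContactForm E V}

theorem cham_mul_left (a : ReebCircleAction lam) {f : ℝ → Equiv.Perm V}
    (hf : IsSmoothFamily 𝓘(ℝ, E) f) {φ : Equiv.Perm V}
    (hφ : IsContactFamily lam (fun _ : ℝ => φ)) (t : ℝ) (x : V) :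
    cham lam (fun τ => φ * f τ) t x = conf a φ (f t x) * cham lam f t x :=
  ev_comp_contact a (hφ.2 0) (hφ.1.contMDiff 0) (hf.mdifferentiableAt_trajectory x t)

theorem cham_mul_right (f : ℝ → Equiv.Perm V) (φ : Equiv.Perm V) (t : ℝ) (x : V) :
    cham lam (fun τ => f τ * φ) t x = cham lam f t (φ x) := rfl

variable (lam) in
/-- A null-homotopy `f (u, ·)`, `u ∈ [0, 1]`, of the loop `f (1, ·)` of contactomorphisms, which is
generated by a non-negative contact Hamiltonian. -/
structure IsNonnegLoop (f : ℝ × ℝ → Equiv.Perm V) : Prop where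
  family : IsContactFamily lam f
  periodic : ∀ u t, f (u, t + 1) = f (u, t)
  zero : ∀ t, f (0, t) = 1
  nonneg : ∀ t x, 0 ≤ cham lam (fun τ => f (1, τ)) t x

variable {f g : ℝ × ℝ → Equiv.Perm V}

theorem IsContactFamily.slice (hf : IsContactFamily lam f) (u : ℝ) :
    IsContactFamily lam (fun t => f (u, t)) :=
  hf.comp (σ := fun t : ℝ => (u, t)) (by fun_prop)

namespace IsNonnegLoop

theorem one : IsNonnegLoop lam (1 : ℝ × ℝ → Equiv.Perm V) where
  family := ⟨IsSmoothFamily.one, fun _ => PreservesContact.id⟩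
  periodic _ _ := rfl
  zero _ := rfl
  nonneg t x := (cham_const 1 t x).ge

theorem mul (a : ReebCircleAction lam) (hf : IsNonnegLoop lam f) (hg : IsNonnegLoop lam g) :
    IsNonnegLoop lam (f * g) where
  family := hf.family.mul hg.family
  periodic u t := by simp only [Pi.mul_apply, hf.periodic, hg.periodic]
  zero t := by simp only [Pi.mul_apply, hf.zero, hg.zero, mul_one]
  nonneg t x := by
    have h := cham_mul a (hf.family.slice 1) (hg.family.slice 1) t x
    refine le_of_le_of_eq (add_nonneg (hf.nonneg t _)
      (mul_nonneg (hf.family.conf_pos a (1, t) _).le (hg.nonneg t x))) h.symm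

theorem conj (a : ReebCircleAction lam) (hf : IsNonnegLoop lam f) {φ : Equiv.Perm V}
    (hφ : IsContactFamily lam (fun _ : ℝ => φ)) : IsNonnegLoop lam (fun p => φ * (f p * φ⁻¹)) where
  family := by
    have h : IsContactFamily lam (fun _ : ℝ × ℝ => φ) := hφ.comp contDiff_fst
    exact h.mul (hf.family.mul h.inv)
  periodic u t := by simp only [hf.periodic]
  zero t := by simp only [hf.zero, one_mul, mul_inv_cancel]
  nonneg t x := by
    have h1 : IsContactFamily lam (fun τ => f (1, τ) * φ⁻¹) := (hf.family.slice 1).mul hφ.inv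
    rw [cham_mul_left a h1.1 hφ]
    exact mul_nonneg (hφ.conf_pos a 0 _).le (hf.nonneg t _)

theorem reparam (hf : IsNonnegLoop lam f) {σ : ℝ → ℝ} (hσ : ContDiff ℝ ∞ σ)
    (hσ1 : ∀ t, σ (t + 1) = σ t + 1) (hσ' : ∀ t, 0 ≤ deriv σ t) :
    IsNonnegLoop lam (fun p => f (p.1, σ p.2)) where
  family := hf.family.comp (contDiff_fst.prodMk (hσ.comp contDiff_snd))
  periodic u t := by simp only [hσ1, hf.periodic]
  zero t := hf.zero _
  nonneg t x := by
    have h := cham_reparam (lam := lam) (hf.family.slice 1).1 (hσ.differentiable (by simp) t) x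
    exact le_of_le_of_eq (mul_nonneg (hσ' t) (hf.nonneg _ x)) h.symm

theorem cham_shift (hf : IsNonnegLoop lam f) (s t : ℝ) (x : V) :
    cham lam (fun τ => f (1, τ + s)) t x = cham lam (fun τ => f (1, τ)) (t + s) x := by
  have h := cham_reparam (lam := lam) (hf.family.slice 1).1 (σ := fun τ => τ + s) (t := t)
    (by fun_prop) x
  refine h.trans ?_
  rw [deriv_add_const, deriv_id'', one_mul]

theorem shift (hf : IsNonnegLoop lam f) (s : ℝ) : IsNonnegLoop lam (fun p => f (p.1, p.2 + s)) :=
  hf.reparam (σ := fun t => t + s) (by fun_prop) (fun t => by ring) fun t => by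
    rw [deriv_add_const, deriv_id'']; exact zero_le_one

/-- Precomposition with a map independent of t does not affect the sign. It makes every loop of the
family start at the identity. -/
theorem normalize (hf : IsNonnegLoop lam f) :
    IsNonnegLoop lam (fun p => f p * (f (p.1, 0))⁻¹) where
  family := hf.family.mul (hf.family.comp (σ := fun p : ℝ × ℝ => (p.1, 0)) (by fun_prop)).inv
  periodic u t := by simp only [hf.periodic]
  zero t := by simp only [hf.zero, mul_one, inv_one]
  nonneg t x := hf.nonneg t _

theorem apply_add_int (hf : IsNonnegLoop lam f) (u t : ℝ) (n : ℤ) : f (u, t + n) = f (u, t) := by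
  induction n using Int.induction_on with
  | zero => simp
  | succ k ih => push_cast at ih ⊢; rw [← add_assoc, hf.periodic, ih]
  | pred k ih =>
    push_cast at ih ⊢
    rw [← ih, ← hf.periodic u (t + (-k - 1))]
    congr 2
    ring

theorem cham_add_int (hf : IsNonnegLoop lam f) (t : ℝ) (n : ℤ) (x : V) :
    cham lam (fun τ => f (1, τ)) (t + n) x = cham lam (fun τ => f (1, τ)) t x := by
  rw [← hf.cham_shift]
  simp only [hf.apply_add_int]

variable [FiniteDimensional ℝ E] [T2Space V] [ConnectedSpace V]

/-- A time shift moves the positivity to time 0, and conjugation by a contactomorphism moves it to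
any chosen point. Positivity is an open condition, and finitely many conjugates cover K; their
product is positive on all of K at time 0, because every factor is the identity there and
contributes non-negatively. -/
theorem exists_pos_at_zero (a : ReebCircleAction lam) (hf : IsNonnegLoop lam f) {t₀ : ℝ} {x₀ : V}
    (h0 : 0 < cham lam (fun τ => f (1, τ)) t₀ x₀) {K : Set V} (hK : IsCompact K) :
    ∃ F, IsNonnegLoop lam F ∧ (∀ u, F (u, 0) = 1) ∧
      ∀ x ∈ K, 0 < cham lam (fun τ => F (1, τ)) 0 x := by
  obtain ⟨F, hF, hF1, x₁, hFx⟩ : ∃ F, IsNonnegLoop lam F ∧ (∀ u, F (u, 0) = 1) ∧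
      ∃ x₁, 0 < cham lam (fun τ => F (1, τ)) 0 x₁ := by
    refine ⟨_, (hf.shift t₀).normalize, fun u => mul_inv_cancel _, f (1, 0 + t₀) x₀, ?_⟩
    change 0 < cham lam (fun τ => f (1, τ + t₀)) 0 ((f (1, 0 + t₀)).symm (f (1, 0 + t₀) x₀))
    rw [hf.cham_shift, zero_add, Equiv.symm_apply_apply]
    exact h0
  refine hK.induction_on (p := fun S => ∃ F, IsNonnegLoop lam F ∧ (∀ u, F (u, 0) = 1) ∧
      ∀ x ∈ S, 0 < cham lam (fun τ => F (1, τ)) 0 x) ?_ ?_ ?_ ?_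
  · exact ⟨1, one, fun _ => rfl, fun x hx => absurd hx (notMem_empty x)⟩
  · rintro S T hST ⟨G, hG, hG1, hGT⟩
    exact ⟨G, hG, hG1, fun x hx => hGT x (hST hx)⟩
  · rintro S T ⟨G, hG, hG1, hGS⟩ ⟨G', hG', hG1', hGT⟩
    refine ⟨G * G', hG.mul a hG', fun u => by simp [hG1, hG1'], fun x hx => ?_⟩
    have h := cham_mul a (hG.family.slice 1) (hG'.family.slice 1) 0 x
    refine lt_of_lt_of_eq ?_ h.symm
    simp only [hG1', Equiv.Perm.coe_one, id_eq]
    have hc := hG.family.conf_pos a (1, 0) x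
    rcases hx with hx | hx
    · exact add_pos_of_pos_of_nonneg (hGS x hx) (mul_nonneg hc.le (hG'.nonneg 0 x))
    · exact add_pos_of_nonneg_of_pos (hG.nonneg 0 x) (mul_pos hc (hGT x hx))
  · intro x _
    obtain ⟨φ, hφ, hφx⟩ := exists_contactomorphism a x₁ x
    have hG := hF.conj a hφ
    have hopen : IsOpen {y | 0 < cham lam (fun τ => φ * (F (1, τ) * φ⁻¹)) 0 y} := by
      have h1 := (contMDiff_cham (lam := lam) (hG.family.slice 1).1).continuous
      exact isOpen_lt continuous_const (h1.comp (by fun_prop : Continuous fun y : V => ((0 : ℝ), y)))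
    refine ⟨_, mem_nhdsWithin_of_mem_nhds (hopen.mem_nhds ?_), _, hG, fun u => ?_, fun y hy => hy⟩
    · have h1 : IsContactFamily lam (fun τ => F (1, τ) * φ⁻¹) := (hF.family.slice 1).mul hφ.inv
      rw [mem_ofPred_eq, cham_mul_left a h1.1 hφ, cham_mul_right]
      refine mul_pos (hφ.conf_pos a 0 _) ?_
      rw [← hφx, show φ⁻¹ (φ x₁) = x₁ from φ.symm_apply_apply x₁]
      exact hFx
    · simp only [hF1, one_mul, mul_inv_cancel]

/-- Positivity on {0} × K persists for times near 0 by compactness. Slowing the loop down near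
integer times stretches that short time to |t - n| < 1/3; the rest of the loop is run in the
remaining time. -/
theorem exists_pos_near_zero (a : ReebCircleAction lam) (hf : IsNonnegLoop lam f) {t₀ : ℝ} {x₀ : V}
    (h0 : 0 < cham lam (fun τ => f (1, τ)) t₀ x₀) {K : Set V} (hK : IsCompact K) :
    ∃ F, IsNonnegLoop lam F ∧ ∀ (t : ℝ) (n : ℤ) (x : V), |t - n| < 1 / 3 → F (1, t) x ∈ K →
      0 < cham lam (fun τ => F (1, τ)) t x := by
  obtain ⟨F, hF, hF1, hFK⟩ := hf.exists_pos_at_zero a h0 hK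
  have hopen : IsOpen {q : ℝ × V |
      0 < cham lam (fun τ => F (1, τ)) q.1 ((F (1, q.1)).symm q.2)} := by
    have h1 := (contMDiff_cham (lam := lam) (hF.family.slice 1).1).continuous
    have h2 := (hF.family.slice 1).1.2.continuous
    exact isOpen_lt continuous_const (h1.comp (continuous_fst.prodMk h2))
  obtain ⟨U, W, hU, -, h0U, hKW, hUW⟩ := generalized_tube_lemma (isCompact_singleton (x := (0 : ℝ)))
    hK hopen (by
      rintro ⟨s, y⟩ ⟨hs, hy⟩
      obtain rfl : s = 0 := hs
      simp only [mem_ofPred_eq, hF1]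
      exact hFK y hy)
  obtain ⟨δ, hδ, hδU⟩ := Metric.isOpen_iff.1 hU 0 (h0U rfl)
  set ε := min δ 1
  have hε : 0 < ε := lt_min hδ one_pos
  have hε1 : ε ≤ 1 := min_le_right _ _
  refine ⟨_, hF.reparam (contDiff_slope ε) (slope_add_one ε) fun t => (deriv_slope_pos hε hε1 t).le,
    fun t n x htn hx => ?_⟩
  have h := cham_reparam (lam := lam) (hF.family.slice 1).1
    ((contDiff_slope ε).differentiable (by simp) t) x
  refine lt_of_lt_of_eq (mul_pos (deriv_slope_pos hε hε1 t) ?_) h.symm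
  simp only at hx
  rw [slope_eq ε htn, hF.apply_add_int] at hx
  rw [slope_eq ε htn, hF.cham_add_int]
  have hU' : ε * (t - n) ∈ U := hδU (by
    rw [Metric.mem_ball, Real.dist_eq, sub_zero, abs_mul, abs_of_pos hε]
    have h1 : ε * |t - n| ≤ ε * (1 / 3) := mul_le_mul_of_nonneg_left htn.le hε.le
    have h2 : ε ≤ δ := min_le_left _ _
    linarith)
  have h3 := hUW (mk_mem_prod hU' (hKW hx))
  simpa using h3

/-- A non-negative contractible loop that is not constant yields a loop that is positive over a
given compact set. -/
theorem exists_pos (a : ReebCircleAction lam) (hf : IsNonnegLoop lam f) {t₀ : ℝ} {x₀ : V}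
    (h0 : 0 < cham lam (fun τ => f (1, τ)) t₀ x₀) {K : Set V} (hK : IsCompact K) :
    ∃ F, IsNonnegLoop lam F ∧ ∀ (t : ℝ) (x : V), F (1, t) x ∈ K →
      0 < cham lam (fun τ => F (1, τ)) t x := by
  obtain ⟨F, hF, hFK⟩ := hf.exists_pos_near_zero a h0 hK
  -- The second loop acts before F, so it must be positive at all points that some F (1, t) carries
  -- into K.
  set K' : Set V := (fun q : ℝ × V => (F (1, q.1)).symm q.2) '' (Icc 0 1 ×ˢ K)
  have hK' : IsCompact K' := (isCompact_Icc.prod hK).image (hF.family.slice 1).1.2.continuous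
  obtain ⟨G, hG, hGK⟩ := hf.exists_pos_near_zero a h0 hK'
  refine ⟨_, hF.mul a (hG.shift (1 / 2)), fun t x hx => ?_⟩
  have hx' : F (1, t) (G (1, t + 1 / 2) x) ∈ K := hx
  have h := cham_mul a (hF.family.slice 1) ((hG.shift (1 / 2)).family.slice 1) t x
  refine lt_of_lt_of_eq ?_ h.symm
  have hc := hF.family.conf_pos a (1, t) (G (1, t + 1 / 2) x)
  have h2 := (hG.shift (1 / 2)).nonneg t x
  by_cases ht : |t - round t| < 1 / 3
  · exact add_pos_of_pos_of_nonneg (hFK t (round t) _ ht hx') (mul_nonneg hc.le h2)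
  · refine add_pos_of_nonneg_of_pos (hF.nonneg t _) (mul_pos hc ?_)
    simp only
    rw [hG.cham_shift]
    have hmem : G (1, t + 1 / 2) x ∈ K' := by
      refine ⟨(Int.fract t, F (1, t) (G (1, t + 1 / 2) x)),
        ⟨⟨Int.fract_nonneg _, (Int.fract_lt_one _).le⟩, hx'⟩, ?_⟩
      have h3 := hF.apply_add_int 1 (Int.fract t) ⌊t⌋
      rw [Int.fract_add_floor] at h3
      simp only [← h3, Equiv.symm_apply_apply]
    -- If t is at distance at least 1/3 from its nearest integer, then t + 1/2 is within 1/6 of an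
    -- integer, so the half-shifted loop G is positive there.
    have hr := abs_sub_round t
    rw [not_lt, le_abs] at ht
    rw [abs_le] at hr
    rcases ht with ht | ht
    · refine hGK _ (round t + 1) x ?_ hmem
      rw [abs_lt]; push_cast; constructor <;> linarith
    · refine hGK _ (round t) x ?_ hmem
      rw [abs_lt]; constructor <;> linarith

theorem cham_eq_zero (a : ReebCircleAction lam) (hf : IsNonnegLoop lam f)
    {A B : Set (SV V)} (hAB : StableIntersectionProperty lam A B) (t : ℝ) (x : V) :
    cham lam (fun τ => f (1, τ)) t x = 0 := by
  by_contra hne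
  obtain ⟨F, hF, hFB⟩ := hf.exists_pos a (lt_of_le_of_ne (hf.nonneg t x) (Ne.symm hne))
    (hAB.2.1.image continuous_fst)
  exact not_stableIntersectionProperty a hF.family hF.periodic hF.zero hFB hAB

end IsNonnegLoop

end Loops

/-! ### Contact isotopies with zero Hamiltonian -/

section Constant

variable {E : Type*} [NormedAddCommGroup E] [NormedSpace ℝ E] [FiniteDimensional ℝ E]
  {V : Type*} [TopologicalSpace V] [ChartedSpace E V] [IsManifold 𝓘(ℝ, E) ∞ V]
  {lam : ContactForm E V}

theorem eq_of_velocity_eq_zero {γ : ℝ → V} (hγ : MDifferentiable 𝓘(ℝ, ℝ) 𝓘(ℝ, E) γ)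
    (h : ∀ t, (show E from velocity 𝓘(ℝ, E) γ t) = 0) (s t : ℝ) : γ s = γ t := by
  have : IsManifold 𝓘(ℝ, E) 1 V := IsManifold.of_le (n := ∞) (by simp)
  have hloc : IsLocallyConstant γ := by
    refine (IsLocallyConstant.iff_eventually_eq γ).2 fun t => ?_
    set c := extChartAt 𝓘(ℝ, E) (γ t)
    have hsrc : ∀ᶠ τ in nhds t, γ τ ∈ c.source :=
      hγ.continuous.continuousAt.preimage_mem_nhds (extChartAt_source_mem_nhds (γ t))
    obtain ⟨δ, hδ, hball⟩ := Metric.eventually_nhds_iff_ball.1 hsrc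
    have hd : ∀ τ ∈ Metric.ball t δ, HasDerivAt (c ∘ γ) 0 τ := by
      intro τ hτ
      have h1 : MDifferentiableAt 𝓘(ℝ, E) 𝓘(ℝ, E) c (γ τ) :=
        mdifferentiableAt_extChartAt (by simpa [c] using hball τ hτ)
      have h2 := h1.comp τ (hγ τ)
      have h3 := velocity_comp h1 (hγ τ)
      have h4 : deriv (c ∘ γ) τ = 0 := by
        have h5 : deriv (c ∘ γ) τ = (show E from velocity 𝓘(ℝ, E) (fun τ => c (γ τ)) τ) := by
          change _ = (show ℝ →L[ℝ] E from mfderiv 𝓘(ℝ, ℝ) 𝓘(ℝ, E) (c ∘ γ) τ) 1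
          rw [mfderiv_eq_fderiv]
          exact fderiv_apply_one_eq_deriv.symm
        rw [h5]
        refine Eq.trans h3 ?_
        refine Eq.trans (congrArg (fun w : E =>
          (show E →L[ℝ] E from mfderiv 𝓘(ℝ, E) 𝓘(ℝ, E) c (γ τ)) w) (h τ)) ?_
        exact map_zero _
      rw [← h4]
      exact h2.differentiableAt.hasDerivAt
    filter_upwards [Metric.ball_mem_nhds t hδ] with τ hτ
    have h6 := Metric.isOpen_ball.is_const_of_deriv_eq_zero
      (convex_ball t δ).isPreconnected
      (fun τ hτ => (hd τ hτ).differentiableAt.differentiableWithinAt)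
      (fun τ hτ => (hd τ hτ).deriv) hτ (Metric.mem_ball_self hδ)
    exact c.injOn (hball τ hτ) (hball t (Metric.mem_ball_self hδ)) h6
  exact hloc.apply_eq_of_isPreconnected isPreconnected_univ (mem_univ s) (mem_univ t)

/-- A contact isotopy with vanishing contact Hamiltonian is constant. -/
theorem eq_of_cham_eq_zero (a : ReebCircleAction lam) {f : ℝ → Equiv.Perm V}
    (hf : IsContactFamily lam f) (h0 : ∀ t x, cham lam f t x = 0) (s t : ℝ) : f s = f t := by
  ext1 x
  refine eq_of_velocity_eq_zero (E := E) (γ := fun τ => f τ x)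
    (fun t => hf.1.mdifferentiableAt_trajectory x t) (fun t => ?_) s t
  by_contra hne
  -- A nonzero velocity would lie in the contact plane and pair nontrivially under dλ with some w
  -- there. On the surface f_τ (β ε), with β pulled back from a curve tangent to w, λ vanishes on
  -- ∂_τ by hypothesis and, at ε = 0, on ∂_ε because every f_τ preserves the contact planes; so dλ
  -- (∂_τ, ∂_ε) = 0.
  obtain ⟨w, hw, hdw⟩ := lam.nondegenerate (f t x) (velocity 𝓘(ℝ, E) (fun τ => f τ x) t)
    (h0 t x) hne
  obtain ⟨γ, hγ, hγ0, rfl⟩ := exists_curve (I := 𝓘(ℝ, E)) (f t x) w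
  set β : ℝ → V := fun ε => (f t).symm (γ ε) with hβ
  have hβs : ContMDiffAt 𝓘(ℝ, ℝ) 𝓘(ℝ, E) ∞ β 0 :=
    ((hf.1.inv.contMDiff t) (γ 0)).comp (0 : ℝ) hγ
  have hβ0 : β 0 = x := by simp [hβ, hγ0]
  have hG : ContMDiffAt 𝓘(ℝ, ℝ × ℝ) 𝓘(ℝ, E) 2 (fun q : ℝ × ℝ => f q.1 (β q.2)) (t, 0) := by
    have h1 : ContMDiffAt 𝓘(ℝ, ℝ × ℝ) 𝓘(ℝ, ℝ) ∞ (Prod.fst : ℝ × ℝ → ℝ) (t, 0) :=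
      contDiff_fst.contMDiff _
    have h2 : ContMDiffAt 𝓘(ℝ, ℝ × ℝ) 𝓘(ℝ, ℝ) ∞ (Prod.snd : ℝ × ℝ → ℝ) (t, 0) :=
      contDiff_snd.contMDiff _
    have h3 : ContMDiffAt 𝓘(ℝ, ℝ × ℝ) 𝓘(ℝ, E) ∞ (fun q : ℝ × ℝ => β q.2) (t, 0) :=
      ContMDiffAt.comp (g := β) (t, (0 : ℝ)) hβs h2
    have h4 := (hf.1.1 (t, β 0)).comp (t, (0 : ℝ)) (h1.prodMk h3)
    exact h4.of_le (by norm_cast)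
  have key := OneForm.d_velocity_velocity lam.smooth hG
  simp only at key
  have hevγ : lam.form.ev γ 0 = 0 := by
    refine Eq.trans ?_ hw
    exact lam.form.congr_point hγ0 _
  have hevβ : lam.form.ev β 0 = 0 := by
    have h1 := ev_comp_contact a (hf.2 t) (hf.1.contMDiff t) (hβs.mdifferentiableAt (by simp))
    have h2 : (fun ε => f t (β ε)) = γ := by
      funext ε; simp [hβ]
    rw [h2, hevγ] at h1
    exact (mul_eq_zero.1 h1.symm).resolve_left (hf.conf_pos a t _).ne'
  have e1 : (fun τ => lam.form.ev (fun ε => f τ (β ε)) 0) = fun _ => 0 := by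
    funext τ
    rw [ev_comp_contact a (hf.2 τ) (hf.1.contMDiff τ) (hβs.mdifferentiableAt (by simp)), hevβ,
      mul_zero]
  have e2 : (fun ε => lam.form.ev (fun τ => f τ (β ε)) t) = fun _ => 0 := by
    funext ε
    exact h0 t (β ε)
  rw [e1, e2, deriv_const, deriv_const, sub_zero] at key
  apply hdw
  have hc : ∀ (z z' : V) (p q p' q' : E), z' = z → p = p' → q = q' →
      lam.form.d z p q = lam.form.d z' p' q' := by
    rintro z _ p q _ _ rfl rfl rfl; rfl
  refine Eq.trans (hc _ _ _ _ _ _ ?_ ?_ ?_) key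
  · rw [hβ0]
  · rw [hβ0]
  · refine velocity_congr (Filter.Eventually.of_forall fun ε => ?_)
    simp [hβ]

end Constant

/-! ### The order on the universal cover -/

section Order

variable {E : Type*} [NormedAddCommGroup E] [NormedSpace ℝ E]
  {V : Type*} [TopologicalSpace V] [ChartedSpace E V] [IsManifold 𝓘(ℝ, E) ∞ V]
  {lam : ContactForm E V} {a : ReebCircleAction lam}

theorem isContactFamily_of_mem {P : Type*} [NormedAddCommGroup P] [NormedSpace ℝ P]
    {f : P → Equiv.Perm V} (hf : f ∈ familyGroup a P) : IsContactFamily lam f :=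
  ⟨hf.1, hf.2.1⟩

/-- A path is non-negative if its contact Hamiltonian is. -/
def IsNonnegPath (f : pathGroup a) : Prop :=
  ∀ t ∈ Icc (0 : ℝ) 1, ∀ x, 0 ≤ cham lam f.1 t x

theorem IsNonnegPath.mul {f g : pathGroup a} (hf : IsNonnegPath f) (hg : IsNonnegPath g) :
    IsNonnegPath (f * g) := fun t ht x => by
  have h := cham_mul a (isContactFamily_of_mem f.2.1) (isContactFamily_of_mem g.2.1) t x
  exact le_of_le_of_eq (add_nonneg (hf t ht _)
    (mul_nonneg ((isContactFamily_of_mem f.2.1).conf_pos a t _).le (hg t ht x))) h.symm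

/-- A contact Hamiltonian is the positive number s times `cham`, taken at the preimage of the point
under the bijection f_t, so the two sign conditions agree. -/
theorem isNonneg_iff [FiniteDimensional ℝ E] {x : UniversalCover a} :
    IsNonneg x ↔ ∃ f : pathGroup a, UniversalCover.mk f = x ∧ IsNonnegPath f := by
  constructor
  · rintro ⟨f, hfx, h, hh, hpos⟩
    refine ⟨f, hfx, fun t ht x => ?_⟩
    have h1 := hpos t ht (f.1 t x, ⟨1, mem_Ioi.2 one_pos⟩)
    rw [hh.eq_cham] at h1
    simpa using h1
  · rintro ⟨f, hfx, hf⟩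
    exact ⟨f, hfx, _, isContactHamiltonian_cham a (isContactFamily_of_mem f.2.1) f.2.2,
      fun t ht z => mul_nonneg (mem_Ioi.1 z.2.2).le (hf t ht _)⟩

theorem IsNonneg.one [FiniteDimensional ℝ E] : IsNonneg (1 : UniversalCover a) :=
  isNonneg_iff.2 ⟨1, rfl, fun t _ x => (cham_const 1 t x).ge⟩

theorem IsNonneg.mul [FiniteDimensional ℝ E] {x y : UniversalCover a} (hx : IsNonneg x)
    (hy : IsNonneg y) : IsNonneg (x * y) := by
  obtain ⟨f, rfl, hf⟩ := isNonneg_iff.1 hx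
  obtain ⟨g, rfl, hg⟩ := isNonneg_iff.1 hy
  exact isNonneg_iff.2 ⟨f * g, rfl, hf.mul hg⟩

theorem const_mem_familyGroup (k : pathGroup a) (s : ℝ) :
    (fun _ : ℝ => k.1 s) ∈ familyGroup a ℝ :=
  familyGroup_comp a (σ := fun _ : ℝ => s) contDiff_const k.2.1

/-- The conjugate of a path by the endpoint of another path. -/
def conjEndpoint (k f : pathGroup a) : pathGroup a :=
  ⟨(fun _ => k.1 1) * f.1 * (fun _ => k.1 1)⁻¹,
    mul_mem (mul_mem (const_mem_familyGroup k 1) f.2.1) (inv_mem (const_mem_familyGroup k 1)), by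
    simp [f.2.2]⟩

/-- The homotopy is k_{t + u(1 - t)} f_t k_{t + u(1 - t)}⁻¹: at t = 0 it is constant because f_0 =
id, and at t = 1 the conjugator is always k_1. Unlike pointwise conjugation by k_t, conjugation by
the fixed map k_1 visibly keeps Hamiltonians non-negative. -/
theorem homotopic_conjEndpoint (k f : pathGroup a) :
    Homotopic a (k * f * k⁻¹) (conjEndpoint k f) := by
  have hk : (fun p : ℝ × ℝ => k.1 (p.2 + p.1 * (1 - p.2))) ∈ familyGroup a (ℝ × ℝ) :=
    familyGroup_comp a (σ := fun p : ℝ × ℝ => p.2 + p.1 * (1 - p.2)) (by fun_prop) k.2.1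
  have hf : (fun p : ℝ × ℝ => f.1 p.2) ∈ familyGroup a (ℝ × ℝ) :=
    familyGroup_comp a contDiff_snd f.2.1
  refine ⟨_, mul_mem (mul_mem hk hf) (inv_mem hk), fun t _ => ⟨?_, ?_⟩, fun u _ => ⟨?_, ?_⟩⟩
  · simp
  · simp [conjEndpoint]
  · simp [f.2.2]
  · simp

theorem IsNonneg.conj [FiniteDimensional ℝ E] {x : UniversalCover a} (hx : IsNonneg x)
    (y : UniversalCover a) : IsNonneg (y * x * y⁻¹) := by
  obtain ⟨f, rfl, hf⟩ := isNonneg_iff.1 hx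
  obtain ⟨k, rfl⟩ := QuotientGroup.mk_surjective y
  refine isNonneg_iff.2 ⟨conjEndpoint k f, ?_, fun t ht x => ?_⟩
  · exact ((UniversalCover.mk_eq_mk_iff _ _).2 (homotopic_conjEndpoint k f)).symm
  · have hk := isContactFamily_of_mem (const_mem_familyGroup k 1)
    have h := cham_mul_left a (isContactFamily_of_mem f.2.1).1 hk t ((k.1 1).symm x)
    exact le_of_le_of_eq (mul_nonneg (hk.conf_pos a 0 _).le (hf t ht _)) h.symm

theorem deriv_ramp_nonneg (t : ℝ) : 0 ≤ deriv ramp t := monotone_ramp.deriv_nonneg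

theorem cham_ramp {f : ℝ → Equiv.Perm V} (hf : IsContactFamily lam f) (t : ℝ) (x : V) :
    cham lam (fun τ => f (ramp τ)) t x = deriv ramp t * cham lam f (ramp t) x :=
  cham_reparam hf.1 (contDiff_ramp.differentiable (by simp) t) x

/-- A null-homotopy of a path, reparametrized to a smooth periodic family. -/
theorem isNonnegLoop_of_homotopic {f : pathGroup a} (hf : IsNonnegPath f)
    {h : ℝ × ℝ → Equiv.Perm V} (hh : h ∈ familyGroup a (ℝ × ℝ))
    (h1 : ∀ t ∈ Icc (0 : ℝ) 1, h (0, t) = f.1 t ∧ h (1, t) = 1)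
    (h2 : ∀ u ∈ Icc (0 : ℝ) 1, h (u, 0) = 1 ∧ h (u, 1) = 1) :
    IsNonnegLoop lam (fun p => h (1 - ramp p.1, ramp (Int.fract p.2))) := by
  -- The fractional part jumps at integers, but the ramp is flat there and the homotopy is the
  -- identity at both ends t = 0 and t = 1, so locally a smooth formula holds. In the other
  -- parameter, 1 - `ramp` reverses the homotopy, making u = 0 the constant loop, and stays in [0,
  -- 1], where the boundary conditions are known.
  have hloc : ∀ t₀ : ℝ, ∀ᶠ t in nhds t₀, ∀ u, h (1 - ramp u, ramp (Int.fract t)) =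
      h (1 - ramp u, ramp (t - ⌊t₀⌋)) := by
    intro t₀
    filter_upwards [Ioo_mem_nhds (show (⌊t₀⌋ : ℝ) - 1 / 3 < t₀ by linarith [Int.floor_le t₀])
      (Int.lt_floor_add_one t₀)] with t ht u
    have hu : 1 - ramp u ∈ Icc (0 : ℝ) 1 :=
      ⟨by linarith [(ramp_mem_Icc u).2], by linarith [(ramp_mem_Icc u).1]⟩
    rcases le_or_gt (⌊t₀⌋ : ℝ) t with hle | hlt
    · have hn : ⌊t⌋ = ⌊t₀⌋ := Int.floor_eq_iff.2 ⟨hle, ht.2⟩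
      rw [Int.fract, hn]
    · have hn : ⌊t⌋ = ⌊t₀⌋ - 1 :=
        Int.floor_eq_iff.2 ⟨by push_cast; linarith [ht.1], by push_cast; linarith⟩
      rw [Int.fract, hn, ramp_eq_one (t := t - ((⌊t₀⌋ - 1 : ℤ) : ℝ)) (by push_cast; linarith [ht.1]),
        ramp_eq_zero (t := t - ⌊t₀⌋) (by linarith), (h2 _ hu).1, (h2 _ hu).2]
  have hc : ∀ n : ℤ, IsContactFamily lam (fun p : ℝ × ℝ => h (1 - ramp p.1, ramp (p.2 - n))) := by
    intro n
    refine (isContactFamily_of_mem hh).comp (σ := fun p : ℝ × ℝ => (1 - ramp p.1, ramp (p.2 - n)))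
      (ContDiff.prodMk (contDiff_const.sub (contDiff_ramp.comp contDiff_fst))
        (contDiff_ramp.comp (contDiff_snd.sub contDiff_const)))
  refine ⟨⟨⟨fun q => ?_, fun q => ?_⟩, fun p => hh.2.1 _⟩, fun u t => ?_, fun t => ?_,
    fun t x => ?_⟩
  · refine ((hc ⌊q.1.2⌋).1.1 q).congr_of_eventuallyEq ?_
    have hq : Continuous fun q : (ℝ × ℝ) × V => q.1.2 := by fun_prop
    filter_upwards [hq.continuousAt.eventually (hloc q.1.2)] with r hr
    exact DFunLike.congr_fun (hr r.1.1) r.2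
  · refine ((hc ⌊q.1.2⌋).1.2 q).congr_of_eventuallyEq ?_
    have hq : Continuous fun q : (ℝ × ℝ) × V => q.1.2 := by fun_prop
    filter_upwards [hq.continuousAt.eventually (hloc q.1.2)] with r hr
    exact congrArg (fun φ : Equiv.Perm V => φ.symm r.2) (hr r.1.1)
  · simp only [Int.fract_add_one]
  · simp only [ramp_eq_zero (t := 0) (by norm_num), sub_zero]
    exact (h1 _ (ramp_mem_Icc _)).2
  · have e1 : (fun τ => h (1 - ramp 1, ramp (Int.fract τ))) =ᶠ[nhds t]
        fun τ => f.1 (ramp (τ - ⌊t⌋)) := by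
      filter_upwards [hloc t] with τ hτ
      rw [hτ 1, ramp_eq_one (t := 1) (by norm_num), sub_self]
      exact (h1 _ (ramp_mem_Icc _)).1
    have hf' := isContactFamily_of_mem f.2.1
    have hd : DifferentiableAt ℝ (fun τ : ℝ => ramp (τ - ⌊t⌋)) t :=
      (contDiff_ramp.comp (contDiff_id.sub contDiff_const)).differentiable (n := ∞) (by simp) t
    have hm : Monotone (fun τ : ℝ => ramp (τ - ⌊t⌋)) := fun s s' hs =>
      monotone_ramp (by linarith)
    have e2 := cham_reparam (lam := lam) hf'.1 hd x
    simp only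
    rw [cham_congr e1, e2]
    exact mul_nonneg hm.deriv_nonneg (hf _ (ramp_mem_Icc _) x)

/-- A non-negative path whose product with some non-negative path is contractible represents the
identity. -/
theorem mk_eq_one_of_homotopic_mul [FiniteDimensional ℝ E] [T2Space V] [ConnectedSpace V]
    {A B : Set (SV V)} (hAB : StableIntersectionProperty lam A B) {f g : pathGroup a}
    (hf : IsNonnegPath f) (hg : IsNonnegPath g) (hfg : Homotopic a (f * g) 1) :
    UniversalCover.mk f = 1 := by
  obtain ⟨h, hh, h1, h2⟩ := hfg
  have hend : (f * g).1 1 = 1 := by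
    rw [← (h1 1 (by simp)).1, (h2 0 (by simp)).2, ← (h2 1 (by simp)).2]
    exact (h1 1 (by simp)).2
  have hloop := isNonnegLoop_of_homotopic (hf.mul hg) hh h1 fun u hu =>
    ⟨(h2 u hu).1, (h2 u hu).2.trans hend⟩
  have hf' := isContactFamily_of_mem f.2.1
  have hg' := isContactFamily_of_mem g.2.1
  have hfr := hf'.comp contDiff_ramp
  have hgr := hg'.comp contDiff_ramp
  -- Outside (0, 1) the periodic loop no longer follows the path fg, but there the reparametrized f
  -- is locally constant.
  have hflat : ∀ t : ℝ, t ∉ Ioo (0 : ℝ) 1 → ∃ φ : Equiv.Perm V,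
      (fun τ => f.1 (ramp τ)) =ᶠ[nhds t] fun _ => φ := by
    intro t ht
    rw [mem_Ioo, not_and_or, not_lt, not_lt] at ht
    rcases ht with ht | ht
    · refine ⟨f.1 0, ?_⟩
      filter_upwards [Iio_mem_nhds (show t < 1 / 3 by linarith)] with τ hτ
      rw [ramp_eq_zero (le_of_lt hτ)]
    · refine ⟨f.1 1, ?_⟩
      filter_upwards [Ioi_mem_nhds (show 2 / 3 < t by linarith)] with τ hτ
      rw [ramp_eq_one (le_of_lt hτ)]
  have hzero : ∀ t x, cham lam (fun τ => f.1 (ramp τ)) t x = 0 := by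
    intro t y
    by_cases ht : t ∈ Ioo (0 : ℝ) 1
    · set x := (g.1 (ramp t)).symm y with hx
      have e0 := hloop.cham_eq_zero a hAB t x
      have e1 : (fun τ => h (1 - ramp 1, ramp (Int.fract τ))) =ᶠ[nhds t]
          (fun τ => f.1 (ramp τ)) * (fun τ => g.1 (ramp τ)) := by
        filter_upwards [Ioo_mem_nhds ht.1 ht.2] with τ hτ
        rw [Int.fract_eq_self.2 ⟨hτ.1.le, hτ.2⟩, ramp_eq_one (t := 1) (by norm_num), sub_self]
        exact (h1 _ (ramp_mem_Icc _)).1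
      simp only at e0
      rw [cham_congr e1, cham_mul a hfr hgr, cham_ramp hf', cham_ramp hg'] at e0
      -- By the product rule the vanishing Hamiltonian of fg is a sum of two non-negative terms, so
      -- the one belonging to f vanishes.
      have p1 := mul_nonneg (deriv_ramp_nonneg t) (hf _ (ramp_mem_Icc t) (g.1 (ramp t) x))
      have p2 := mul_nonneg (hf'.conf_pos a (ramp t) (g.1 (ramp t) x)).le
        (mul_nonneg (deriv_ramp_nonneg t) (hg _ (ramp_mem_Icc t) x))
      rw [cham_ramp hf', ← (g.1 (ramp t)).apply_symm_apply y, ← hx]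
      exact le_antisymm (by linarith) p1
    · obtain ⟨φ, hφ⟩ := hflat t ht
      rw [cham_congr hφ, cham_const]
  have hone : ∀ s ∈ Icc (0 : ℝ) 1, f.1 s = 1 := by
    intro s hs
    obtain ⟨t, rfl⟩ := exists_ramp_eq hs
    have h3 := eq_of_cham_eq_zero a hfr hzero t 0
    rw [h3, ramp_eq_zero (t := 0) (by norm_num), f.2.2]
  -- f is the identity on [0, 1], the only range that a homotopy sees; the constant homotopy
  -- therefore suffices.
  refine (UniversalCover.mk_eq_mk_iff f 1).2
    ⟨1, one_mem _, fun t ht => ⟨(hone t ht).symm, rfl⟩, fun u _ => ⟨rfl, (hone 1 (by simp)).symm⟩⟩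

theorem IsNonneg.eq_one [FiniteDimensional ℝ E] [T2Space V] [ConnectedSpace V]
    {A B : Set (SV V)} (hAB : StableIntersectionProperty lam A B) {x : UniversalCover a}
    (hx : IsNonneg x) (hx' : IsNonneg x⁻¹) : x = 1 := by
  obtain ⟨f, rfl, hf⟩ := isNonneg_iff.1 hx
  obtain ⟨g, hgf, hg⟩ := isNonneg_iff.1 hx'
  refine mk_eq_one_of_homotopic_mul hAB hf hg ((UniversalCover.mk_eq_mk_iff (f * g) 1).1 ?_)
  change UniversalCover.mk f * UniversalCover.mk g = 1
  rw [hgf, mul_inv_cancel]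

end Order

end ContactOrder

end

theorem theorem2p2
    {E : Type*} [NormedAddCommGroup E] [NormedSpace ℝ E] [FiniteDimensional ℝ E]
    {V : Type*} [TopologicalSpace V] [T2Space V] [SecondCountableTopology V] [ConnectedSpace V]
    [ChartedSpace E V] [IsManifold 𝓘(ℝ, E) ∞ V]
    (lam : ContactForm E V) (a : ReebCircleAction lam)
    (hAB : ∃ A B : Set (SV V), StableIntersectionProperty lam A B) :
    (∀ x : UniversalCover a, x ≽ x) ∧
    (∀ x y z : UniversalCover a, x ≽ y → y ≽ z → x ≽ z) ∧
    (∀ x y : UniversalCover a, x ≽ y → y ≽ x → x = y) ∧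
    (∀ x y z w : UniversalCover a, x ≽ y → z ≽ w → x * z ≽ y * w) := by
  obtain ⟨A, B, hAB⟩ := hAB
  refine ⟨fun x => ?_, fun x y z hxy hyz => ?_, fun x y hxy hyx => ?_, fun x y z w hxy hzw => ?_⟩
  · change IsNonneg (x * x⁻¹)
    rw [mul_inv_cancel]
    exact IsNonneg.one
  · change IsNonneg (x * z⁻¹)
    have h : x * z⁻¹ = (x * y⁻¹) * (y * z⁻¹) := by group
    rw [h]
    exact IsNonneg.mul hxy hyz
  · have h : y * x⁻¹ = (x * y⁻¹)⁻¹ := by group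
    have hyx' : IsNonneg (y * x⁻¹) := hyx
    rw [h] at hyx'
    exact mul_inv_eq_one.1 (IsNonneg.eq_one hAB hxy hyx')
  · change IsNonneg (x * z * (y * w)⁻¹)
    -- Bi-invariance reduces to closure of the non-negative classes under products and conjugation.
    have h : x * z * (y * w)⁻¹ = (x * y⁻¹) * (y * (z * w⁻¹) * y⁻¹) := by group
    rw [h]
    exact IsNonneg.mul hxy (IsNonneg.conj hzw y)
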